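/- **Setting.** Let $\Omega=\mathbb R^3$ or $\Omega=\mathbb T^3$ (a torus of some fixed period $L>0$), $-3<\gamma\le 1$, and let $B(v-u,\theta)=|v-u|^\gamma b(\theta)$ with $b$ measurable, $0\le b(\theta)\le C_b|\cos\theta|$ and $\cos\theta=(v-u)\cdot\omega/|v-u|$, $\omega\in\mathbb S^2$. Put $u'=u+[(v-u)\cdot\omega]\omega$, $v'=v-[(v-u)\cdot\omega]\omega$, $\mu(v)=(2\pi)^{-3/2}e^{-|v|^2/2}$, $w_\beta(v)=(1+|v|^2)^{\beta/2}$, $$\nu(v)=\int_{\mathbb R^3}\!\int_{\mathbb S^2}B(v-u,\theta)\mu(u)\,d\omega du,\qquad \Gamma(g,g)=\frac1{\sqrt\mu}Q(\sqrt\mu g,\sqrt\mu g),$$ $$Q(F_1,F_2)(v)=\int_{\mathbb R^3}\!\int_{\mathbb S^2}B(v-u,\theta)\,[F_1(u')F_2(v')-F_1(u)F_2(v)]\,d\omega du,$$ $$Kg(v)=\int_{\mathbb R^3}\!\int_{\mathbb S^2}B(v-u,\theta)\Big[\sqrt{\mu(u)\mu(u')}\,g(v')+\sqrt{\mu(u)\mu(v')}\,g(u')-\sqrt{\mu(v)\mu(u)}\,g(u)\Big]d\omega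 du .$$ Let $F=\mu+\sqrt\mu f\ge 0$ be a mild solution of the Boltzmann equation on $[0,T]$ with initial datum $F_0=\mu+\sqrt\mu f_0$: $f$ is measurable, $\sup_{0\le s\le T}\|w_\beta f(s)\|_{L^\infty(\Omega\times\mathbb R^3)}<\infty$, and for every $t\in[0,T]$ and almost every $(x,v)$ $$f(t,x,v)=e^{-\nu(v)t}f_0(x-vt,v)+\int_0^te^{-\nu(v)(t-s)}\big[Kf+\Gamma(f,f)\big](s,x-v(t-s),v)\,ds .$$ Assume that $F-\mu$, $|v|^2(F-\mu)$ and $F\ln F-\mu\ln\mu$ are integrable over $\Omega\times\mathbb R^3$ at each time $t\in[0,T]$, and that $F$ conserves the defect mass and energy and does not exceed the initial defect entropy: for $t\in[0,T]$, $$\iint (F(t)-\mu)\,dvdx=\iint(F_0-\mu)\,dvdx=:M_0,\qquad \iint |v|^2(F(t)-\mu)\,dvdx=\iint|v|^2(F_0-\mu)\,dvdx=:E_0,$$ $$\iint (F(t)\ln F(t)-\mu\ln\mu)\,dvdx\le\iint(F_0\ln F_0-\mu\ln\mu)\,dvdx .$$ Put $$\mathcal E(F_0)=\iint(F_0\ln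 F_0-\mu\ln\mu)\,dvdx+\Big[\tfrac32\ln(2\pi)-1\Big]M_0+\tfrac12E_0,\qquad h=w_\beta f,\qquad p=1+\frac{3+\gamma}{4(9-\gamma)} .$$ **Lemma 3.3.** Let $\beta>\max\{3,3+\gamma\}$. There are positive constants $C$, $C_m$ (for each $m>0$) and $C_N$ (for each $N\ge1$), depending only on $\Omega$, $b$, $\gamma$, $\beta$ and, where indicated, on $m$ or on $N$, such that for every $f$ as above, every $t\in[0,T]$ and almost every $x\in\Omega$, for all $\lambda>0$, $m>0$, $N\ge1$, $$\begin{aligned}\int_{\mathbb R^3}|f(t,x,v)|\,dv\le{}&\int_{\mathbb R^3}e^{-\nu(v)t}|f_0(x-vt,v)|\,dv+C_N\lambda^{-3/2}\sqrt{\mathcal E(F_0)}+C_N\lambda^{-3}\mathcal E(F_0)\\&+C\Big(m^{3+\gamma}+C_m\Big[\lambda+\frac1N+\frac1{N^{\beta-3}}\Big]\Big)\sup_{0\le s\le t}\Big\{\|h(s)\|_{L^\infty}+\|h(s)\|_{L^\infty}^2\Big\}\\&+C_N\lambda^{-3}\Big(\sqrt{\mathcal E(F_0)}+\mathcal E(F_0)\Big)^{1-\frac1p}\sup_{0\le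 s\le t}\|h(s)\|_{L^\infty}^{1+\frac1p}.\end{aligned}$$ -/

import Mathlib

open MeasureTheory Set
open scoped ENNReal

namespace Boltzmann

noncomputable section

/-- Velocity space, and the universal cover of the position space. -/
abbrev R3 : Type := EuclideanSpace ℝ (Fin 3)

/-- The unit sphere of `R3`. -/
abbrev S2 : Type := Metric.sphere (0 : R3) 1

/-- The measure `dω du` on `R3 × S2`: Lebesgue measure times surface measure. -/
def collisionMeasure : Measure (R3 × S2) :=
  (volume : Measure R3).prod (volume : Measure R3).toSphere

/-! ### The spatial domain -/

/-- The spatial domain `Ω`: the whole space, or the torus `(ℝ / Lℤ)³` of some period `L > 0`.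
Functions on the torus are represented by `L`-periodic functions on `R3`. -/
inductive SpatialDomain : Type
  | wholeSpace : SpatialDomain
  | torus (L : ℝ) (hL : 0 < L) : SpatialDomain

/-- The set over which one integrates in order to integrate over `Ω`: all of `R3`, or the
fundamental cell `[0, L)³` of the torus. -/
def SpatialDomain.cell : SpatialDomain → Set R3
  | .wholeSpace => univ
  | .torus L _ => {x | ∀ i, x i ∈ Ico 0 L}

/-- `g` is a function on `Ω`: no condition for the whole space, periodicity for the torus. -/
def SpatialDomain.IsFunctionOn {α : Type} : SpatialDomain → (R3 → α) → Prop
  | .wholeSpace, _ => True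
  | .torus L _, g => ∀ (i : Fin 3) (x : R3), g (x + EuclideanSpace.single i L) = g x

/-- The measure `dv dx` on `Ω × R3`. -/
def SpatialDomain.phaseMeasure (Ω : SpatialDomain) : Measure (R3 × R3) :=
  ((volume : Measure R3).restrict Ω.cell).prod volume

/-! ### The collision operator -/

/-- Angular cut-off: `b` is a measurable function of the angle `θ ∈ [0, π]` with
`0 ≤ b(θ) ≤ C |cos θ|`. -/
def IsCutoff (b : ℝ → ℝ) : Prop :=
  Measurable b ∧ ∃ C : ℝ, 0 < C ∧ ∀ θ ∈ Icc 0 Real.pi, 0 ≤ b θ ∧ b θ ≤ C * |Real.cos θ|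

/-- The collision kernel `B(z, θ) = |z|^γ b(θ)`, where `θ` is the angle between `z` and `ω`. -/
def kernelB (γ : ℝ) (b : ℝ → ℝ) (z : R3) (ω : S2) : ℝ :=
  ‖z‖ ^ γ * b (InnerProductGeometry.angle z (ω : R3))

/-- `u' = u + [(v - u) · ω] ω`. -/
def uPrime (v u : R3) (ω : S2) : R3 := u + (inner ℝ (v - u) (ω : R3)) • (ω : R3)

/-- `v' = v - [(v - u) · ω] ω`. -/
def vPrime (v u : R3) (ω : S2) : R3 := v - (inner ℝ (v - u) (ω : R3)) • (ω : R3)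

/-- The global Maxwellian `μ(v) = (2π)^{-3/2} exp(-|v|² / 2)`. -/
def maxwellian (v : R3) : ℝ :=
  1 / (2 * Real.pi) ^ (3 / 2 : ℝ) * Real.exp (-‖v‖ ^ 2 / 2)

/-- The gain term `Q₊(F₁, F₂)`. -/
def Qplus (γ : ℝ) (b : ℝ → ℝ) (F₁ F₂ : R3 → ℝ) (v : R3) : ℝ :=
  ∫ p : R3 × S2, kernelB γ b (v - p.1) p.2 * F₁ (uPrime v p.1 p.2) * F₂ (vPrime v p.1 p.2)
    ∂collisionMeasure

/-- The loss term `Q₋(F₁, F₂)`. -/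
def Qminus (γ : ℝ) (b : ℝ → ℝ) (F₁ F₂ : R3 → ℝ) (v : R3) : ℝ :=
  ∫ p : R3 × S2, kernelB γ b (v - p.1) p.2 * F₁ p.1 * F₂ v ∂collisionMeasure

/-- The collision term `Q = Q₊ - Q₋`. -/
def Q (γ : ℝ) (b : ℝ → ℝ) (F₁ F₂ : R3 → ℝ) (v : R3) : ℝ :=
  Qplus γ b F₁ F₂ v - Qminus γ b F₁ F₂ v

/-- The collision frequency `ν(v)`. -/
def nu (γ : ℝ) (b : ℝ → ℝ) (v : R3) : ℝ :=
  ∫ p : R3 × S2, kernelB γ b (v - p.1) p.2 * maxwellian p.1 ∂collisionMeasure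

/-- The operator `K₁`. -/
def K₁ (γ : ℝ) (b : ℝ → ℝ) (g : R3 → ℝ) (v : R3) : ℝ :=
  ∫ p : R3 × S2, kernelB γ b (v - p.1) p.2 * √(maxwellian v * maxwellian p.1) * g p.1
    ∂collisionMeasure

/-- The operator `K₂`. -/
def K₂ (γ : ℝ) (b : ℝ → ℝ) (g : R3 → ℝ) (v : R3) : ℝ :=
  (∫ p : R3 × S2, kernelB γ b (v - p.1) p.2
      * √(maxwellian p.1 * maxwellian (uPrime v p.1 p.2)) * g (vPrime v p.1 p.2)
    ∂collisionMeasure)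
  + ∫ p : R3 × S2, kernelB γ b (v - p.1) p.2
      * √(maxwellian p.1 * maxwellian (vPrime v p.1 p.2)) * g (uPrime v p.1 p.2)
    ∂collisionMeasure

/-- The operator `K = K₂ - K₁`. -/
def K (γ : ℝ) (b : ℝ → ℝ) (g : R3 → ℝ) (v : R3) : ℝ := K₂ γ b g v - K₁ γ b g v

/-- The nonlinear term `Γ(g, g) = μ^{-1/2} Q(√μ g, √μ g)`. -/
def Gam (γ : ℝ) (b : ℝ → ℝ) (g : R3 → ℝ) (v : R3) : ℝ :=
  1 / √(maxwellian v)
    * Q γ b (fun u => √(maxwellian u) * g u) (fun u => √(maxwellian u) * g u) v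

/-! ### Weighted norms and solutions -/

/-- The weight `w_β(v) = (1 + |v|²)^{β/2}`. -/
def weight (β : ℝ) (v : R3) : ℝ := (1 + ‖v‖ ^ 2) ^ (β / 2)

/-- `‖w_β g‖_{L^∞(Ω × R3)}`, the essential supremum norm. For a function on the torus the essential
supremum over the cell and that of the periodic representative over `R3` coincide. -/
def weightedNorm (β : ℝ) (g : R3 → R3 → ℝ) : ℝ≥0∞ :=
  eLpNorm (fun z : R3 × R3 => weight β z.2 * g z.1 z.2) ∞ volume

/-- The density `F = μ + √μ g` of a perturbation `g`. -/
def density (g : R3 → R3 → ℝ) (x v : R3) : ℝ := maxwellian v + √(maxwellian v) * g x v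

/-- `f` is, on the time interval `[0, T]`, a mild solution of the Boltzmann equation for the
perturbation, with initial value `f 0`, with nonnegative density `F = μ + √μ f`, and in the class
`sup_{0 ≤ s ≤ T} ‖w_β f(s)‖_{L^∞} < ∞`. -/
structure IsMildSolution (Ω : SpatialDomain) (γ : ℝ) (b : ℝ → ℝ) (β T : ℝ)
    (f : ℝ → R3 → R3 → ℝ) : Prop where
  measurable : Measurable fun z : ℝ × R3 × R3 => f z.1 z.2.1 z.2.2
  isFunctionOn : ∀ t ∈ Icc 0 T, Ω.IsFunctionOn (f t)
  bounded : ⨆ s ∈ Icc 0 T, weightedNorm β (f s) < ∞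
  nonneg : ∀ t ∈ Icc 0 T, ∀ᵐ z : R3 × R3, 0 ≤ density (f t) z.1 z.2
  mild : ∀ t ∈ Icc 0 T, ∀ᵐ z : R3 × R3,
    f t z.1 z.2 =
      Real.exp (-nu γ b z.2 * t) * f 0 (z.1 - t • z.2) z.2
      + (∫ s in (0 : ℝ)..t,
          Real.exp (-nu γ b z.2 * (t - s)) * K γ b (f s (z.1 - (t - s) • z.2)) z.2)
      + ∫ s in (0 : ℝ)..t,
          Real.exp (-nu γ b z.2 * (t - s)) * Gam γ b (f s (z.1 - (t - s) • z.2)) z.2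

/-! ### Defect mass, energy and entropy -/

/-- The integrand `F - μ` of the defect mass. -/
def massDefect (F : R3 → R3 → ℝ) (z : R3 × R3) : ℝ := F z.1 z.2 - maxwellian z.2

/-- The integrand `|v|² (F - μ)` of the defect energy. -/
def energyDefect (F : R3 → R3 → ℝ) (z : R3 × R3) : ℝ :=
  ‖z.2‖ ^ 2 * (F z.1 z.2 - maxwellian z.2)

/-- The integrand `F ln F - μ ln μ` of the defect entropy. -/
def entropyDefect (F : R3 → R3 → ℝ) (z : R3 × R3) : ℝ :=
  F z.1 z.2 * Real.log (F z.1 z.2) - maxwellian z.2 * Real.log (maxwellian z.2)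

/-- The defect mass, energy and entropy of `F` are well defined and finite. -/
structure HasFiniteDefects (Ω : SpatialDomain) (F : R3 → R3 → ℝ) : Prop where
  mass : Integrable (massDefect F) Ω.phaseMeasure
  energy : Integrable (energyDefect F) Ω.phaseMeasure
  entropy : Integrable (entropyDefect F) Ω.phaseMeasure

/-- On `[0, T]` the defect mass and energy of `F` are conserved, and its defect entropy is at most
the initial one. -/
structure ConservesDefects (Ω : SpatialDomain) (T : ℝ) (F : ℝ → R3 → R3 → ℝ) : Prop where
  finite : ∀ t ∈ Icc 0 T, HasFiniteDefects Ω (F t)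
  mass : ∀ t ∈ Icc 0 T,
    ∫ z, massDefect (F t) z ∂Ω.phaseMeasure = ∫ z, massDefect (F 0) z ∂Ω.phaseMeasure
  energy : ∀ t ∈ Icc 0 T,
    ∫ z, energyDefect (F t) z ∂Ω.phaseMeasure = ∫ z, energyDefect (F 0) z ∂Ω.phaseMeasure
  entropy : ∀ t ∈ Icc 0 T,
    ∫ z, entropyDefect (F t) z ∂Ω.phaseMeasure ≤ ∫ z, entropyDefect (F 0) z ∂Ω.phaseMeasure

/-- The functional
`ℰ(F₀) = ∫∫ (F₀ ln F₀ - μ ln μ) + [(3/2) ln(2π) - 1] M₀ + E₀ / 2`, where `M₀` and `E₀` are the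
defect mass and the defect energy of `F₀`. -/
def relEntropy (Ω : SpatialDomain) (F₀ : R3 → R3 → ℝ) : ℝ :=
  (∫ z, entropyDefect F₀ z ∂Ω.phaseMeasure)
  + (3 / 2 * Real.log (2 * Real.pi) - 1) * (∫ z, massDefect F₀ z ∂Ω.phaseMeasure)
  + 1 / 2 * ∫ z, energyDefect F₀ z ∂Ω.phaseMeasure

/-- The exponent `p = 1 + (3 + γ) / (4 (9 - γ))`. -/
def pExp (γ : ℝ) : ℝ := 1 + (3 + γ) / (4 * (9 - γ))

end

end Boltzmann

/-! Write `H` for the supremum over `[0, t]` of the weighted norms. In the mild formulation the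
collision terms sample `|f|` at time `s`, at the position `x - (t - s)v`, and at one of the
velocities `v'`, `u'`, `u`. In `K` the other factor is a Maxwellian, bounded by a constant times
`1/w_β`; in `Γ` it is a value of `f`, bounded a.e. by `H/w_β`. Hence both operators are dominated by
one average that is linear in `|f|` (`enorm_K_le`, `enorm_Gam_le`), and the claim reduces to
bounding `collisionIntegral` and multiplying by `C₁ + H`.

Collisions push forward to a measure `M` on pairs (velocity, sampled velocity), `collisionPairs`.
The damping `exp(-ν(t-s))` is compared with `q exp(-q(t-s))`, where `q ≤ ν` is of size `(1+|v|)^γ`;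
the time integral of the latter is at most `1`, and the factor `1/q` is put into `M`. Energy
conservation in a collision bounds the product of the two decays by `1/w_β(v)`, so `M` is finite
because `β > 3`, and `q` is `M`-integrable because `β > 3 + γ`. It is absolutely continuous because,
for fixed `v`, sampling pulls null sets back to null sets. So all but mass `1/N` of `M` sits on a
bounded set where its density is bounded; this soft fact (`exists_bounded_density`) takes the place
of explicit kernel estimates and truncations.

On that set, and for `t - s ≥ λ`, the substitution `y = x - (t-s)v` has Jacobian factor at most
`λ^{-3}` (up to a constant on the torus) and turns the velocity average into a space integral.
Pointwise `|f| ≤ 2√ψ + ψ/√μ`, with `ψ` the relative entropy density of `F`, whose integral never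
exceeds `ℰ(F₀)`. Cauchy-Schwarz gives the term `λ^{-3/2}√ℰ`, the rest gives `λ^{-3}ℰ`. The last `λ`
of time and the exceptional set cost at most `(Cλ + 1/N)H`.

In the quadratic part, `H` times the entropy bound is interpolated with the trivial bound `CH`
through `min(a, b) ≤ a^θ b^{1-θ}` with `θ = 1/p`; all that matters about `p` is `0 ≤ 1/p ≤ 1`. The
terms in `m` and in `N^{3-β}` are pure slack in this argument, which is why `C_m = 1` is possible.
-/

namespace Boltzmann

open Measure InformationTheory
open scoped Pointwise

/-! ### Null sets under the collision map -/

/-- A property of unit vectors which holds for the direction of almost every vector holds almost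
everywhere on the sphere. -/
theorem ae_sphere_of_ae {p : R3 → Prop} (hp : MeasurableSet {ξ | p ξ})
    (h : ∀ᵐ ξ : R3, p (‖ξ‖⁻¹ • ξ)) :
    ∀ᵐ ω : S2 ∂(volume : Measure R3).toSphere, p (ω : R3) := by
  have hm : MeasurableSet {ω : S2 | ¬ p (ω : R3)} := (measurable_subtype_coe hp).compl
  rw [ae_iff, toSphere_apply' _ hm]
  refine mul_eq_zero_of_right _ (measure_mono_null ?_ (ae_iff.1 h))
  rintro _ ⟨r, hr, _, ⟨ω, hω, rfl⟩, rfl⟩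
  have hn : ‖(ω : R3)‖ = 1 := by simp
  simp only [mem_ofPred_eq, norm_smul, hn, mul_one, Real.norm_of_nonneg hr.1.le, smul_smul,
    inv_mul_cancel₀ hr.1.ne', one_smul]
  exact hω

/-- The solution is bounded only almost everywhere, so its values at `v'` and `u'` are controlled
only if these maps pull null sets back to null sets. Invariance under normalising the direction lets
a unit vector be replaced by almost every vector of the whole space, where linear changes of
variables and Fubini are available. -/
theorem quasiMeasurePreserving_collision (Φ : R3 → R3 → R3)
    (hΦ : Measurable fun p : R3 × R3 => Φ p.1 p.2)
    (hhom : ∀ z ξ : R3, ξ ≠ 0 → Φ z (‖ξ‖⁻¹ • ξ) = Φ z ξ)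
    (h : ∀ E : Set R3, MeasurableSet E → volume E = 0 → ∀ᵐ ξ : R3, ∀ᵐ z : R3, Φ z ξ ∉ E)
    (v : R3) :
    QuasiMeasurePreserving (fun p : R3 × S2 => v + Φ (p.1 - v) (p.2 : R3))
      collisionMeasure volume := by
  have hm : Measurable fun p : R3 × R3 => v + Φ (p.1 - v) p.2 :=
    (hΦ.comp ((measurable_fst.sub_const v).prodMk measurable_snd)).const_add v
  have hm' : Measurable fun p : R3 × S2 => v + Φ (p.1 - v) (p.2 : R3) :=
    hm.comp (measurable_fst.prodMk (measurable_subtype_coe.comp measurable_snd))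
  refine ⟨hm', AbsolutelyContinuous.mk fun E hE h0 => ?_⟩
  rw [map_apply hm' hE]
  have hE' : MeasurableSet {y : R3 | v + y ∈ E} := (measurable_const_add v) hE
  have h0' : volume {y : R3 | v + y ∈ E} = 0 := by
    have := measure_preimage_add (volume : Measure R3) v E
    rw [h0] at this
    exact this
  have h1 : ∀ᵐ ξ : R3, ∀ᵐ u : R3, v + Φ (u - v) ξ ∉ E := by
    filter_upwards [h _ hE' h0'] with ξ hξ
    exact (measurePreserving_sub_right volume v).quasiMeasurePreserving.ae hξ
  have hS : MeasurableSet {p : R3 × R3 | v + Φ (p.2 - v) p.1 ∉ E} :=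
    (hm.comp measurable_swap hE).compl
  have hset : MeasurableSet {ξ : R3 | ∀ᵐ u : R3, v + Φ (u - v) ξ ∉ E} :=
    by
    have := measurable_measure_prodMk_left (ν := (volume : Measure R3)) hS.compl
    exact measurableSet_eq_fun this measurable_const
  have h2 : ∀ᵐ ω : S2 ∂(volume : Measure R3).toSphere,
      ∀ᵐ u : R3, v + Φ (u - v) (ω : R3) ∉ E := by
    refine ae_sphere_of_ae hset ?_
    filter_upwards [h1, ae_iff.2 (by simp : volume {ξ : R3 | ¬ ξ ≠ 0} = 0)] with ξ hξ hne
    filter_upwards [hξ] with u hu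
    rwa [hhom _ _ hne]
  have hT : MeasurableSet {p : R3 × S2 | v + Φ (p.1 - v) (p.2 : R3) ∉ E} := (hm' hE).compl
  have h3 : ∀ᵐ u : R3, ∀ᵐ ω : S2 ∂(volume : Measure R3).toSphere,
      v + Φ (u - v) (ω : R3) ∉ E := by
    rw [ae_ae_comm (p := fun (u : R3) (ω : S2) => v + Φ (u - v) (ω : R3) ∉ E) hT]
    exact h2
  have h4 := (ae_prod_iff_ae_ae hT).2 h3
  rw [ae_iff] at h4
  simpa [collisionMeasure, preimage] using h4

theorem ae_affine_notMem {R : Set ℝ} (hR : MeasurableSet R) (h0 : volume R = 0) (a c : ℝ)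
    (hc : c ≠ 0) : ∀ᵐ s : ℝ, a + c * s ∉ R := by
  have h1 : ∀ᵐ y : ℝ, y ∉ R := by rw [ae_iff]; simpa using h0
  have h2 : ∀ᵐ y : ℝ, a + y ∉ R := (quasiMeasurePreserving_add_left volume a).ae h1
  have := (ae_comp_linearMap_mem_iff (LinearMap.lsmul ℝ ℝ c) volume volume
    (fun y => ⟨c⁻¹ * y, by simp [hc]⟩) (s := {y | a + y ∉ R})
    ((measurable_const_add a) hR).compl).2 h2
  simpa using this

theorem ae_inner_notMem {R : Set ℝ} (hR : MeasurableSet R) (h0 : volume R = 0) (ξ : R3)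
    (hξ : ξ ≠ 0) : ∀ᵐ z : R3, inner ℝ z ξ ∉ R := by
  have h1 : ∀ᵐ y : ℝ, y ∈ Rᶜ := by rw [ae_iff]; simpa using h0
  have := (ae_comp_linearMap_mem_iff (innerₛₗ ℝ ξ) (volume : Measure R3) volume
    (fun y => ⟨(y * (inner ℝ ξ ξ)⁻¹) • ξ, by
      simp [hξ]⟩) hR.compl).2 h1
  filter_upwards [this] with z hz
  simpa [real_inner_comm] using hz

/-- Orthogonal projection of `z` onto the line spanned by `ξ`. -/
noncomputable def projLine (z ξ : R3) : R3 := (inner ℝ z ξ / ‖ξ‖ ^ 2) • ξ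

theorem measurable_projLine : Measurable fun p : R3 × R3 => projLine p.1 p.2 := by
  unfold projLine; fun_prop

theorem projLine_dir (z ξ : R3) (hξ : ξ ≠ 0) : projLine z (‖ξ‖⁻¹ • ξ) = projLine z ξ := by
  have : ‖ξ‖ ≠ 0 := by simpa using hξ
  simp only [projLine, inner_smul_right, norm_smul, norm_inv, norm_norm, smul_smul]
  congr 1
  field_simp

theorem projLine_sphere (z : R3) (ω : S2) : projLine z ω = (inner ℝ z (ω : R3)) • (ω : R3) := by
  simp [projLine]

/-- Dilations preserve null sets, so by Fubini almost every line through the origin meets `E` in a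
null set of parameters. The projection onto such a line is a surjective linear functional followed
by the parametrisation. -/
theorem ae_projLine_notMem {E : Set R3} (hE : MeasurableSet E) (h0 : volume E = 0) :
    ∀ᵐ ξ : R3, ∀ᵐ z : R3, projLine z ξ ∉ E := by
  have hm : MeasurableSet {p : ℝ × R3 | p.1 • p.2 ∉ E} :=
    ((measurable_fst.smul measurable_snd : Measurable fun p : ℝ × R3 => p.1 • p.2) hE).compl
  have h1 : ∀ᵐ r : ℝ, ∀ᵐ ξ : R3, r • ξ ∉ E := by
    filter_upwards [ae_iff.2 (by simp : volume {r : ℝ | ¬ r ≠ 0} = 0)] with r hr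
    exact (ae_comp_linearMap_mem_iff (LinearMap.lsmul ℝ R3 r) (volume : Measure R3) volume
      (fun y => ⟨r⁻¹ • y, by simp [smul_smul, hr]⟩) hE.compl).2
      (by rw [ae_iff]; simpa using h0)
  have h2 : ∀ᵐ ξ : R3, ∀ᵐ r : ℝ, r • ξ ∉ E := (ae_ae_comm hm).1 h1
  filter_upwards [h2, ae_iff.2 (by simp : volume {ξ : R3 | ¬ ξ ≠ 0} = 0)] with ξ hξ hne
  have hm1 : Measurable fun s : ℝ => (s / ‖ξ‖ ^ 2) • ξ := by fun_prop
  have hn : ‖ξ‖ ≠ 0 := by simpa using hne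
  have h3 : ∀ᵐ s : ℝ, (s / ‖ξ‖ ^ 2) • ξ ∉ E := by
    have := (ae_comp_linearMap_mem_iff (LinearMap.lsmul ℝ ℝ ((‖ξ‖ ^ 2)⁻¹)) volume volume
      (fun y => ⟨‖ξ‖ ^ 2 * y, by simp [hn]⟩) (s := {r : ℝ | r • ξ ∉ E})
      ((by fun_prop : Measurable fun r : ℝ => r • ξ) hE).compl).2 hξ
    simpa [div_eq_inv_mul] using this
  refine ae_inner_notMem (hm1 hE) ?_ ξ hne
  have := ae_iff.1 h3
  simpa [preimage] using this

/-- Fubini: each translate of `E` is null, so almost every line parallel to `c` meets `E` in a null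
set. -/
theorem ae_sub_smul_notMem {E : Set R3} (hE : MeasurableSet E) (h0 : volume E = 0) (c : R3) :
    ∀ᵐ z : R3, ∀ᵐ r : ℝ, z - r • c ∉ E := by
  have hm : MeasurableSet {p : ℝ × R3 | p.2 - p.1 • c ∉ E} :=
    ((by fun_prop : Measurable fun p : ℝ × R3 => p.2 - p.1 • c) hE).compl
  refine (ae_ae_comm hm).1 (Filter.Eventually.of_forall fun r => ?_)
  exact (measurePreserving_sub_right volume (r • c)).quasiMeasurePreserving.ae
    (by rw [ae_iff]; simpa using h0 : ∀ᵐ y : R3, y ∉ E)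

theorem ae_ne_zero_inner {c : R3} (hc : c ≠ 0) : ∀ᵐ ξ : R3, inner ℝ c ξ ≠ 0 := by
  filter_upwards [ae_inner_notMem (measurableSet_singleton (0 : ℝ)) (by simp) c hc] with ξ hξ
  rw [real_inner_comm]
  simpa using hξ

/-- The oblique projection along `c` onto the orthogonal complement of `ξ`, as a function of `ξ`. -/
theorem ae_oblique_notMem {E : Set R3} (hE : MeasurableSet E) (h0 : volume E = 0) {c : R3}
    (hc : c ≠ 0) :
    ∀ᵐ z : R3, ∀ᵐ ξ : R3, z - (inner ℝ z ξ / inner ℝ c ξ) • c ∉ E := by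
  -- Moving `ξ` along a vector `e` orthogonal to `c` keeps `⟨c, ξ⟩` fixed and changes `⟨z, ξ⟩` at a
  -- constant rate, nonzero for almost every `z`. The coefficient of `c` is therefore an affine
  -- bijection of the parameter.
  obtain ⟨e, he0, hec⟩ : ∃ e : R3, e ≠ 0 ∧ inner ℝ c e = 0 := by
    by_contra! hcon
    have hinj : Function.Injective (innerₛₗ ℝ c) := by
      rw [injective_iff_map_eq_zero]
      intro a ha
      by_contra hne
      exact hcon a hne (by simpa using ha)
    have := LinearMap.finrank_le_finrank_of_injective hinj
    simp at this
  filter_upwards [ae_sub_smul_notMem hE h0 c, ae_ne_zero_inner he0] with z hz hze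
  have hR : MeasurableSet {r : ℝ | z - r • c ∈ E} :=
    (by fun_prop : Measurable fun r : ℝ => z - r • c) hE
  have hR0 : volume {r : ℝ | z - r • c ∈ E} = 0 := by simpa [ae_iff] using hz
  have hm : Measurable fun ξ : R3 => z - (inner ℝ z ξ / inner ℝ c ξ) • c := by fun_prop
  set d : R3 := e with hd
  -- The plane `⟨c, ξ⟩ = 0`, where the quotient is meaningless, is admitted here so that the line
  -- argument works for every `ξ`; being null, it is removed at the end.
  have hset : MeasurableSet {ξ : R3 | inner ℝ c ξ = 0 ∨ z - (inner ℝ z ξ / inner ℝ c ξ) • c ∉ E} :=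
    (measurableSet_eq_fun (by fun_prop) (by fun_prop)).union (hm hE).compl
  have key := ae_mem_of_ae_add_linearMap_mem (LinearMap.toSpanSingleton ℝ R3 d) volume
    (volume : Measure R3) hset (fun ξ => by
      by_cases hcξ : inner ℝ c ξ = 0
      · refine Filter.Eventually.of_forall fun s => Or.inl ?_
        simp [inner_add_right, inner_smul_right, hcξ, hec]
      · have hne : inner ℝ z d / inner ℝ c ξ ≠ 0 :=
          div_ne_zero (by rwa [real_inner_comm]) hcξ
        filter_upwards [ae_affine_notMem hR hR0 (inner ℝ z ξ / inner ℝ c ξ) _ hne] with s hs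
        right
        have h1 : inner ℝ c (ξ + s • d) = inner ℝ c ξ := by
          simp [inner_add_right, inner_smul_right, hec]
        have h2 : inner ℝ z (ξ + s • d) = inner ℝ z ξ + s * inner ℝ z d := by
          simp [inner_add_right, inner_smul_right]
        simp only [LinearMap.toSpanSingleton_apply, h1, h2]
        have h3 : (inner ℝ z ξ + s * inner ℝ z d) / inner ℝ c ξ
          = inner ℝ z ξ / inner ℝ c ξ + inner ℝ z d / inner ℝ c ξ * s := by ring
        rw [h3]
        exact hs)
  filter_upwards [key, ae_ne_zero_inner hc] with ξ h1 h2
  exact h1.resolve_left h2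

/-- For fixed `ξ` the range is a plane, itself a null set, so the averaging over `ξ` is essential.
The orthogonal projection is the oblique projection along `c` composed with an invertible linear map
`S`, which reduces the claim to the oblique case, where `ξ` can be varied for fixed `z`. -/
theorem ae_projPlane_notMem {E : Set R3} (hE : MeasurableSet E) (h0 : volume E = 0) :
    ∀ᵐ ξ : R3, ∀ᵐ z : R3, z - projLine z ξ ∉ E := by
  obtain ⟨c, hc⟩ : ∃ c : R3, c ≠ 0 := exists_ne 0
  have hm : MeasurableSet {p : R3 × R3 | p.1 - (inner ℝ p.1 p.2 / inner ℝ c p.2) • c ∉ E} :=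
    ((by fun_prop : Measurable fun p : R3 × R3 =>
      p.1 - (inner ℝ p.1 p.2 / inner ℝ c p.2) • c) hE).compl
  have h1 := (ae_ae_comm hm).1 (ae_oblique_notMem hE h0 hc)
  filter_upwards [h1, ae_ne_zero_inner hc] with ξ hξ hcξ
  have hne : ξ ≠ 0 := by rintro rfl; simp at hcξ
  have hn : ‖ξ‖ ≠ 0 := by simpa using hne
  -- `S` replaces the component of `z` along `ξ` by a multiple of `c`; the oblique projection along
  -- `c` removes exactly that multiple.
  let S : R3 →ₗ[ℝ] R3 :=
    { toFun := fun z => z - projLine z ξ + (inner ℝ z ξ) • c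
      map_add' := fun x y => by
        simp only [projLine, inner_add_left, add_div, add_smul]; abel
      map_smul' := fun a x => by
        simp only [projLine, real_inner_smul_left, mul_div_assoc, mul_smul, smul_add, smul_sub,
          RingHom.id_apply] }
  have hS : ∀ z, S z = z - projLine z ξ + (inner ℝ z ξ) • c := fun z => rfl
  have hproj : ∀ z, inner ℝ (z - projLine z ξ) ξ = (0 : ℝ) := fun z => by
    simp only [projLine, inner_sub_left, real_inner_smul_left, real_inner_self_eq_norm_sq]
    field_simp; ring
  have hSi : ∀ z, inner ℝ (S z) ξ = inner ℝ z ξ * inner ℝ c ξ := fun z => by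
    rw [hS, inner_add_left, hproj, zero_add, real_inner_smul_left]
  have hinj : Function.Injective S := by
    rw [injective_iff_map_eq_zero]
    intro z hz
    have h2 : inner ℝ z ξ = 0 := by
      have := hSi z
      rw [hz, inner_zero_left] at this
      exact (mul_eq_zero.1 this.symm).resolve_right hcξ
    simpa [hS, projLine, h2] using hz
  have h3 := (ae_comp_linearMap_mem_iff S (volume : Measure R3) volume
    (LinearMap.injective_iff_surjective.1 hinj)
    (s := {z | z - (inner ℝ z ξ / inner ℝ c ξ) • c ∉ E})
    ((by fun_prop : Measurable fun z : R3 => z - (inner ℝ z ξ / inner ℝ c ξ) • c) hE).compl).2 hξ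
  filter_upwards [h3] with z hz
  have h4 : S z - (inner ℝ (S z) ξ / inner ℝ c ξ) • c = z - projLine z ξ := by
    rw [hSi, mul_div_cancel_right₀ _ hcξ, hS, add_sub_cancel_right]
  simpa [h4] using hz

theorem quasiMeasurePreserving_vPrime (v : R3) :
    QuasiMeasurePreserving (fun p : R3 × S2 => vPrime v p.1 p.2) collisionMeasure volume := by
  have := quasiMeasurePreserving_collision (fun z ξ => projLine z ξ)
    measurable_projLine projLine_dir (fun E => ae_projLine_notMem) v
  refine (funext fun p => ?_ : (fun p : R3 × S2 => vPrime v p.1 p.2) = _) ▸ this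
  simp only [projLine_sphere, vPrime, ← neg_sub p.1 v, inner_neg_left, neg_smul, sub_neg_eq_add]

theorem quasiMeasurePreserving_uPrime (v : R3) :
    QuasiMeasurePreserving (fun p : R3 × S2 => uPrime v p.1 p.2) collisionMeasure volume := by
  have := quasiMeasurePreserving_collision (fun z ξ => z - projLine z ξ)
    (measurable_fst.sub measurable_projLine) (fun z ξ hξ => by rw [projLine_dir _ _ hξ])
    (fun E => ae_projPlane_notMem) v
  refine (funext fun p => ?_ : (fun p : R3 × S2 => uPrime v p.1 p.2) = _) ▸ this
  simp only [projLine_sphere, uPrime, ← neg_sub p.1 v, inner_neg_left, neg_smul]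
  abel

/-! ### Energy identity and measurability of the collision map -/

theorem norm_sq_uPrime_add_vPrime (v u : R3) (ω : S2) :
    ‖uPrime v u ω‖ ^ 2 + ‖vPrime v u ω‖ ^ 2 = ‖u‖ ^ 2 + ‖v‖ ^ 2 := by
  have hn : ‖(ω : R3)‖ = 1 := by simp
  simp only [uPrime, vPrime, norm_add_sq_real, norm_sub_sq_real, norm_smul, inner_smul_right, hn,
    inner_sub_left, Real.norm_eq_abs, mul_one, sq_abs]
  ring

theorem measurable_uPrime : Measurable fun q : R3 × R3 × S2 => uPrime q.1 q.2.1 q.2.2 := by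
  unfold uPrime; fun_prop

theorem measurable_vPrime : Measurable fun q : R3 × R3 × S2 => vPrime q.1 q.2.1 q.2.2 := by
  unfold vPrime; fun_prop

/-! ### The weight and the Maxwellian -/

/-- `1 / w_β`. -/
noncomputable def decay (β : ℝ) (v : R3) : ℝ := (weight β v)⁻¹

theorem weight_pos (β : ℝ) (v : R3) : 0 < weight β v := by
  unfold weight; positivity

theorem decay_pos (β : ℝ) (v : R3) : 0 < decay β v := inv_pos.2 (weight_pos β v)

theorem continuous_weight (β : ℝ) : Continuous (weight β) := by
  unfold weight
  exact (by fun_prop : Continuous fun v : R3 => 1 + ‖v‖ ^ 2).rpow_const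
    fun v => Or.inl (by positivity)

theorem measurable_decay (β : ℝ) : Measurable (decay β) :=
  (continuous_weight β).measurable.inv

theorem weight_le_one_add_norm {β : ℝ} (hβ : 0 ≤ β) (v : R3) : weight β v ≤ (1 + ‖v‖) ^ β := by
  have h : (1 + ‖v‖) ^ β = ((1 + ‖v‖) ^ 2) ^ (β / 2) := by
    rw [← Real.rpow_natCast, ← Real.rpow_mul (by positivity)]
    congr 1; push_cast; ring
  rw [h, weight]
  refine Real.rpow_le_rpow (by positivity) ?_ (by positivity)
  nlinarith [norm_nonneg v]

theorem decay_le_one_add_norm {β : ℝ} (hβ : 0 ≤ β) (v : R3) :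
    decay β v ≤ 2 ^ (β / 2) * (1 + ‖v‖) ^ (-β) := by
  have h : (1 + ‖v‖) ^ β = ((1 + ‖v‖) ^ 2) ^ (β / 2) := by
    rw [← Real.rpow_natCast, ← Real.rpow_mul (by positivity)]
    congr 1; push_cast; ring
  have h2 : (1 + ‖v‖) ^ β ≤ 2 ^ (β / 2) * weight β v := by
    rw [h, weight, ← Real.mul_rpow (by positivity) (by positivity)]
    refine Real.rpow_le_rpow (by positivity) ?_ (by positivity)
    nlinarith [sq_nonneg (1 - ‖v‖)]
  rw [Real.rpow_neg (by positivity), decay, ← div_eq_mul_inv, inv_eq_one_div,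
    div_le_div_iff₀ (weight_pos β v) (by positivity)]
  simpa using h2

/-- Since `(1+|x|²)(1+|y|²) ≥ 1 + |x|² + |y|²`, two particles carrying at least the energy of `v`
together carry at least its weight. This keeps decay in `v` after a collision. -/
theorem decay_mul_decay_le {β : ℝ} (hβ : 0 ≤ β) {x y v : R3} (h : ‖v‖ ^ 2 ≤ ‖x‖ ^ 2 + ‖y‖ ^ 2) :
    decay β x * decay β y ≤ decay β v := by
  unfold decay
  rw [← mul_inv]
  refine inv_anti₀ (weight_pos β v) ?_
  unfold weight
  rw [← Real.mul_rpow (by positivity) (by positivity)]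
  refine Real.rpow_le_rpow (by positivity) ?_ (by positivity)
  nlinarith [sq_nonneg ‖x‖, sq_nonneg ‖y‖, mul_nonneg (sq_nonneg ‖x‖) (sq_nonneg ‖y‖)]

theorem maxwellian_pos (v : R3) : 0 < maxwellian v := by unfold maxwellian; positivity

theorem continuous_maxwellian : Continuous maxwellian := by unfold maxwellian; fun_prop

theorem measurable_maxwellian : Measurable maxwellian := continuous_maxwellian.measurable

theorem maxwellian_le_exp (v : R3) : maxwellian v ≤ Real.exp (-‖v‖ ^ 2 / 2) := by
  unfold maxwellian
  refine mul_le_of_le_one_left (Real.exp_pos _).le ?_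
  rw [div_le_one (by positivity)]
  exact Real.one_le_rpow (by nlinarith [Real.pi_gt_three]) (by norm_num)

theorem sqrt_maxwellian_le_exp (v : R3) : √(maxwellian v) ≤ Real.exp (-‖v‖ ^ 2 / 4) := by
  rw [Real.sqrt_le_left (Real.exp_pos _).le, ← Real.exp_nat_mul]
  refine (maxwellian_le_exp v).trans_eq ?_
  congr 1; push_cast; ring

theorem maxwellian_le_sqrt (v : R3) : maxwellian v ≤ √(maxwellian v) := by
  have h1 : maxwellian v ≤ 1 := (maxwellian_le_exp v).trans
    (Real.exp_le_one_iff.2 (by nlinarith [sq_nonneg ‖v‖]))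
  refine Real.le_sqrt_of_sq_le ?_
  nlinarith [maxwellian_pos v]

theorem exp_neg_sq_le (k : ℝ) :
    ∃ C : ℝ, 0 < C ∧ ∀ r : ℝ, 0 ≤ r → Real.exp (-r ^ 2 / 4) ≤ C * (1 + r) ^ (-k) := by
  obtain ⟨n, hn⟩ := exists_nat_ge k
  -- `n!` comes from `(1+r)^n ≤ n! exp(1+r)`, and the `2` from `-r²/4 + 1 + r ≤ 2`, that is `(r -
  -- 2)² ≥ 0`.
  refine ⟨n.factorial * Real.exp 2, by positivity, fun r hr => ?_⟩
  have h1 : (1 + r) ^ n ≤ n.factorial * Real.exp (1 + r) := by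
    have := Real.pow_div_factorial_le_exp (1 + r) (by positivity) n
    rwa [div_le_iff₀ (by positivity), mul_comm] at this
  have h2 : (1 + r) ^ k ≤ (1 + r) ^ n := by
    rw [← Real.rpow_natCast]
    exact Real.rpow_le_rpow_of_exponent_le (by linarith) hn
  have h3 : Real.exp (-r ^ 2 / 4) * Real.exp (1 + r) ≤ Real.exp 2 := by
    rw [← Real.exp_add, Real.exp_le_exp]
    nlinarith [sq_nonneg (r - 2)]
  rw [Real.rpow_neg (by positivity), ← div_eq_mul_inv, le_div_iff₀ (by positivity)]
  calc Real.exp (-r ^ 2 / 4) * (1 + r) ^ k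
      ≤ Real.exp (-r ^ 2 / 4) * (n.factorial * Real.exp (1 + r)) := by
        gcongr; exact h2.trans h1
    _ = n.factorial * (Real.exp (-r ^ 2 / 4) * Real.exp (1 + r)) := by ring
    _ ≤ n.factorial * Real.exp 2 := by gcongr

theorem sqrt_maxwellian_le_decay {β : ℝ} (hβ : 0 ≤ β) :
    ∃ C : ℝ, 0 < C ∧ ∀ v : R3, √(maxwellian v) ≤ C * decay β v := by
  obtain ⟨C, hC, h⟩ := exp_neg_sq_le β
  refine ⟨C, hC, fun v => (sqrt_maxwellian_le_exp v).trans ((h _ (norm_nonneg v)).trans ?_)⟩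
  gcongr
  rw [Real.rpow_neg (by positivity), decay]
  exact inv_anti₀ (weight_pos β v) (weight_le_one_add_norm hβ v)

theorem lintegral_decay_mul_lt_top {β δ : ℝ} (hβ : 0 ≤ β) (h : 3 < β - δ) :
    ∫⁻ v : R3, ENNReal.ofReal (decay β v * (1 + ‖v‖) ^ δ) < ∞ := by
  have h3 : (Module.finrank ℝ R3 : ℝ) < β - δ := by simpa using h
  have hfin := finite_integral_one_add_norm (μ := (volume : Measure R3)) h3
  calc ∫⁻ v : R3, ENNReal.ofReal (decay β v * (1 + ‖v‖) ^ δ)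
      ≤ ∫⁻ v : R3, ENNReal.ofReal (2 ^ (β / 2)) * ENNReal.ofReal ((1 + ‖v‖) ^ (-(β - δ))) := by
        refine lintegral_mono fun v => ?_
        rw [← ENNReal.ofReal_mul (by positivity)]
        refine ENNReal.ofReal_le_ofReal ?_
        calc decay β v * (1 + ‖v‖) ^ δ
            ≤ (2 ^ (β / 2) * (1 + ‖v‖) ^ (-β)) * (1 + ‖v‖) ^ δ := by
              gcongr; exact decay_le_one_add_norm hβ v
          _ = 2 ^ (β / 2) * (1 + ‖v‖) ^ (-(β - δ)) := by
              rw [mul_assoc, ← Real.rpow_add (by positivity)]; congr 2; ring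
    _ < ∞ := by
        rw [lintegral_const_mul' _ _ ENNReal.ofReal_ne_top]
        exact ENNReal.mul_lt_top ENNReal.ofReal_lt_top hfin

/-! ### Rotation invariance of the angular integral -/

/-- The surface measure of a set is a multiple of the volume of the cone over it, and a linear
isometry maps cones to cones of equal volume. -/
theorem lintegral_sphere_comp_isometry (R : R3 ≃ₗᵢ[ℝ] R3) {g : R3 → ℝ≥0∞} (hg : Measurable g) :
    ∫⁻ ω : S2, g (R ω) ∂(volume : Measure R3).toSphere
      = ∫⁻ ω : S2, g ω ∂(volume : Measure R3).toSphere := by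
  let ρ : S2 → S2 := fun ω => ⟨R ω, by simp⟩
  have hρ : Measurable ρ :=
    (R.continuous.measurable.comp measurable_subtype_coe).subtype_mk
  have hmp : MeasurePreserving ρ (volume : Measure R3).toSphere
      (volume : Measure R3).toSphere := by
    refine ⟨hρ, ext fun s hs => ?_⟩
    rw [map_apply hρ hs, toSphere_apply' _ (hρ hs), toSphere_apply' _ hs]
    congr 1
    rw [← R.measurePreserving.measure_preimage_emb R.toHomeomorph.measurableEmbedding
      (Ioo (0 : ℝ) 1 • (Subtype.val '' s : Set R3))]
    congr 1
    ext x
    simp only [mem_smul, mem_image, mem_preimage, Subtype.exists, exists_and_right, exists_eq_right]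
    constructor
    · rintro ⟨r, hr, y, ⟨hy, hys⟩, rfl⟩
      exact ⟨r, hr, R y, ⟨by simpa using hy, hys⟩, by simp⟩
    · rintro ⟨r, hr, y, ⟨hy, hys⟩, hx⟩
      refine ⟨r, hr, R.symm y, ⟨by simpa using hy, ?_⟩, ?_⟩
      · simpa [ρ] using hys
      · apply R.injective
        simpa using hx
  exact hmp.lintegral_comp (f := fun ω : S2 => g ω) (hg.comp measurable_subtype_coe)

theorem measurable_angle {α : Type*} [MeasurableSpace α] {f g : α → R3} (hf : Measurable f)
    (hg : Measurable g) : Measurable fun a => InnerProductGeometry.angle (f a) (g a) := by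
  unfold InnerProductGeometry.angle
  exact Real.continuous_arccos.measurable.comp (by fun_prop)

/-- The angular integral `∫ b(θ) dω`. -/
noncomputable def angularMass (b : ℝ → ℝ) : ℝ≥0∞ :=
  ∫⁻ ω : S2, ENNReal.ofReal (b (InnerProductGeometry.angle (EuclideanSpace.single 0 1 : R3) ω))
    ∂(volume : Measure R3).toSphere

theorem lintegral_angle {b : ℝ → ℝ} (hb : Measurable b) {z : R3} (hz : z ≠ 0) :
    ∫⁻ ω : S2, ENNReal.ofReal (b (InnerProductGeometry.angle z ω))
      ∂(volume : Measure R3).toSphere = angularMass b := by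
  set e : R3 := EuclideanSpace.single 0 1 with he
  have hen : ‖e‖ = 1 := by simp [he]
  have hzn : 0 < ‖z‖ := norm_pos_iff.2 hz
  have hnorm : ‖‖z‖⁻¹ • z‖ = ‖e‖ := by
    rw [norm_smul, hen, norm_inv, norm_norm, inv_mul_cancel₀ hzn.ne']
  -- The reflection exchanging the two unit vectors `z/|z|` and `e`; it preserves angles.
  let R : R3 ≃ₗᵢ[ℝ] R3 := (ℝ ∙ (‖z‖⁻¹ • z - e))ᗮ.reflection
  have hR : R (‖z‖⁻¹ • z) = e := Submodule.reflection_sub hnorm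
  have hm : Measurable fun ξ : R3 => ENNReal.ofReal (b (InnerProductGeometry.angle e ξ)) :=
    (hb.comp (measurable_angle measurable_const measurable_id)).ennreal_ofReal
  rw [angularMass, ← lintegral_sphere_comp_isometry R hm]
  refine lintegral_congr fun ω => ?_
  rw [← hR, ← LinearIsometryEquiv.coe_toLinearIsometry, LinearIsometry.angle_map, InnerProductGeometry.angle_smul_left_of_pos _ _
    (inv_pos.2 hzn)]

theorem angularMass_lt_top {b : ℝ → ℝ} (hb : IsCutoff b) : angularMass b < ∞ := by
  obtain ⟨_, C, hC, h⟩ := hb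
  calc angularMass b ≤ ∫⁻ _ : S2, ENNReal.ofReal C ∂(volume : Measure R3).toSphere := by
        refine lintegral_mono fun ω => ENNReal.ofReal_le_ofReal ?_
        refine (h _ ⟨InnerProductGeometry.angle_nonneg _ _,
          InnerProductGeometry.angle_le_pi _ _⟩).2.trans ?_
        exact mul_le_of_le_one_right hC.le (Real.abs_cos_le_one _)
    _ < ∞ := by
        rw [lintegral_const]
        exact ENNReal.mul_lt_top ENNReal.ofReal_lt_top (measure_lt_top _ _)

theorem kernelB_nonneg {γ : ℝ} {b : ℝ → ℝ} (hb : IsCutoff b) (z : R3) (ω : S2) :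
    0 ≤ kernelB γ b z ω := by
  obtain ⟨_, C, hC, h⟩ := hb
  exact mul_nonneg (by positivity) (h _ ⟨InnerProductGeometry.angle_nonneg _ _,
    InnerProductGeometry.angle_le_pi _ _⟩).1

theorem measurable_kernelB (γ : ℝ) {b : ℝ → ℝ} (hb : Measurable b) {α : Type*}
    [MeasurableSpace α] {f : α → R3} {g : α → S2} (hf : Measurable f) (hg : Measurable g) :
    Measurable fun a => kernelB γ b (f a) (g a) := by
  have h1 : Measurable fun a => ‖f a‖ ^ γ := hf.norm.pow_const γ
  have h2 : Measurable fun a => (g a : R3) := measurable_subtype_coe.comp hg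
  have h3 : Measurable fun a => b (InnerProductGeometry.angle (f a) (g a : R3)) :=
    hb.comp (measurable_angle hf h2)
  exact h1.mul h3

theorem lintegral_kernelB {γ : ℝ} {b : ℝ → ℝ} (hb : IsCutoff b) {m : R3 → ℝ≥0∞}
    (hm : Measurable m) (v : R3) :
    ∫⁻ p, ENNReal.ofReal (kernelB γ b (v - p.1) p.2) * m p.1 ∂collisionMeasure
      = angularMass b * ∫⁻ u, ENNReal.ofReal (‖v - u‖ ^ γ) * m u := by
  have hk : Measurable fun p : R3 × S2 => ENNReal.ofReal (kernelB γ b (v - p.1) p.2) :=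
    (measurable_kernelB γ hb.1 (measurable_const.sub measurable_fst)
      measurable_snd).ennreal_ofReal
  have hkm : Measurable fun p : R3 × S2 =>
      ENNReal.ofReal (kernelB γ b (v - p.1) p.2) * m p.1 := hk.mul (hm.comp measurable_fst)
  have hum : Measurable fun u : R3 => ENNReal.ofReal (‖v - u‖ ^ γ) * m u :=
    (by fun_prop : Measurable fun u : R3 => ENNReal.ofReal (‖v - u‖ ^ γ)).mul hm
  rw [collisionMeasure, lintegral_prod _ hkm.aemeasurable,
    ← lintegral_const_mul _ hum]
  refine lintegral_congr_ae ?_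
  -- At `u = v` there is no direction to rotate, so this single point is discarded.
  filter_upwards [ae_iff.2 (by simp : volume {u : R3 | ¬ u ≠ v} = 0)] with u hu
  have hku : Measurable fun ω : S2 => ENNReal.ofReal (kernelB γ b (v - u) ω) :=
    (measurable_kernelB γ hb.1 measurable_const measurable_id).ennreal_ofReal
  rw [lintegral_mul_const _ hku]
  simp only [kernelB, ENNReal.ofReal_mul (Real.rpow_nonneg (norm_nonneg (v - u)) γ)]
  rw [lintegral_const_mul' _ _ ENNReal.ofReal_ne_top, lintegral_angle hb.1 (sub_ne_zero.2 hu.symm)]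
  ring

/-! ### Two-sided bounds for the convolution of `|·|^γ` with a Gaussian -/

theorem lintegral_ball_rpow_lt_top {γ : ℝ} (hγ : -3 < γ) :
    ∫⁻ z : R3 in Metric.closedBall 0 1, ENNReal.ofReal (‖z‖ ^ γ) < ∞ := by
  have h : Integrable (fun z : R3 => (Iic (1 : ℝ)).indicator (fun r => r ^ γ) ‖z‖) := by
    rw [integrable_fun_norm_addHaar (volume : Measure R3)
      (f := (Iic (1 : ℝ)).indicator (fun r => r ^ γ))]
    -- In polar coordinates the singularity is `r^(2+γ)`, integrable at `0` exactly because `γ >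
    -- -3`.
    have h1 : IntegrableOn (fun r : ℝ => r ^ (2 + γ)) (Ioc 0 1) := by
      have := (intervalIntegral.intervalIntegrable_rpow' (a := 0) (b := 1) (r := 2 + γ)
        (by linarith))
      rwa [intervalIntegrable_iff_integrableOn_Ioc_of_le zero_le_one] at this
    have h2 : IntegrableOn ((Iic (1 : ℝ)).indicator fun r : ℝ => r ^ (2 + γ)) (Ioi 0) := by
      rw [IntegrableOn, integrable_indicator_iff measurableSet_Iic, IntegrableOn,
        Measure.restrict_restrict measurableSet_Iic, inter_comm, Ioi_inter_Iic]
      exact h1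
    refine h2.congr_fun (fun r hr => ?_) measurableSet_Ioi
    have hr' : (0 : ℝ) < r := hr
    by_cases h1 : r ≤ 1
    · simp [indicator, h1, Real.rpow_add hr']
    · simp [indicator, h1]
  have h2 := h.lintegral_lt_top
  rw [← lintegral_indicator measurableSet_closedBall]
  refine lt_of_eq_of_lt (lintegral_congr fun z => ?_) h2
  by_cases hz : ‖z‖ ≤ 1 <;> simp [indicator, hz]

/-- A Peetre-type inequality: `1+|v| ≤ (1+|v-u|)(1+|u|)` for negative `γ`, and `|v-u| ≤
(1+|v|)(1+|u|)` otherwise, trade `v - u` for `v` at the cost of a power of `1+|u|`. The indicator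
carries the singularity at `u = v`. -/
theorem rpow_norm_sub_le (γ : ℝ) (v u : R3) :
    ‖v - u‖ ^ γ ≤ 2 ^ |γ| * (1 + ‖v‖) ^ γ * ((1 + ‖u‖) ^ |γ| *
      (1 + (Metric.closedBall (0 : R3) 1).indicator (fun z => ‖z‖ ^ γ) (v - u))) := by
  set z := v - u with hz
  have hI : 0 ≤ (Metric.closedBall (0 : R3) 1).indicator (fun z => ‖z‖ ^ γ) z :=
    indicator_nonneg (fun _ _ => by positivity) _
  have h2 : (1 : ℝ) ≤ 2 ^ |γ| := Real.one_le_rpow one_le_two (abs_nonneg _)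
  rcases le_or_gt 0 γ with h | h
  · rw [abs_of_nonneg h] at *
    have h1 : ‖z‖ ≤ (1 + ‖v‖) * (1 + ‖u‖) := by
      have := norm_sub_le v u
      nlinarith [norm_nonneg v, norm_nonneg u]
    have h3 : ‖z‖ ^ γ ≤ (1 + ‖v‖) ^ γ * (1 + ‖u‖) ^ γ := by
      rw [← Real.mul_rpow (by positivity) (by positivity)]
      exact Real.rpow_le_rpow (norm_nonneg _) h1 h
    calc ‖z‖ ^ γ ≤ 1 * ((1 + ‖v‖) ^ γ * ((1 + ‖u‖) ^ γ * (1 + 0))) := by simpa using h3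
      _ ≤ 2 ^ γ * ((1 + ‖v‖) ^ γ * ((1 + ‖u‖) ^ γ *
          (1 + (Metric.closedBall (0 : R3) 1).indicator (fun z => ‖z‖ ^ γ) z))) := by gcongr
      _ = _ := by ring
  · rw [abs_of_neg h] at *
    have h1 : (1 + ‖v‖) ≤ (1 + ‖z‖) * (1 + ‖u‖) := by
      have : ‖v‖ ≤ ‖z‖ + ‖u‖ := by simpa [hz] using norm_add_le (v - u) u
      nlinarith [norm_nonneg z, norm_nonneg u]
    have h3 : (1 + ‖z‖) ^ γ ≤ (1 + ‖v‖) ^ γ * (1 + ‖u‖) ^ (-γ) := by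
      rw [Real.rpow_neg (by positivity), ← div_eq_mul_inv, le_div_iff₀ (by positivity),
        ← Real.mul_rpow (by positivity) (by positivity)]
      exact Real.rpow_le_rpow_of_nonpos (by positivity) h1 h.le
    have h4 : ‖z‖ ^ γ ≤ 2 ^ (-γ) * (1 + ‖z‖) ^ γ *
        (1 + (Metric.closedBall (0 : R3) 1).indicator (fun z => ‖z‖ ^ γ) z) := by
      rcases le_or_gt ‖z‖ 1 with hz1 | hz1
      · have hI' : (Metric.closedBall (0 : R3) 1).indicator (fun z => ‖z‖ ^ γ) z = ‖z‖ ^ γ := by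
          simp [indicator, hz1]
        have h5 : 1 ≤ 2 ^ (-γ) * (1 + ‖z‖) ^ γ := by
          rw [Real.rpow_neg (by positivity), ← div_eq_inv_mul, one_le_div (by positivity)]
          exact Real.rpow_le_rpow_of_nonpos (by positivity) (by linarith) h.le
        rw [hI']
        have : 0 ≤ ‖z‖ ^ γ := by positivity
        nlinarith
      · have h5 : ‖z‖ ^ γ ≤ 2 ^ (-γ) * (1 + ‖z‖) ^ γ := by
          rw [Real.rpow_neg (by positivity), ← div_eq_inv_mul, le_div_iff₀ (by positivity),
            ← Real.mul_rpow (by positivity) (by positivity)]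
          exact Real.rpow_le_rpow_of_nonpos (by positivity) (by linarith) h.le
        calc ‖z‖ ^ γ ≤ 2 ^ (-γ) * (1 + ‖z‖) ^ γ * (1 + 0) := by simpa using h5
          _ ≤ _ := by gcongr
    calc ‖z‖ ^ γ ≤ 2 ^ (-γ) * (1 + ‖z‖) ^ γ *
          (1 + (Metric.closedBall (0 : R3) 1).indicator (fun z => ‖z‖ ^ γ) z) := h4
      _ ≤ 2 ^ (-γ) * ((1 + ‖v‖) ^ γ * (1 + ‖u‖) ^ (-γ)) *
          (1 + (Metric.closedBall (0 : R3) 1).indicator (fun z => ‖z‖ ^ γ) z) := by gcongr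
      _ = _ := by ring

theorem lintegral_rpow_mul_sqrt_maxwellian_le {γ : ℝ} (hγ : -3 < γ) :
    ∃ C : ℝ, 0 < C ∧ ∀ v : R3,
      ∫⁻ u, ENNReal.ofReal (‖v - u‖ ^ γ) * ENNReal.ofReal √(maxwellian u)
        ≤ ENNReal.ofReal (C * (1 + ‖v‖) ^ γ) := by
  -- The power `|γ|` absorbs the loss in `u`; the remaining power `-4` is integrable in dimension
  -- three and at most `1`, so it may be dropped in front of the singular part.
  obtain ⟨C, hC, hexp⟩ := exp_neg_sq_le (|γ| + 4)
  set I := ∫⁻ z : R3 in Metric.closedBall 0 1, ENNReal.ofReal (‖z‖ ^ γ) with hI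
  have hIfin : I < ∞ := lintegral_ball_rpow_lt_top hγ
  set J := ∫⁻ u : R3, ENNReal.ofReal ((1 + ‖u‖) ^ (-4 : ℝ)) with hJ
  have hJfin : J < ∞ := finite_integral_one_add_norm (by simp; norm_num)
  refine ⟨2 ^ |γ| * C * (J + I).toReal + 1, by positivity, fun v => ?_⟩
  have hG : ∀ u : R3, (1 + ‖u‖) ^ |γ| * √(maxwellian u) ≤ C * (1 + ‖u‖) ^ (-4 : ℝ) := fun u => by
    calc (1 + ‖u‖) ^ |γ| * √(maxwellian u)
        ≤ (1 + ‖u‖) ^ |γ| * (C * (1 + ‖u‖) ^ (-(|γ| + 4))) := by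
          gcongr; exact (sqrt_maxwellian_le_exp u).trans (hexp _ (norm_nonneg u))
      _ = C * ((1 + ‖u‖) ^ |γ| * (1 + ‖u‖) ^ (-(|γ| + 4))) := by ring
      _ = C * (1 + ‖u‖) ^ (-4 : ℝ) := by
          rw [← Real.rpow_add (by positivity)]; congr 2; ring
  have hG' : ∀ u : R3, (1 + ‖u‖) ^ (-4 : ℝ) ≤ 1 := fun u =>
    Real.rpow_le_one_of_one_le_of_nonpos (by linarith [norm_nonneg u]) (by norm_num)
  set K : ℝ := 2 ^ |γ| * (1 + ‖v‖) ^ γ * C with hK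
  have hK0 : 0 ≤ K := by positivity
  have hpt : ∀ u : R3, ENNReal.ofReal (‖v - u‖ ^ γ) * ENNReal.ofReal √(maxwellian u)
      ≤ ENNReal.ofReal K * (ENNReal.ofReal ((1 + ‖u‖) ^ (-4 : ℝ))
        + (Metric.closedBall (0 : R3) 1).indicator (fun z => ENNReal.ofReal (‖z‖ ^ γ)) (v - u)) := by
    intro u
    have hind : (Metric.closedBall (0 : R3) 1).indicator (fun z => ENNReal.ofReal (‖z‖ ^ γ)) (v - u)
        = ENNReal.ofReal ((Metric.closedBall (0 : R3) 1).indicator (fun z => ‖z‖ ^ γ) (v - u)) := by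
      by_cases h : v - u ∈ Metric.closedBall (0 : R3) 1
      · rw [indicator_of_mem h, indicator_of_mem h]
      · rw [indicator_of_notMem h, indicator_of_notMem h, ENNReal.ofReal_zero]
    have hI0 : 0 ≤ (Metric.closedBall (0 : R3) 1).indicator (fun z => ‖z‖ ^ γ) (v - u) :=
      indicator_nonneg (fun _ _ => by positivity) _
    rw [hind, ← ENNReal.ofReal_mul (by positivity), ← ENNReal.ofReal_add (by positivity) hI0,
      ← ENNReal.ofReal_mul hK0]
    refine ENNReal.ofReal_le_ofReal ?_
    set X := (Metric.closedBall (0 : R3) 1).indicator (fun z => ‖z‖ ^ γ) (v - u)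
    calc ‖v - u‖ ^ γ * √(maxwellian u)
        ≤ (2 ^ |γ| * (1 + ‖v‖) ^ γ * ((1 + ‖u‖) ^ |γ| * (1 + X))) * √(maxwellian u) := by
          gcongr; exact rpow_norm_sub_le γ v u
      _ = 2 ^ |γ| * (1 + ‖v‖) ^ γ * (((1 + ‖u‖) ^ |γ| * √(maxwellian u)) * (1 + X)) := by ring
      _ ≤ 2 ^ |γ| * (1 + ‖v‖) ^ γ * ((C * (1 + ‖u‖) ^ (-4 : ℝ)) * (1 + X)) := by
          exact mul_le_mul_of_nonneg_left (mul_le_mul_of_nonneg_right (hG u) (by positivity))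
            (by positivity)
      _ = K * ((1 + ‖u‖) ^ (-4 : ℝ) + (1 + ‖u‖) ^ (-4 : ℝ) * X) := by rw [hK]; ring
      _ ≤ K * ((1 + ‖u‖) ^ (-4 : ℝ) + X) := by
          gcongr; exact mul_le_of_le_one_left hI0 (hG' u)
  have hmI : Measurable ((Metric.closedBall (0 : R3) 1).indicator
      fun z : R3 => ENNReal.ofReal (‖z‖ ^ γ)) :=
    (by fun_prop : Measurable fun z : R3 => ENNReal.ofReal (‖z‖ ^ γ)).indicator
      measurableSet_closedBall
  calc _ ≤ ∫⁻ u : R3, ENNReal.ofReal K * (ENNReal.ofReal ((1 + ‖u‖) ^ (-4 : ℝ))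
        + (Metric.closedBall (0 : R3) 1).indicator
          (fun z => ENNReal.ofReal (‖z‖ ^ γ)) (v - u)) := lintegral_mono hpt
    _ = ENNReal.ofReal K * (J + I) := by
        rw [lintegral_const_mul' _ _ ENNReal.ofReal_ne_top, lintegral_add_left (by fun_prop),
          lintegral_sub_left_eq_self (fun z => (Metric.closedBall (0 : R3) 1).indicator
          (fun z => ENNReal.ofReal (‖z‖ ^ γ)) z) v, lintegral_indicator measurableSet_closedBall]
    _ = ENNReal.ofReal (K * (J + I).toReal) := by
        rw [ENNReal.ofReal_mul hK0, ENNReal.ofReal_toReal (by simp [hIfin.ne, hJfin.ne])]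
    _ ≤ _ := by
        refine ENNReal.ofReal_le_ofReal ?_
        have : 0 ≤ (1 + ‖v‖) ^ γ := by positivity
        rw [hK]; nlinarith

/-- Only the annulus `1 < |u| < 2` is needed. The Maxwellian is even, so twice the integral contains
`|v-u|^γ + |v+u|^γ`. If `γ ≥ 0`, one of `|v±u|` is at least `(1+|v|)/2`, because their sum dominates
both `2|v|` and `2|u|`; if `γ < 0`, then `|v-u| ≤ 2(1+|v|)` suffices. -/
theorem le_lintegral_rpow_mul_maxwellian (γ : ℝ) :
    ∃ c : ℝ, 0 < c ∧ ∀ v : R3, ENNReal.ofReal (c * (1 + ‖v‖) ^ γ)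
      ≤ ∫⁻ u, ENNReal.ofReal (‖v - u‖ ^ γ) * ENNReal.ofReal (maxwellian u) := by
  set A : Set R3 := Metric.ball 0 2 \ Metric.closedBall 0 1 with hA
  have hAm : MeasurableSet A := measurableSet_ball.diff measurableSet_closedBall
  have hAo : IsOpen A := Metric.isOpen_ball.sdiff Metric.isClosed_closedBall
  set D := ∫⁻ u in A, ENNReal.ofReal (maxwellian u) with hD
  have hD0 : D ≠ 0 := by
    rw [hD, Ne, lintegral_eq_zero_iff (measurable_maxwellian.ennreal_ofReal)]
    intro h
    have h2 : ∀ᵐ u ∂(volume : Measure R3).restrict A, False := by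
      filter_upwards [h] with u hu
      have : 0 < ENNReal.ofReal (maxwellian u) := ENNReal.ofReal_pos.2 (maxwellian_pos u)
      exact this.ne' hu
    have h3 : volume A = 0 := by simpa using h2
    have hne : A.Nonempty := ⟨EuclideanSpace.single 0 (3 / 2), by
      simp [hA]; norm_num⟩
    exact (hAo.measure_pos volume hne).ne' h3
  have hDt : D ≠ ∞ := by
    refine ne_top_of_le_ne_top (measure_ball_lt_top (μ := (volume : Measure R3)) (x := 0)
      (r := 2)).ne ?_
    calc D ≤ ∫⁻ u in A, 1 := by
          refine lintegral_mono fun u => ENNReal.ofReal_le_one.2 ((maxwellian_le_exp u).trans ?_)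
          exact Real.exp_le_one_iff.2 (by nlinarith [sq_nonneg ‖u‖])
      _ = volume A := by simp
      _ ≤ _ := measure_mono sdiff_subset
  have hDp : 0 < D.toReal := ENNReal.toReal_pos hD0 hDt
  refine ⟨2⁻¹ * 2 ^ (-|γ|) * D.toReal, by positivity, fun v => ?_⟩
  set L := ∫⁻ u, ENNReal.ofReal (‖v - u‖ ^ γ) * ENNReal.ofReal (maxwellian u) with hL
  have hmL : ∀ w : R3, Measurable fun u : R3 =>
      ENNReal.ofReal (‖w - u‖ ^ γ) * ENNReal.ofReal (maxwellian u) := fun w =>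
    (by fun_prop : Measurable fun u : R3 => ENNReal.ofReal (‖w - u‖ ^ γ)).mul
      measurable_maxwellian.ennreal_ofReal
  have hL2 : L = ∫⁻ u, ENNReal.ofReal (‖v + u‖ ^ γ) * ENNReal.ofReal (maxwellian u) := by
    rw [hL, ← (measurePreserving_neg (volume : Measure R3)).lintegral_comp (hmL v)]
    simp [maxwellian]
  have h2L : L + L = ∫⁻ u, (ENNReal.ofReal (‖v - u‖ ^ γ) + ENNReal.ofReal (‖v + u‖ ^ γ))
      * ENNReal.ofReal (maxwellian u) := by
    conv_lhs =>
      congr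
      · rw [hL]
      · rw [hL2]
    rw [← lintegral_add_left (hmL v)]
    simp_rw [add_mul]
  have hpt : ∀ u ∈ A, u ≠ v → u ≠ -v → 2 ^ (-|γ|) * (1 + ‖v‖) ^ γ
      ≤ ‖v - u‖ ^ γ + ‖v + u‖ ^ γ := by
    intro u hu h1 h2
    have hu2 : ‖u‖ < 2 := by simpa using hu.1
    have hu1 : 1 < ‖u‖ := by simpa using hu.2
    have hp : 0 < ‖v - u‖ := norm_pos_iff.2 (sub_ne_zero.2 h1.symm)
    have hq : 0 < ‖v + u‖ := norm_pos_iff.2 fun h => h2 (eq_neg_of_add_eq_zero_right h)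
    rcases le_or_gt 0 γ with hγ | hγ
    · have hmax : (2⁻¹ * (1 + ‖v‖)) ≤ ‖v - u‖ ∨ (2⁻¹ * (1 + ‖v‖)) ≤ ‖v + u‖ := by
        by_contra! hcon
        have e1 : 2 * ‖v‖ ≤ ‖v - u‖ + ‖v + u‖ := by
          have := norm_add_le (v - u) (v + u)
          rwa [show v - u + (v + u) = (2 : ℝ) • v by rw [two_smul]; abel, norm_smul,
            Real.norm_of_nonneg zero_le_two] at this
        have e2 : 2 * ‖u‖ ≤ ‖v + u‖ + ‖v - u‖ := by
          have := norm_sub_le (v + u) (v - u)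
          rwa [show v + u - (v - u) = (2 : ℝ) • u by rw [two_smul]; abel, norm_smul,
            Real.norm_of_nonneg zero_le_two] at this
        linarith [hcon.1, hcon.2]
      have e3 : 2 ^ (-|γ|) * (1 + ‖v‖) ^ γ = (2⁻¹ * (1 + ‖v‖)) ^ γ := by
        rw [Real.mul_rpow (by positivity) (by positivity), abs_of_nonneg hγ,
          Real.rpow_neg zero_le_two, Real.inv_rpow zero_le_two]
      rw [e3]
      rcases hmax with h | h
      · exact (Real.rpow_le_rpow (by positivity) h hγ).trans (le_add_of_nonneg_right (by positivity))
      · exact (Real.rpow_le_rpow (by positivity) h hγ).trans (le_add_of_nonneg_left (by positivity))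
    · have e3 : 2 ^ (-|γ|) * (1 + ‖v‖) ^ γ = (2 * (1 + ‖v‖)) ^ γ := by
        rw [Real.mul_rpow (by positivity) (by positivity), abs_of_neg hγ, neg_neg]
      rw [e3]
      have h5 : ‖v - u‖ ≤ 2 * (1 + ‖v‖) := by
        have := norm_sub_le v u; linarith [norm_nonneg v]
      exact (Real.rpow_le_rpow_of_nonpos hp h5 hγ.le).trans
        (le_add_of_nonneg_right (by positivity))
  set K : ℝ := 2 ^ (-|γ|) * (1 + ‖v‖) ^ γ with hK
  have hK0 : 0 ≤ K := by positivity
  have hmain : ENNReal.ofReal K * D ≤ L + L := by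
    rw [h2L, hD, ← lintegral_const_mul' _ _ ENNReal.ofReal_ne_top]
    refine (lintegral_mono_ae ?_).trans (setLIntegral_le_lintegral A _)
    refine (ae_restrict_iff' hAm).2 ?_
    filter_upwards [ae_iff.2 (by simp : volume {u : R3 | ¬ u ≠ v} = 0),
      ae_iff.2 (by simp : volume {u : R3 | ¬ u ≠ -v} = 0)] with u h1 h2 hu
    gcongr
    rw [← ENNReal.ofReal_add (by positivity) (by positivity)]
    exact ENNReal.ofReal_le_ofReal (hpt u hu h1 h2)
  have hfin : ENNReal.ofReal (2⁻¹ * 2 ^ (-|γ|) * D.toReal * (1 + ‖v‖) ^ γ)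
      = 2⁻¹ * (ENNReal.ofReal K * D) := by
    rw [show 2⁻¹ * 2 ^ (-|γ|) * D.toReal * (1 + ‖v‖) ^ γ = 2⁻¹ * (K * D.toReal) by rw [hK]; ring,
      ENNReal.ofReal_mul (by positivity), ENNReal.ofReal_mul hK0, ENNReal.ofReal_toReal hDt,
      ENNReal.ofReal_inv_of_pos two_pos]
    simp
  rw [hfin]
  calc 2⁻¹ * (ENNReal.ofReal K * D) ≤ 2⁻¹ * (L + L) := by gcongr
    _ = L := by
      rw [← two_mul, ← mul_assoc, ENNReal.inv_mul_cancel two_ne_zero ENNReal.ofNat_ne_top, one_mul]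

/-! ### The collision frequency -/

theorem le_nu {γ : ℝ} (hγ : -3 < γ) {b : ℝ → ℝ} (hb : IsCutoff b) :
    ∃ c : ℝ, 0 < c ∧ ∀ v : R3, c * (angularMass b).toReal * (1 + ‖v‖) ^ γ ≤ nu γ b v := by
  obtain ⟨c, hc, hlow⟩ := le_lintegral_rpow_mul_maxwellian γ
  obtain ⟨C, hC, hup⟩ := lintegral_rpow_mul_sqrt_maxwellian_le hγ
  refine ⟨c, hc, fun v => ?_⟩
  have hm : Measurable fun p : R3 × S2 => kernelB γ b (v - p.1) p.2 * maxwellian p.1 :=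
    (measurable_kernelB γ hb.1 (measurable_const.sub measurable_fst) measurable_snd).mul
      (measurable_maxwellian.comp measurable_fst)
  have h1 : nu γ b v = (angularMass b *
      ∫⁻ u, ENNReal.ofReal (‖v - u‖ ^ γ) * ENNReal.ofReal (maxwellian u)).toReal := by
    rw [nu, integral_eq_lintegral_of_nonneg_ae
      (Filter.Eventually.of_forall fun p => mul_nonneg (kernelB_nonneg hb _ _)
        (maxwellian_pos _).le) hm.aestronglyMeasurable,
      ← lintegral_kernelB hb measurable_maxwellian.ennreal_ofReal]
    simp_rw [ENNReal.ofReal_mul (kernelB_nonneg hb _ _)]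
  -- Finiteness matters for a lower bound too: `toReal` sends an infinite integral to `0`.
  have hfin : ∫⁻ u, ENNReal.ofReal (‖v - u‖ ^ γ) * ENNReal.ofReal (maxwellian u) ≠ ∞ := by
    refine ne_top_of_le_ne_top ENNReal.ofReal_ne_top ((lintegral_mono fun u => ?_).trans (hup v))
    gcongr
    exact maxwellian_le_sqrt u
  rw [h1, ENNReal.toReal_mul, mul_comm c, mul_assoc]
  gcongr
  rw [← ENNReal.ofReal_le_iff_le_toReal hfin]
  exact hlow v

/-! ### Relative entropy -/

/-- The comparison of Hellinger distance and relative entropy: insert `log x = 2 log √x ≥ 2(1 -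
1/√x)` into `x log x + 1 - x`. -/
theorem sq_sqrt_sub_one_le_klFun {x : ℝ} (hx : 0 ≤ x) : (√x - 1) ^ 2 ≤ klFun x := by
  rcases hx.eq_or_lt with rfl | hx'
  · simp [klFun]
  have hs : 0 < √x := Real.sqrt_pos.2 hx'
  have h1 : Real.log x = 2 * Real.log √x := by rw [Real.log_sqrt hx]; ring
  have h2 : 1 - (√x)⁻¹ ≤ Real.log √x := Real.one_sub_inv_le_log_of_pos hs
  have h3 : √x * √x = x := Real.mul_self_sqrt hx
  have h4 : x * (√x)⁻¹ = √x := by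
    rw [← div_eq_mul_inv, Real.div_sqrt]
  rw [klFun, h1]
  nlinarith [mul_le_mul_of_nonneg_left h2 hx]

/-- From `x - 1 = (√x - 1)² + 2(√x - 1)`. The square root governs small deviations and the linear
term large ones, so no case distinction on the size of `x` is needed. -/
theorem abs_sub_one_le_klFun {x : ℝ} (hx : 0 ≤ x) : |x - 1| ≤ 2 * √(klFun x) + klFun x := by
  have h1 := sq_sqrt_sub_one_le_klFun hx
  have h2 : |√x - 1| ≤ √(klFun x) := Real.abs_le_sqrt h1
  have h3 : x - 1 = (√x - 1) * (√x - 1) + 2 * (√x - 1) := by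
    nlinarith [Real.mul_self_sqrt hx]
  calc |x - 1| ≤ |(√x - 1) * (√x - 1)| + |2 * (√x - 1)| := by rw [h3]; exact abs_add_le _ _
    _ = (√x - 1) ^ 2 + 2 * |√x - 1| := by
        rw [abs_mul_self, abs_mul, abs_of_pos (two_pos : (0 : ℝ) < 2), sq]
    _ ≤ _ := by linarith

/-- The relative entropy density `F ln (F / μ) - F + μ`. -/
noncomputable def entropyDensity (F : R3 → R3 → ℝ) (x v : R3) : ℝ :=
  maxwellian v * klFun (F x v / maxwellian v)

theorem log_maxwellian (v : R3) :
    Real.log (maxwellian v) = -(3 / 2 * Real.log (2 * Real.pi)) - ‖v‖ ^ 2 / 2 := by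
  have h : (0 : ℝ) < (2 * Real.pi) ^ (3 / 2 : ℝ) := by positivity
  rw [maxwellian, Real.log_mul (by positivity) (Real.exp_pos _).ne', Real.log_exp, one_div,
    Real.log_inv, Real.log_rpow (by positivity)]
  ring

/-- As `log μ` is affine in `|v|²`, the relative entropy density is a combination of the three
defects. The coefficients in `relEntropy` are exactly these, so `ℰ` is the relative entropy with
respect to `μ`. -/
theorem entropyDensity_eq (F : R3 → R3 → ℝ) (z : R3 × R3) :
    entropyDensity F z.1 z.2 = entropyDefect F z
      + (3 / 2 * Real.log (2 * Real.pi) - 1) * massDefect F z + 1 / 2 * energyDefect F z := by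
  have hμ := maxwellian_pos z.2
  simp only [entropyDensity, klFun, entropyDefect, massDefect, energyDefect]
  rcases eq_or_ne (F z.1 z.2) 0 with h | h
  · rw [h, log_maxwellian]; simp; ring
  · rw [Real.log_div h hμ.ne', log_maxwellian]
    field_simp
    ring

theorem integrable_entropyDensity {Ω : SpatialDomain} {F : R3 → R3 → ℝ}
    (hF : HasFiniteDefects Ω F) :
    Integrable (fun z : R3 × R3 => entropyDensity F z.1 z.2) Ω.phaseMeasure := by
  simp_rw [entropyDensity_eq]
  exact (hF.entropy.add (hF.mass.const_mul _)).add (hF.energy.const_mul _)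

theorem relEntropy_eq_integral {Ω : SpatialDomain} {F : R3 → R3 → ℝ}
    (hF : HasFiniteDefects Ω F) :
    relEntropy Ω F = ∫ z, entropyDensity F z.1 z.2 ∂Ω.phaseMeasure := by
  have h1 := hF.mass.const_mul (3 / 2 * Real.log (2 * Real.pi) - 1)
  have h2 := hF.energy.const_mul (1 / 2)
  have h12 : Integrable (fun z => entropyDefect F z
    + (3 / 2 * Real.log (2 * Real.pi) - 1) * massDefect F z) Ω.phaseMeasure := hF.entropy.add h1
  simp_rw [entropyDensity_eq]
  rw [integral_add h12 h2, integral_add hF.entropy h1, integral_const_mul, integral_const_mul,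
    relEntropy]

theorem phaseMeasure_absolutelyContinuous (Ω : SpatialDomain) :
    Ω.phaseMeasure ≪ (volume : Measure (R3 × R3)) := by
  rw [SpatialDomain.phaseMeasure, volume_eq_prod]
  exact AbsolutelyContinuous.prod restrict_le_self.absolutelyContinuous AbsolutelyContinuous.rfl

theorem entropyDensity_nonneg {F : R3 → R3 → ℝ} {x v : R3} (h : 0 ≤ F x v) :
    0 ≤ entropyDensity F x v :=
  mul_nonneg (maxwellian_pos v).le (klFun_nonneg (div_nonneg h (maxwellian_pos v).le))

theorem relEntropy_nonneg {Ω : SpatialDomain} {F : R3 → R3 → ℝ} (hF : HasFiniteDefects Ω F)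
    (h0 : ∀ᵐ z : R3 × R3, 0 ≤ F z.1 z.2) : 0 ≤ relEntropy Ω F := by
  rw [relEntropy_eq_integral hF]
  refine integral_nonneg_of_ae ?_
  filter_upwards [(phaseMeasure_absolutelyContinuous Ω).ae_le h0] with z hz
  exact entropyDensity_nonneg hz

theorem lintegral_entropyDensity {Ω : SpatialDomain} {F : R3 → R3 → ℝ}
    (hF : HasFiniteDefects Ω F) (h0 : ∀ᵐ z : R3 × R3, 0 ≤ F z.1 z.2) :
    ∫⁻ z, ENNReal.ofReal (entropyDensity F z.1 z.2) ∂Ω.phaseMeasure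
      = ENNReal.ofReal (relEntropy Ω F) := by
  rw [relEntropy_eq_integral hF, ofReal_integral_eq_lintegral_ofReal (integrable_entropyDensity hF)]
  filter_upwards [(phaseMeasure_absolutelyContinuous Ω).ae_le h0] with z hz
  exact entropyDensity_nonneg hz

/-- With `X = F/μ` one has `g = √μ (X - 1)`, and the scalar inequality for `|X - 1|` applies. This
is where nonnegativity of the density enters. -/
theorem abs_le_entropyDensity {g : R3 → R3 → ℝ} {x v : R3} (h : 0 ≤ density g x v) :
    |g x v| ≤ 2 * √(entropyDensity (density g) x v)
      + entropyDensity (density g) x v / √(maxwellian v) := by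
  have hμ := maxwellian_pos v
  have hs : 0 < √(maxwellian v) := Real.sqrt_pos.2 hμ
  have hss : √(maxwellian v) * √(maxwellian v) = maxwellian v := Real.mul_self_sqrt hμ.le
  set X := density g x v / maxwellian v with hX
  have hg : g x v = √(maxwellian v) * (X - 1) := by
    have h1 : density g x v = maxwellian v + √(maxwellian v) * g x v := rfl
    rw [hX, h1, add_div, div_self hμ.ne', add_sub_cancel_left, ← mul_div_assoc, ← mul_assoc, hss,
      mul_div_cancel_left₀ _ hμ.ne']
  have hk : 0 ≤ klFun X := klFun_nonneg (div_nonneg h hμ.le)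
  have hψ : entropyDensity (density g) x v = maxwellian v * klFun X := rfl
  rw [hψ, Real.sqrt_mul hμ.le, hg, abs_mul, abs_of_pos hs]
  calc √(maxwellian v) * |X - 1| ≤ √(maxwellian v) * (2 * √(klFun X) + klFun X) := by
        gcongr; exact abs_sub_one_le_klFun (div_nonneg h hμ.le)
    _ = 2 * (√(maxwellian v) * √(klFun X)) + maxwellian v * klFun X / √(maxwellian v) := by
        rw [mul_div_right_comm, Real.div_sqrt]; ring

/-! ### Averages along free transport -/

theorem measurableSet_cell (Ω : SpatialDomain) : MeasurableSet Ω.cell := by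
  cases Ω with
  | wholeSpace => exact MeasurableSet.univ
  | torus L hL =>
    have : (SpatialDomain.torus L hL).cell = ⋂ i : Fin 3, {x : R3 | x i ∈ Ico 0 L} := by
      ext x; simp [SpatialDomain.cell]
    rw [this]
    exact MeasurableSet.iInter fun i => (by fun_prop : Measurable fun x : R3 => x i)
      measurableSet_Ico

theorem lintegral_ball_comp_sub_smul {g : R3 → ℝ≥0∞} (hg : Measurable g) (x : R3) {τ : ℝ}
    (hτ : 0 < τ) (A : ℝ) :
    ∫⁻ v in Metric.ball 0 A, g (x - τ • v)
      = ENNReal.ofReal (τ ^ (-3 : ℝ)) * ∫⁻ y in Metric.ball x (τ * A), g y := by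
  have hm : Measurable fun v : R3 => τ • v := measurable_const_smul τ
  have hG : Measurable fun y : R3 => (Metric.ball x (τ * A)).indicator g (x - y) :=
    (hg.indicator measurableSet_ball).comp (measurable_const.sub measurable_id)
  have h1 : ∫⁻ v in Metric.ball 0 A, g (x - τ • v)
      = ∫⁻ v, (Metric.ball x (τ * A)).indicator g (x - τ • v) := by
    rw [← lintegral_indicator measurableSet_ball]
    refine lintegral_congr fun v => ?_
    have : x - τ • v ∈ Metric.ball x (τ * A) ↔ v ∈ Metric.ball 0 A := by
      simp [dist_eq_norm, norm_smul, abs_of_pos hτ, hτ]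
    by_cases hv : v ∈ Metric.ball 0 A
    · rw [indicator_of_mem hv, indicator_of_mem (this.2 hv)]
    · rw [indicator_of_notMem hv, indicator_of_notMem (fun h => hv (this.1 h))]
  have hmap : Measure.map (fun v : R3 => τ • v) volume
      = ENNReal.ofReal (τ ^ (-3 : ℝ)) • (volume : Measure R3) := by
    rw [map_addHaar_smul _ hτ.ne']
    congr 2
    rw [finrank_euclideanSpace_fin, abs_of_pos (by positivity), Real.rpow_neg hτ.le]
    norm_cast
  rw [h1, ← lintegral_map hG hm, hmap, lintegral_smul_measure, smul_eq_mul,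
    lintegral_sub_left_eq_self (fun y => (Metric.ball x (τ * A)).indicator g y) x,
    lintegral_indicator measurableSet_ball]

/-- The ball is covered by lattice translates of the cell, each contributing the same integral by
periodicity; it remains to count the translates. -/
theorem lintegral_ball_le_cell {L : ℝ} (hL : 0 < L) {g : R3 → ℝ≥0∞}
    (hp : ∀ (i : Fin 3) (x : R3), g (x + EuclideanSpace.single i L) = g x) (x : R3) {R : ℝ}
    (hR : 0 ≤ R) :
    ∫⁻ y in Metric.ball x R, g y ≤ ENNReal.ofReal ((2 * R / L + 2) ^ 3)
      * ∫⁻ y in (SpatialDomain.torus L hL).cell, g y := by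
  let T : (Fin 3 → ℤ) → R3 := fun k => ∑ i, k i • (EuclideanSpace.single i L : R3)
  have hT : ∀ k i, T k i = k i * L := fun k i => by
    fin_cases i <;> simp [T, Fin.sum_univ_three]
  have hper : ∀ k, Function.Periodic g (T k) := fun k => by
    have h1 : ∀ i : Fin 3, Function.Periodic g (k i • (EuclideanSpace.single i L : R3)) :=
      fun i => Function.Periodic.zsmul (fun x => hp i x) (k i)
    simp only [T, Fin.sum_univ_three]
    exact ((h1 0).add_period (h1 1)).add_period (h1 2)
  let S : Finset (Fin 3 → ℤ) :=
    Fintype.piFinset fun i => Finset.Icc ⌊(x i - R) / L⌋ ⌊(x i + R) / L⌋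
  set Q := (SpatialDomain.torus L hL).cell with hQ
  have hQm : MeasurableSet Q := measurableSet_cell _
  have hcov : Metric.ball x R ⊆ ⋃ k ∈ S, (fun y => y - T k) ⁻¹' Q := by
    intro y hy
    have hyn : ∀ i, |y i - x i| ≤ R := fun i => by
      have h1 : ‖(y - x) i‖ ≤ ‖y - x‖ := PiLp.norm_apply_le (y - x) i
      have h2 : ‖y - x‖ < R := by simpa [dist_eq_norm] using hy
      simpa using h1.trans h2.le
    simp only [mem_iUnion]
    refine ⟨fun i => ⌊y i / L⌋, ?_, ?_⟩
    · rw [Fintype.mem_piFinset]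
      intro i
      have := abs_le.1 (hyn i)
      rw [Finset.mem_Icc]
      constructor <;> apply Int.floor_le_floor <;> gcongr <;> linarith
    · intro i
      have h1 := Int.floor_le (y i / L)
      have h2 := Int.lt_floor_add_one (y i / L)
      rw [le_div_iff₀ hL] at h1
      rw [div_lt_iff₀ hL] at h2
      have h3 : (y - T fun i => ⌊y i / L⌋) i = y i - ⌊y i / L⌋ * L := by
        rw [PiLp.sub_apply, hT]
      rw [mem_Ico, h3]
      constructor <;> linarith
  have hcell : ∀ k, ∫⁻ y in (fun y => y - T k) ⁻¹' Q, g y = ∫⁻ y in Q, g y := fun k => by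
    have h1 : (fun y => g (y - T k)) = g := funext fun y => (hper k).sub_eq y
    have := (measurePreserving_sub_right (volume : Measure R3) (T k)).setLIntegral_comp_preimage_emb
      (MeasurableEquiv.subRight (T k)).measurableEmbedding g Q
    rw [h1] at this
    exact this
  have hcard : (S.card : ℝ) ≤ (2 * R / L + 2) ^ 3 := by
    -- One unit comes from the closed integer interval, one from rounding down its lower end.
    have h1 : ∀ i, ((Finset.Icc ⌊(x i - R) / L⌋ ⌊(x i + R) / L⌋).card : ℝ) ≤ 2 * R / L + 2 := by
      intro i
      have h2 := Int.lt_floor_add_one ((x i - R) / L)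
      have h3 := Int.floor_le ((x i + R) / L)
      have h4 : ⌊(x i - R) / L⌋ ≤ ⌊(x i + R) / L⌋ := by
        apply Int.floor_le_floor; gcongr; linarith
      rw [Int.card_Icc]
      have h5 : (((⌊(x i + R) / L⌋ + 1 - ⌊(x i - R) / L⌋).toNat : ℤ) : ℝ)
          = ⌊(x i + R) / L⌋ + 1 - ⌊(x i - R) / L⌋ := by
        rw [Int.toNat_of_nonneg (by linarith)]; push_cast; ring
      have h6 : (x i + R) / L - (x i - R) / L = 2 * R / L := by ring
      rw [← Int.cast_natCast, h5]
      linarith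
    rw [Fintype.card_piFinset]
    push_cast
    calc _ ≤ ∏ _i : Fin 3, (2 * R / L + 2) :=
          Finset.prod_le_prod (fun _ _ => by positivity) fun i _ => h1 i
      _ = _ := by simp
  calc ∫⁻ y in Metric.ball x R, g y ≤ ∫⁻ y in ⋃ k ∈ S, (fun y => y - T k) ⁻¹' Q, g y :=
        lintegral_mono_set hcov
    _ ≤ ∑ k ∈ S, ∫⁻ y in (fun y => y - T k) ⁻¹' Q, g y := by
        have h1 : volume.restrict (⋃ k ∈ S, (fun y => y - T k) ⁻¹' Q)
            ≤ ∑ k ∈ S, (volume : Measure R3).restrict ((fun y => y - T k) ⁻¹' Q) := by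
          refine Measure.le_iff.2 fun s hs => ?_
          rw [restrict_apply hs, Measure.finsetSum_apply, inter_iUnion₂]
          refine (measure_biUnion_finset_le _ _).trans (Finset.sum_le_sum fun k _ => ?_)
          rw [restrict_apply hs]
        refine (lintegral_mono' h1 le_rfl).trans_eq ?_
        rw [lintegral_finsetSum_measure]
    _ = S.card * ∫⁻ y in Q, g y := by
        rw [Finset.sum_congr rfl fun k _ => hcell k, Finset.sum_const, nsmul_eq_mul]
    _ ≤ _ := by
        gcongr
        rw [← ENNReal.ofReal_natCast]
        exact ENNReal.ofReal_le_ofReal hcard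

/-- The Jacobian factor is `τ^{-3}`. On the torus a long flight wraps around, but the number of
cells visited grows only like `τ³`: `τ^{-1}(2τA/L + 2) = 2A/L + 2/τ`, which for `λ ≤ min(1, τ)` is
at most `(2A/L + 2)/λ`. -/
theorem lintegral_transport_le (Ω : SpatialDomain) {A : ℝ} (hA : 0 ≤ A) :
    ∃ C : ℝ, 0 < C ∧ ∀ g : R3 → ℝ≥0∞, Measurable g → Ω.IsFunctionOn g → ∀ (x : R3) (lam τ : ℝ),
      0 < lam → lam ≤ 1 → lam ≤ τ →
      ∫⁻ v in Metric.ball 0 A, g (x - τ • v)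
        ≤ ENNReal.ofReal (C * lam ^ (-3 : ℝ)) * ∫⁻ y in Ω.cell, g y := by
  cases Ω with
  | wholeSpace =>
    refine ⟨1, one_pos, fun g hg _ x lam τ h0 h1 h2 => ?_⟩
    have hτ : 0 < τ := h0.trans_le h2
    rw [lintegral_ball_comp_sub_smul hg x hτ]
    gcongr
    · rw [one_mul]
      exact Real.rpow_le_rpow_of_nonpos h0 h2 (by norm_num)
    · exact subset_univ _
  | torus L hL =>
    refine ⟨(2 * A / L + 2) ^ 3, by positivity, fun g hg hp x lam τ h0 h1 h2 => ?_⟩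
    have hτ : 0 < τ := h0.trans_le h2
    rw [lintegral_ball_comp_sub_smul hg x hτ]
    refine (mul_le_mul_right (lintegral_ball_le_cell hL hp x
      (mul_nonneg hτ.le hA)) _).trans ?_
    rw [← mul_assoc, ← ENNReal.ofReal_mul (by positivity)]
    refine mul_le_mul' (ENNReal.ofReal_le_ofReal ?_) le_rfl
    have e : ∀ r : ℝ, 0 < r → r ^ (-3 : ℝ) = (r⁻¹) ^ 3 := fun r hr => by
      rw [Real.rpow_neg hr.le, inv_pow]; norm_cast
    rw [e _ hτ, e _ h0, ← mul_pow, ← mul_pow]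
    refine pow_le_pow_left₀ (by positivity) ?_ 3
    have h3 : τ⁻¹ ≤ lam⁻¹ := inv_anti₀ h0 h2
    have h4 : 1 ≤ lam⁻¹ := (one_le_inv₀ h0).2 h1
    have h5 : τ⁻¹ * (2 * (τ * A) / L + 2) = 2 * A / L + 2 * τ⁻¹ := by field_simp
    have h6 : 0 ≤ 2 * A / L := by positivity
    rw [h5]
    nlinarith

theorem IsFunctionOn_comp {Ω : SpatialDomain} {α β : Type} {g : R3 → α} (h : Ω.IsFunctionOn g)
    (F : α → β) : Ω.IsFunctionOn fun x => F (g x) := by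
  cases Ω with
  | wholeSpace => trivial
  | torus L hL => exact fun i x => congrArg F (h i x)

theorem quasiMeasurePreserving_transport (x : R3) {τ : ℝ} (hτ : 0 < τ) :
    QuasiMeasurePreserving (fun z : R3 × R3 => (x - τ • z.1, z.2)) volume volume := by
  have h1 : QuasiMeasurePreserving (fun v : R3 => τ • v) volume volume :=
    ⟨measurable_const_smul τ, by
      rw [map_addHaar_smul _ hτ.ne']; exact smul_absolutelyContinuous⟩
  have h2 := (measurePreserving_sub_left (volume : Measure R3) x).quasiMeasurePreserving.comp h1
  refine ⟨(h2.measurable.comp measurable_fst).prodMk measurable_snd, ?_⟩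
  have h3 : (volume : Measure (R3 × R3)).map (Prod.map ((fun y => x - y) ∘ fun v : R3 => τ • v) id)
      = (volume.map ((fun y => x - y) ∘ fun v : R3 => τ • v)).prod (volume.map id) := by
    rw [volume_eq_prod, map_prod_map _ _ h2.measurable measurable_id]
  change Measure.map (Prod.map ((fun y => x - y) ∘ fun v : R3 => τ • v) id) volume ≪ volume
  rw [h3, volume_eq_prod, Measure.map_id]
  exact h2.absolutelyContinuous.prod AbsolutelyContinuous.rfl

theorem lintegral_sqrt_le {α : Type*} [MeasurableSpace α] (m : Measure α) {ψ : α → ℝ}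
    (hψ : Measurable ψ) :
    ∫⁻ z, ENNReal.ofReal √(ψ z) ∂m
      ≤ m univ ^ (1 / 2 : ℝ) * (∫⁻ z, ENNReal.ofReal (ψ z) ∂m) ^ (1 / 2 : ℝ) := by
  have h := ENNReal.lintegral_mul_le_Lp_mul_Lq m (p := 2) (q := 2)
    Real.HolderConjugate.two_two (f := fun _ => 1) (g := fun z => ENNReal.ofReal √(ψ z))
    aemeasurable_const hψ.sqrt.ennreal_ofReal.aemeasurable
  have h2 : ∀ z, ENNReal.ofReal √(ψ z) ^ (2 : ℝ) = ENNReal.ofReal (ψ z) := fun z => by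
    rw [ENNReal.ofReal_rpow_of_nonneg (Real.sqrt_nonneg _) two_pos.le]
    rcases le_total 0 (ψ z) with h0 | h0
    · norm_num [Real.sq_sqrt h0]
    · rw [Real.sqrt_eq_zero_of_nonpos h0, ENNReal.ofReal_of_nonpos h0]; norm_num
  simpa [h2] using h

/-- Away from the final time, the average of `|g|` over bounded velocities along free transport is
controlled by the relative entropy. -/
theorem lintegral_transport_le_relEntropy (Ω : SpatialDomain) {A : ℝ} (hA : 0 < A) :
    ∃ C : ℝ, 0 < C ∧ ∀ g : R3 → R3 → ℝ, Measurable (fun z : R3 × R3 => g z.1 z.2) →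
      Ω.IsFunctionOn g → (∀ᵐ z : R3 × R3, 0 ≤ density g z.1 z.2) →
      HasFiniteDefects Ω (density g) → ∀ E : ℝ, relEntropy Ω (density g) ≤ E →
      ∀ (x : R3) (lam τ : ℝ), 0 < lam → lam ≤ 1 → lam ≤ τ →
      ∫⁻ z in Metric.ball (0 : R3) A ×ˢ Metric.ball (0 : R3) A, ‖g (x - τ • z.1) z.2‖ₑ
        ≤ ENNReal.ofReal (C * (lam ^ (-(3 / 2) : ℝ) * √E + lam ^ (-3 : ℝ) * E)) := by
  obtain ⟨C, hC, hcell⟩ := lintegral_transport_le Ω hA.le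
  set B : Set R3 := Metric.ball (0 : R3) A with hB
  have hBm : MeasurableSet B := measurableSet_ball
  set V : ℝ := (volume (B ×ˢ B : Set (R3 × R3))).toReal with hV
  have hVfin : volume (B ×ˢ B : Set (R3 × R3)) ≠ ∞ := by
    rw [volume_eq_prod, prod_prod]
    exact ENNReal.mul_ne_top measure_ball_lt_top.ne measure_ball_lt_top.ne
  -- The factor `1/√μ` is unbounded at large velocities; boundedness of the sampled velocity is
  -- needed here.
  obtain ⟨S, hS, hμ⟩ : ∃ S : ℝ, 0 < S ∧ ∀ w ∈ B, (√(maxwellian w))⁻¹ ≤ S := by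
    obtain ⟨S, hS⟩ := (isCompact_closedBall (0 : R3) A).bddAbove_image
      (f := fun w => (√(maxwellian w))⁻¹) (Continuous.continuousOn
        (continuous_maxwellian.sqrt.inv₀ fun w => (Real.sqrt_pos.2 (maxwellian_pos w)).ne'))
    refine ⟨max S 1, by positivity, fun w hw => le_max_of_le_left (hS ⟨w, ?_, rfl⟩)⟩
    exact Metric.ball_subset_closedBall hw
  refine ⟨2 * √V * √C + S * C + 1, by positivity, ?_⟩
  intro g hg hper hpos hdef E hE x lam τ h0 h1 h2
  have hτ : 0 < τ := h0.trans_le h2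
  have hE0 : 0 ≤ E := (relEntropy_nonneg hdef hpos).trans hE
  set ψ := entropyDensity (density g) with hψ
  have hdm : Measurable fun z : R3 × R3 => density g z.1 z.2 := by
    unfold density
    exact (measurable_maxwellian.comp measurable_snd).add
      ((measurable_maxwellian.comp measurable_snd).sqrt.mul hg)
  have hψm : Measurable fun z : R3 × R3 => ψ z.1 z.2 :=
    (measurable_maxwellian.comp measurable_snd).mul
      (measurable_klFun.comp (hdm.div (measurable_maxwellian.comp measurable_snd)))
  have htr : Measurable fun z : R3 × R3 => (x - τ • z.1, z.2) := by fun_prop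
  have hψt : Measurable fun z : R3 × R3 => ψ (x - τ • z.1) z.2 := hψm.comp htr
  have hψe : Measurable fun z : R3 × R3 => ENNReal.ofReal (ψ z.1 z.2) := hψm.ennreal_ofReal
  set D := ∫⁻ z in B ×ˢ B, ENNReal.ofReal (ψ (x - τ • z.1) z.2) with hD
  have hDle : D ≤ ENNReal.ofReal (C * lam ^ (-3 : ℝ) * E) := by
    have hG : Measurable fun y : R3 => ∫⁻ w, ENNReal.ofReal (ψ y w) := hψe.lintegral_prod_right'
    have hGp : Ω.IsFunctionOn fun y : R3 => ∫⁻ w, ENNReal.ofReal (ψ y w) :=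
      IsFunctionOn_comp hper fun h : R3 → ℝ => ∫⁻ w, ENNReal.ofReal (maxwellian w *
        klFun ((maxwellian w + √(maxwellian w) * h w) / maxwellian w))
    calc D = ∫⁻ v in B, ∫⁻ w in B, ENNReal.ofReal (ψ (x - τ • v) w) := by
          rw [hD, volume_eq_prod, ← prod_restrict, lintegral_prod _
            hψt.ennreal_ofReal.aemeasurable]
      _ ≤ ∫⁻ v in B, ∫⁻ w, ENNReal.ofReal (ψ (x - τ • v) w) :=
          lintegral_mono fun v => setLIntegral_le_lintegral _ _
      _ ≤ ENNReal.ofReal (C * lam ^ (-3 : ℝ)) *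
            ∫⁻ y in Ω.cell, ∫⁻ w, ENNReal.ofReal (ψ y w) :=
          hcell (fun y => ∫⁻ w, ENNReal.ofReal (ψ y w)) hG hGp x lam τ h0 h1 h2
      _ = ENNReal.ofReal (C * lam ^ (-3 : ℝ)) * ENNReal.ofReal (relEntropy Ω (density g)) := by
          rw [← lintegral_entropyDensity hdef hpos, SpatialDomain.phaseMeasure,
            lintegral_prod _ hψe.aemeasurable]
      _ ≤ ENNReal.ofReal (C * lam ^ (-3 : ℝ)) * ENNReal.ofReal E := by gcongr
      _ = _ := by rw [← ENNReal.ofReal_mul (by positivity)]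
  have hpt : ∀ᵐ z : R3 × R3 ∂volume.restrict (B ×ˢ B), ‖g (x - τ • z.1) z.2‖ₑ
      ≤ 2 * ENNReal.ofReal √(ψ (x - τ • z.1) z.2)
        + ENNReal.ofReal S * ENNReal.ofReal (ψ (x - τ • z.1) z.2) := by
    refine (ae_restrict_iff' (hBm.prod hBm)).2 ?_
    filter_upwards [(quasiMeasurePreserving_transport x hτ).ae hpos] with z hz hzB
    have h3 := abs_le_entropyDensity hz
    have h4 := entropyDensity_nonneg hz
    have h5 : ∀ r : ℝ, 2 * ENNReal.ofReal r = ENNReal.ofReal (2 * r) := fun r => by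
      rw [ENNReal.ofReal_mul zero_le_two, ENNReal.ofReal_ofNat]
    rw [h5, ← ENNReal.ofReal_mul hS.le, ← ENNReal.ofReal_add (by positivity) (mul_nonneg hS.le h4), Real.enorm_eq_ofReal_abs]
    refine ENNReal.ofReal_le_ofReal (h3.trans ?_)
    gcongr
    rw [div_eq_inv_mul]
    exact mul_le_mul_of_nonneg_right (hμ _ hzB.2) h4
  -- Cauchy-Schwarz on a set of finite volume; taking the root turns `λ^{-3}E` into `λ^{-3/2}√E`.
  have hsq := lintegral_sqrt_le ((volume : Measure (R3 × R3)).restrict (B ×ˢ B)) hψt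
  rw [restrict_apply_univ] at hsq
  have hK : 0 ≤ C * lam ^ (-3 : ℝ) * E := by positivity
  have hsq2 : (volume (B ×ˢ B : Set (R3 × R3))) ^ (1 / 2 : ℝ) * D ^ (1 / 2 : ℝ)
      ≤ ENNReal.ofReal (√V * (√C * (lam ^ (-(3 / 2) : ℝ) * √E))) := by
    have h5 : √(C * lam ^ (-3 : ℝ) * E) = √C * (lam ^ (-(3 / 2) : ℝ) * √E) := by
      rw [Real.sqrt_mul (by positivity), Real.sqrt_mul hC.le, mul_assoc]
      congr 2
      rw [Real.sqrt_eq_rpow, ← Real.rpow_mul h0.le]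
      norm_num
    have h6 : (volume (B ×ˢ B : Set (R3 × R3))) ^ (1 / 2 : ℝ) = ENNReal.ofReal √V := by
      rw [Real.sqrt_eq_rpow, ← ENNReal.ofReal_rpow_of_nonneg ENNReal.toReal_nonneg (by norm_num),
        ENNReal.ofReal_toReal hVfin]
    have h7 : ENNReal.ofReal (C * lam ^ (-3 : ℝ) * E) ^ (1 / 2 : ℝ)
        = ENNReal.ofReal √(C * lam ^ (-3 : ℝ) * E) := by
      rw [Real.sqrt_eq_rpow, ← ENNReal.ofReal_rpow_of_nonneg hK (by norm_num)]
    rw [← h5, h6, ENNReal.ofReal_mul (Real.sqrt_nonneg _), ← h7]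
    gcongr
  calc ∫⁻ z in B ×ˢ B, ‖g (x - τ • z.1) z.2‖ₑ
      ≤ ∫⁻ z in B ×ˢ B, (2 * ENNReal.ofReal √(ψ (x - τ • z.1) z.2)
        + ENNReal.ofReal S * ENNReal.ofReal (ψ (x - τ • z.1) z.2)) := lintegral_mono_ae hpt
    _ = 2 * (∫⁻ z in B ×ˢ B, ENNReal.ofReal √(ψ (x - τ • z.1) z.2)) + ENNReal.ofReal S * D := by
        rw [lintegral_add_left (hψt.sqrt.ennreal_ofReal.const_mul 2),
          lintegral_const_mul' _ _ (by norm_num), lintegral_const_mul' _ _ ENNReal.ofReal_ne_top]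
    _ ≤ 2 * ENNReal.ofReal (√V * (√C * (lam ^ (-(3 / 2) : ℝ) * √E)))
          + ENNReal.ofReal S * ENNReal.ofReal (C * lam ^ (-3 : ℝ) * E) := by
        exact add_le_add (mul_le_mul' le_rfl (hsq.trans hsq2)) (mul_le_mul' le_rfl hDle)
    _ = ENNReal.ofReal (2 * (√V * (√C * (lam ^ (-(3 / 2) : ℝ) * √E)))
          + S * (C * lam ^ (-3 : ℝ) * E)) := by
        rw [ENNReal.ofReal_add (by positivity) (by positivity), ENNReal.ofReal_mul zero_le_two,
          ENNReal.ofReal_mul (p := S) hS.le, ENNReal.ofReal_ofNat]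
    _ ≤ _ := by
        refine ENNReal.ofReal_le_ofReal ?_
        have a1 : 0 ≤ lam ^ (-(3 / 2) : ℝ) * √E := by positivity
        have a2 : 0 ≤ lam ^ (-3 : ℝ) * E := by positivity
        have a3 : 0 ≤ √V * √C := by positivity
        have a4 : 0 ≤ S * C := by positivity
        nlinarith [mul_nonneg a3 a2, mul_nonneg a4 a1]

/-! ### An abstract transport estimate -/

theorem lintegral_exp_le_one {c : ℝ} (hc : 0 ≤ c) {t : ℝ} (ht : 0 ≤ t) :
    ∫⁻ s in Ioc 0 t, ENNReal.ofReal (c * Real.exp (-c * (t - s))) ≤ 1 := by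
  have hcont : Continuous fun s : ℝ => c * Real.exp (-c * (t - s)) := by fun_prop
  have hd : ∀ s : ℝ, HasDerivAt (fun s => Real.exp (-c * (t - s)))
      (c * Real.exp (-c * (t - s))) s := fun s => by
    have h1 : HasDerivAt (fun s : ℝ => -c * (t - s)) c s := by
      have := ((hasDerivAt_id s).const_sub t).const_mul (-c)
      simpa using this
    simpa [mul_comm] using h1.exp
  have hint : ∫ s in (0 : ℝ)..t, c * Real.exp (-c * (t - s))
      = Real.exp (-c * (t - t)) - Real.exp (-c * (t - 0)) :=
    intervalIntegral.integral_eq_sub_of_hasDerivAt (fun s _ => hd s)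
      (hcont.intervalIntegrable _ _)
  rw [← ofReal_integral_eq_lintegral_ofReal
    ((hcont.intervalIntegrable (μ := volume) 0 t).1)
    (Filter.Eventually.of_forall fun s => mul_nonneg hc (Real.exp_pos _).le),
    ← intervalIntegral.integral_of_le ht, hint]
  rw [ENNReal.ofReal_le_one]
  simp only [sub_self, mul_zero, Real.exp_zero]
  linarith [Real.exp_pos (-c * (t - 0))]

/-- A finite absolutely continuous measure is, up to small mass, concentrated on a bounded set on
which its density is bounded. -/
theorem exists_bounded_density (M : Measure (R3 × R3)) [IsFiniteMeasure M]
    (hM : M ≪ volume) {ε : ℝ≥0∞} (hε : ε ≠ 0) :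
    ∃ (A : ℝ) (D : Set (R3 × R3)), 0 < A ∧ MeasurableSet D ∧ M Dᶜ ≤ ε ∧
      D ⊆ Metric.ball 0 A ×ˢ Metric.ball 0 A ∧
      ∀ g : R3 × R3 → ℝ≥0∞, ∫⁻ z in D, g z ∂M ≤ ENNReal.ofReal A * ∫⁻ z in D, g z := by
  set r := M.rnDeriv volume with hr
  have hrm : Measurable r := measurable_rnDeriv _ _
  have hMr : (volume : Measure (R3 × R3)).withDensity r = M := withDensity_rnDeriv_eq _ _ hM
  -- These sets exhaust everything except where the density is infinite, an `M`-null set; continuity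
  -- from above then yields a suitable `n`.
  let D : ℕ → Set (R3 × R3) := fun n =>
    (Metric.ball 0 ((n : ℝ) + 1) ×ˢ Metric.ball 0 ((n : ℝ) + 1)) ∩ {z | r z ≤ (n : ℝ≥0∞) + 1}
  have hDm : ∀ n, MeasurableSet (D n) := fun n =>
    (measurableSet_ball.prod measurableSet_ball).inter (hrm measurableSet_Iic)
  have hanti : Antitone fun n => (D n)ᶜ := by
    intro m n hmn
    have hmn' : (m : ℝ) + 1 ≤ n + 1 := by gcongr
    have h2 : (m : ℝ≥0∞) + 1 ≤ n + 1 := by gcongr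
    exact compl_subset_compl.2 (inter_subset_inter (prod_mono (Metric.ball_subset_ball hmn')
      (Metric.ball_subset_ball hmn')) fun z hz => le_trans hz h2)
  have hlim := tendsto_measure_iInter_atTop (μ := M) (s := fun n => (D n)ᶜ)
    (fun n => (hDm n).compl.nullMeasurableSet) hanti ⟨0, measure_ne_top _ _⟩
  have hzero : M (⋂ n, (D n)ᶜ) = 0 := by
    have h1 : ∀ᵐ z ∂M, r z < ∞ := hM.ae_le (rnDeriv_lt_top M volume)
    refine measure_mono_null (fun z hz => ?_) (ae_iff.1 h1)
    intro hlt
    obtain ⟨n1, h1⟩ := exists_nat_gt ‖z.1‖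
    obtain ⟨n2, h2⟩ := exists_nat_gt ‖z.2‖
    obtain ⟨n3, h3⟩ := ENNReal.exists_nat_gt hlt.ne
    have hzn := mem_iInter.1 hz (n1 + n2 + n3)
    refine hzn ⟨⟨?_, ?_⟩, ?_⟩
    · rw [mem_ball_zero_iff]; push_cast
      have : (0 : ℝ) ≤ n2 := by positivity
      have : (0 : ℝ) ≤ n3 := by positivity
      linarith
    · rw [mem_ball_zero_iff]; push_cast
      have : (0 : ℝ) ≤ n1 := by positivity
      have : (0 : ℝ) ≤ n3 := by positivity
      linarith
    · refine h3.le.trans ?_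
      push_cast
      exact (le_add_self).trans le_self_add
  rw [hzero] at hlim
  obtain ⟨n, hn⟩ := ((tendsto_order.1 hlim).2 ε (pos_iff_ne_zero.2 hε)).exists
  refine ⟨(n : ℝ) + 1, D n, by positivity, hDm n, hn.le, inter_subset_left, fun g => ?_⟩
  have hcast : ENNReal.ofReal ((n : ℝ) + 1) = (n : ℝ≥0∞) + 1 := by
    rw [ENNReal.ofReal_add (by positivity) zero_le_one]; simp
  rw [hcast]
  calc ∫⁻ z in D n, g z ∂M
      ≤ ∫⁻ z, g z ∂((n : ℝ≥0∞) + 1) • (volume.restrict (D n)) := by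
        refine lintegral_mono' (Measure.le_iff.2 fun s hs => ?_) le_rfl
        rw [Measure.smul_apply, restrict_apply hs, restrict_apply hs, smul_eq_mul]
        calc M (s ∩ D n) = ∫⁻ z in s ∩ D n, r z := by
              rw [← withDensity_apply _ (hs.inter (hDm n)), hMr]
          _ ≤ ∫⁻ _ in s ∩ D n, ((n : ℝ≥0∞) + 1) :=
              setLIntegral_mono' (hs.inter (hDm n)) fun z hz => hz.2.2
          _ = _ := by rw [setLIntegral_const]
    _ = _ := by rw [lintegral_smul_measure, smul_eq_mul]

/-- The properties of a solution on `[0, t)` that enter the transport estimate. -/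
structure IsControlled (Ω : SpatialDomain) (β t E : ℝ) (H : ℝ≥0∞) (f : ℝ → R3 → R3 → ℝ) :
    Prop where
  measurable : Measurable fun z : ℝ × R3 × R3 => f z.1 z.2.1 z.2.2
  isFunctionOn : ∀ s ∈ Ico 0 t, Ω.IsFunctionOn (f s)
  nonneg : ∀ s ∈ Ico 0 t, ∀ᵐ z : R3 × R3, 0 ≤ density (f s) z.1 z.2
  finite : ∀ s ∈ Ico 0 t, HasFiniteDefects Ω (density (f s))
  entropy : ∀ s ∈ Ico 0 t, relEntropy Ω (density (f s)) ≤ E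
  bounded : ∀ s ∈ Ico 0 t, ∀ᵐ z : R3 × R3, ENNReal.ofReal (weight β z.2) * ‖f s z.1 z.2‖ₑ ≤ H

/-- The time integral along characteristics of a weighted velocity average. -/
noncomputable def transportAverage (β : ℝ) (q : R3 → ℝ) (M : Measure (R3 × R3))
    (f : ℝ → R3 → R3 → ℝ) (t : ℝ) (x : R3) : ℝ≥0∞ :=
  ∫⁻ s in Ioc 0 t, ∫⁻ z, ENNReal.ofReal (q z.1 * Real.exp (-q z.1 * (t - s)))
    * (ENNReal.ofReal (weight β z.2) * ‖f s (x - (t - s) • z.1) z.2‖ₑ) ∂M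

/-- The time `s = t` is dropped because the map `v ↦ x - (t-s)v` is constant there and does not
preserve null sets. -/
theorem ae_Ioc_mem_Ico (t : ℝ) : ∀ᵐ s ∂(volume.restrict (Ioc 0 t) : Measure ℝ), s ∈ Ico 0 t := by
  refine (ae_restrict_iff' measurableSet_Ioc).2 ?_
  filter_upwards [ae_iff.2 (by simp : volume {s : ℝ | ¬ s ≠ t} = 0)] with s hs hs'
  exact ⟨hs'.1.le, lt_of_le_of_ne hs'.2 hs⟩

theorem IsControlled.ae_bounded {Ω : SpatialDomain} {β t E : ℝ} {H : ℝ≥0∞}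
    {f : ℝ → R3 → R3 → ℝ} (hf : IsControlled Ω β t E H f) {M : Measure (R3 × R3)}
    (hM : M ≪ volume) (x : R3) {s : ℝ} (hs : s ∈ Ico 0 t) :
    ∀ᵐ z ∂M, ENNReal.ofReal (weight β z.2) * ‖f s (x - (t - s) • z.1) z.2‖ₑ ≤ H :=
  hM.ae_le ((quasiMeasurePreserving_transport x (sub_pos.2 hs.2)).ae (hf.bounded s hs))

theorem lintegral_exp_prod_le {q : R3 → ℝ} (hq : Measurable q) (hq0 : ∀ v, 0 ≤ q v)
    (M : Measure (R3 × R3)) [SFinite M] {t : ℝ} (ht : 0 ≤ t) (H : ℝ≥0∞) :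
    ∫⁻ s in Ioc 0 t, ∫⁻ z, ENNReal.ofReal (q z.1 * Real.exp (-q z.1 * (t - s))) * H ∂M
      ≤ M univ * H := by
  have hm : Measurable fun p : ℝ × (R3 × R3) =>
      ENNReal.ofReal (q p.2.1 * Real.exp (-q p.2.1 * (t - p.1))) := by fun_prop
  rw [lintegral_lintegral_swap (f := fun (s : ℝ) (z : R3 × R3) =>
    ENNReal.ofReal (q z.1 * Real.exp (-q z.1 * (t - s))) * H) (hm.mul_const H).aemeasurable]
  calc ∫⁻ z, (∫⁻ s in Ioc 0 t, ENNReal.ofReal (q z.1 * Real.exp (-q z.1 * (t - s))) * H) ∂M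
      ≤ ∫⁻ _, H ∂M := by
        refine lintegral_mono fun z => ?_
        rw [lintegral_mul_const _ (by fun_prop)]
        exact mul_le_of_le_one_left' (lintegral_exp_le_one (hq0 _) ht)
    _ = M univ * H := by rw [lintegral_const, mul_comm]

theorem transportAverage_le {Ω : SpatialDomain} {β t E : ℝ} {H : ℝ≥0∞} {f : ℝ → R3 → R3 → ℝ}
    (hf : IsControlled Ω β t E H f) {q : R3 → ℝ} (hq : Measurable q) (hq0 : ∀ v, 0 ≤ q v)
    {M : Measure (R3 × R3)} [SFinite M] (hM : M ≪ volume) (ht : 0 ≤ t) (x : R3) :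
    transportAverage β q M f t x ≤ M univ * H := by
  refine le_trans (lintegral_mono_ae ?_) (lintegral_exp_prod_le hq hq0 M ht H)
  filter_upwards [ae_Ioc_mem_Ico t] with s hs
  refine lintegral_mono_ae ?_
  filter_upwards [hf.ae_bounded hM x hs] with z hz
  gcongr

/-- Three regions. Within `λ` of the final time the exponential is dropped, which costs `λ ∫ q dM`.
Away from it, the complement of the good set `D` has mass at most `ε`, and on `D` the entropy
estimate for transport applies. -/
theorem transportAverage_le_relEntropy (Ω : SpatialDomain) {β : ℝ} (hβ : 0 ≤ β) {q : R3 → ℝ}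
    (hq : Measurable q) (hq0 : ∀ v, 0 ≤ q v)
    (hqloc : ∀ A : ℝ, ∃ a B : ℝ, 0 < a ∧ 0 < B ∧ ∀ v ∈ Metric.ball (0 : R3) A, a ≤ q v ∧ q v ≤ B)
    {M : Measure (R3 × R3)} [IsFiniteMeasure M] (hM : M ≪ volume) {ε : ℝ} (hε : 0 < ε) :
    ∃ A : ℝ, 0 < A ∧ ∀ (t E : ℝ) (H : ℝ≥0∞) (f : ℝ → R3 → R3 → ℝ), IsControlled Ω β t E H f →
      0 ≤ t → 0 ≤ E → ∀ (x : R3) (lam : ℝ), 0 < lam → lam ≤ 1 →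
      transportAverage β q M f t x ≤ (ENNReal.ofReal ε
          + ENNReal.ofReal lam * ∫⁻ z, ENNReal.ofReal (q z.1) ∂M) * H
        + ENNReal.ofReal (A * (lam ^ (-(3 / 2) : ℝ) * √E + lam ^ (-3 : ℝ) * E)) := by
  obtain ⟨A, D, hA, hDm, hDc, hDsub, hDint⟩ :=
    exists_bounded_density M hM (ENNReal.ofReal_pos.2 hε).ne'
  obtain ⟨a, B, ha, hB, hab⟩ := hqloc A
  obtain ⟨C, hC, htr⟩ := lintegral_transport_le_relEntropy Ω hA
  obtain ⟨w, hw, hwb⟩ : ∃ w : ℝ, 0 < w ∧ ∀ v ∈ Metric.ball (0 : R3) A, weight β v ≤ w := by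
    refine ⟨(1 + A) ^ β, by positivity, fun v hv => (weight_le_one_add_norm hβ v).trans ?_⟩
    have : ‖v‖ ≤ A := by simpa using (Metric.ball_subset_closedBall hv)
    gcongr
  -- `A` bounds the density of `M` on `D`, `w` the weight, and `C` is the entropy constant. The
  -- ratio `B/a` replaces `q exp(-q(t-s))` by a multiple of `a exp(-a(t-s))`, whose time integral is
  -- at most `1`; hence the bound is uniform in `t`.
  refine ⟨A * (B / a * w) * C, by positivity, ?_⟩
  intro t E H f hf ht hE x lam h0 h1
  set R : ℝ := lam ^ (-(3 / 2) : ℝ) * √E + lam ^ (-3 : ℝ) * E with hR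
  have hR0 : 0 ≤ R := by positivity
  let Φ : ℝ → R3 × R3 → ℝ≥0∞ := fun s z =>
    ENNReal.ofReal (q z.1 * Real.exp (-q z.1 * (t - s)))
      * (ENNReal.ofReal (weight β z.2) * ‖f s (x - (t - s) • z.1) z.2‖ₑ)
  let near : Set ℝ := {s | t - s < lam}
  have hpt : ∀ᵐ s ∂(volume.restrict (Ioc 0 t) : Measure ℝ),
      ∫⁻ z, Φ s z ∂M ≤ (near.indicator (fun _ => ∫⁻ z, ENNReal.ofReal (q z.1) * H ∂M) s
        + ∫⁻ z, ENNReal.ofReal (q z.1 * Real.exp (-q z.1 * (t - s))) * H ∂M.restrict Dᶜ)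
        + ENNReal.ofReal (a * Real.exp (-a * (t - s)))
          * ENNReal.ofReal (A * (B / a * w) * C * R) := by
    filter_upwards [ae_Ioc_mem_Ico t] with s hs
    have hbd := hf.ae_bounded hM x hs
    have hτ : 0 < t - s := sub_pos.2 hs.2
    by_cases hnear : s ∈ near
    · rw [indicator_of_mem hnear]
      refine le_trans (lintegral_mono_ae ?_) (le_add_right (le_add_right le_rfl))
      filter_upwards [hbd] with z hz
      have : q z.1 * Real.exp (-q z.1 * (t - s)) ≤ q z.1 := by
        refine mul_le_of_le_one_right (hq0 _) (Real.exp_le_one_iff.2 ?_)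
        nlinarith [hq0 z.1]
      exact mul_le_mul' (ENNReal.ofReal_le_ofReal this) hz
    · rw [indicator_of_notMem hnear, zero_add]
      have hlam : lam ≤ t - s := not_lt.1 hnear
      rw [← lintegral_add_compl (Φ s) hDm, add_comm]
      refine add_le_add (lintegral_mono_ae ?_) ?_
      · filter_upwards [ae_restrict_of_ae hbd] with z hz
        exact mul_le_mul' le_rfl hz
      · have hΦ : ∀ z ∈ D, Φ s z ≤ ENNReal.ofReal (B * Real.exp (-a * (t - s)) * w)
            * ‖f s (x - (t - s) • z.1) z.2‖ₑ := fun z hz => by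
          obtain ⟨hz1, hz2⟩ := hDsub hz
          obtain ⟨hqa, hqB⟩ := hab z.1 hz1
          have e1 : Real.exp (-q z.1 * (t - s)) ≤ Real.exp (-a * (t - s)) := by
            apply Real.exp_le_exp.2; nlinarith
          have e2 : q z.1 * Real.exp (-q z.1 * (t - s)) ≤ B * Real.exp (-a * (t - s)) :=
            mul_le_mul hqB e1 (Real.exp_pos _).le hB.le
          rw [ENNReal.ofReal_mul (by positivity), mul_assoc]
          exact mul_le_mul' (ENNReal.ofReal_le_ofReal e2)
            (mul_le_mul' (ENNReal.ofReal_le_ofReal (hwb _ hz2)) le_rfl)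
        have hfm : Measurable fun z : R3 × R3 => f s z.1 z.2 :=
          hf.measurable.comp (measurable_const.prodMk measurable_id)
        have h4 := htr (f s) hfm (hf.isFunctionOn s hs) (hf.nonneg s hs) (hf.finite s hs) E
          (hf.entropy s hs) x lam (t - s) h0 h1 hlam
        calc ∫⁻ z in D, Φ s z ∂M ≤ ENNReal.ofReal A * ∫⁻ z in D, Φ s z := hDint _
          _ ≤ ENNReal.ofReal A * ∫⁻ z in D, ENNReal.ofReal (B * Real.exp (-a * (t - s)) * w)
              * ‖f s (x - (t - s) • z.1) z.2‖ₑ := by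
              exact mul_le_mul' le_rfl (setLIntegral_mono' hDm hΦ)
          _ = ENNReal.ofReal A * (ENNReal.ofReal (B * Real.exp (-a * (t - s)) * w) *
              ∫⁻ z in D, ‖f s (x - (t - s) • z.1) z.2‖ₑ) := by
              rw [lintegral_const_mul' _ _ ENNReal.ofReal_ne_top]
          _ ≤ ENNReal.ofReal A * (ENNReal.ofReal (B * Real.exp (-a * (t - s)) * w) *
              ENNReal.ofReal (C * R)) := by
              exact mul_le_mul' le_rfl (mul_le_mul' le_rfl ((lintegral_mono_set hDsub).trans h4))
          _ = _ := by
              rw [← ENNReal.ofReal_mul (by positivity), ← ENNReal.ofReal_mul (by positivity),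
                ← ENNReal.ofReal_mul (by positivity)]
              congr 1
              field_simp
  have hnearm : MeasurableSet near :=
    measurableSet_lt (measurable_const.sub measurable_id) measurable_const
  have hqm : Measurable fun p : ℝ × (R3 × R3) =>
      ENNReal.ofReal (q p.2.1 * Real.exp (-q p.2.1 * (t - p.1))) * H := by fun_prop
  have hm1 : Measurable fun s => near.indicator (fun _ => ∫⁻ z, ENNReal.ofReal (q z.1) * H ∂M) s :=
    measurable_const.indicator hnearm
  have hm2 : Measurable fun s : ℝ => ∫⁻ z, ENNReal.ofReal
      (q z.1 * Real.exp (-q z.1 * (t - s))) * H ∂M.restrict Dᶜ := hqm.lintegral_prod_right'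
  have hm12 : Measurable fun s : ℝ =>
      near.indicator (fun _ => ∫⁻ z, ENNReal.ofReal (q z.1) * H ∂M) s + ∫⁻ z, ENNReal.ofReal
        (q z.1 * Real.exp (-q z.1 * (t - s))) * H ∂M.restrict Dᶜ := hm1.add hm2
  have hI1 : ∫⁻ s in Ioc 0 t, near.indicator (fun _ => ∫⁻ z, ENNReal.ofReal (q z.1) * H ∂M) s
      ≤ ENNReal.ofReal lam * (∫⁻ z, ENNReal.ofReal (q z.1) ∂M) * H := by
    rw [lintegral_indicator_const hnearm, restrict_apply hnearm,
      lintegral_mul_const _ (by fun_prop), mul_comm, ← mul_assoc]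
    gcongr
    calc volume (near ∩ Ioc 0 t) ≤ volume (Ioc (t - lam) t) := by
          refine measure_mono fun s hs => ⟨?_, hs.2.2⟩
          have : t - s < lam := hs.1
          linarith
      _ = ENNReal.ofReal lam := by simp
  have hI2 := lintegral_exp_prod_le hq hq0 (M.restrict Dᶜ) ht H
  have hI3 : ∫⁻ s in Ioc 0 t, ENNReal.ofReal (a * Real.exp (-a * (t - s)))
      * ENNReal.ofReal (A * (B / a * w) * C * R) ≤ ENNReal.ofReal (A * (B / a * w) * C * R) := by
    rw [lintegral_mul_const _ (by fun_prop)]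
    exact mul_le_of_le_one_left' (lintegral_exp_le_one ha.le ht)
  rw [restrict_apply_univ] at hI2
  refine (lintegral_mono_ae hpt).trans ?_
  rw [lintegral_add_left hm12, lintegral_add_left hm1]
  refine add_le_add ?_ hI3
  rw [add_mul, add_comm]
  exact add_le_add (hI2.trans (mul_le_mul' hDc le_rfl)) hI1

/-! ### Collision averages -/

/-- The kernel `B √μ(u)`. -/
noncomputable def scatter (γ : ℝ) (b : ℝ → ℝ) (v : R3) (p : R3 × S2) : ℝ≥0∞ :=
  ENNReal.ofReal (kernelB γ b (v - p.1) p.2) * ENNReal.ofReal √(maxwellian p.1)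

/-- The velocities `v'`, `u'`, `u` at which a collision samples a perturbation. -/
noncomputable def target (i : Fin 3) (v : R3) (p : R3 × S2) : R3 :=
  ![vPrime v p.1 p.2, uPrime v p.1 p.2, p.1] i

/-- The velocities `u'`, `v'`, `v` of the collision partners. -/
noncomputable def partner (i : Fin 3) (v : R3) (p : R3 × S2) : R3 :=
  ![uPrime v p.1 p.2, vPrime v p.1 p.2, v] i

/-- The collision average of `|g|` through one of the velocities `v'`, `u'`, `u`, weighted by the
decay of the partner. -/
noncomputable def partialAverage (γ : ℝ) (b : ℝ → ℝ) (β : ℝ) (i : Fin 3) (v : R3) (g : R3 → ℝ) :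
    ℝ≥0∞ :=
  ∫⁻ p, scatter γ b v p * ENNReal.ofReal (decay β (partner i v p)) * ‖g (target i v p)‖ₑ
    ∂collisionMeasure

/-- The sum of the three collision averages. -/
noncomputable def collisionAverage (γ : ℝ) (b : ℝ → ℝ) (β : ℝ) (v : R3) (g : R3 → ℝ) : ℝ≥0∞ :=
  ∑ i, partialAverage γ b β i v g

instance : SFinite collisionMeasure := prod.instSFinite

theorem measurable_scatter (γ : ℝ) {b : ℝ → ℝ} (hb : Measurable b) {α : Type*}
    [MeasurableSpace α] {v : α → R3} {p : α → R3 × S2} (hv : Measurable v) (hp : Measurable p) :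
    Measurable fun a => scatter γ b (v a) (p a) := by
  have h1 : Measurable fun a => kernelB γ b (v a - (p a).1) (p a).2 :=
    measurable_kernelB γ hb (hv.sub (measurable_fst.comp hp)) (measurable_snd.comp hp)
  have h2 : Measurable fun a => √(maxwellian (p a).1) :=
    (measurable_maxwellian.comp (measurable_fst.comp hp)).sqrt
  exact h1.ennreal_ofReal.mul h2.ennreal_ofReal

theorem measurable_target (i : Fin 3) :
    Measurable fun q : R3 × (R3 × S2) => target i q.1 q.2 := by
  fin_cases i
  · exact measurable_vPrime
  · exact measurable_uPrime
  · exact measurable_fst.comp measurable_snd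

theorem measurable_partner (i : Fin 3) :
    Measurable fun q : R3 × (R3 × S2) => partner i q.1 q.2 := by
  fin_cases i
  · exact measurable_uPrime
  · exact measurable_vPrime
  · exact measurable_fst

theorem quasiMeasurePreserving_target (i : Fin 3) (v : R3) :
    QuasiMeasurePreserving (target i v) collisionMeasure volume := by
  fin_cases i
  · exact quasiMeasurePreserving_vPrime v
  · exact quasiMeasurePreserving_uPrime v
  · exact quasiMeasurePreserving_fst

/-- Energy conservation: the pair of target and partner has total energy `|u|² + |v|²`, in
particular at least `|v|²`. -/
theorem decay_partner_mul_target {β : ℝ} (hβ : 0 ≤ β) (i : Fin 3) (v : R3) (p : R3 × S2) :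
    decay β (partner i v p) * decay β (target i v p) ≤ decay β v := by
  refine decay_mul_decay_le hβ ?_
  have h := norm_sq_uPrime_add_vPrime v p.1 p.2
  have h2 := sq_nonneg ‖p.1‖
  fin_cases i <;> simp only [partner, target, Fin.zero_eta, Fin.mk_one, Fin.reduceFinMk,
    Matrix.cons_val] <;> linarith

theorem lintegral_scatter_le {γ : ℝ} (hγ : -3 < γ) {b : ℝ → ℝ} (hb : IsCutoff b) :
    ∃ C : ℝ, 0 < C ∧ ∀ v : R3, ∫⁻ p, scatter γ b v p ∂collisionMeasure
      ≤ angularMass b * ENNReal.ofReal (C * (1 + ‖v‖) ^ γ) := by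
  obtain ⟨C, hC, h⟩ := lintegral_rpow_mul_sqrt_maxwellian_le hγ
  refine ⟨C, hC, fun v => ?_⟩
  unfold scatter
  rw [lintegral_kernelB hb (m := fun u => ENNReal.ofReal √(maxwellian u))
    measurable_maxwellian.sqrt.ennreal_ofReal v]
  exact mul_le_mul' le_rfl (h v)

theorem collisionAverage_eq_zero {γ : ℝ} {b : ℝ → ℝ} (hb : IsCutoff b)
    (h : angularMass b = 0) (β : ℝ) (v : R3) (g : R3 → ℝ) : collisionAverage γ b β v g = 0 := by
  have h1 : ∫⁻ p, scatter γ b v p ∂collisionMeasure = 0 := by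
    unfold scatter
    rw [lintegral_kernelB hb (m := fun u => ENNReal.ofReal √(maxwellian u))
      measurable_maxwellian.sqrt.ennreal_ofReal v, h, zero_mul]
  have hm : Measurable fun p => scatter γ b v p :=
    measurable_scatter γ hb.1 measurable_const measurable_id
  have h2 := (lintegral_eq_zero_iff hm).1 h1
  refine Finset.sum_eq_zero fun i _ => ?_
  unfold partialAverage
  rw [lintegral_congr_ae (g := fun _ => 0)]
  · simp
  · filter_upwards [h2] with p hp
    have : scatter γ b v p = 0 := hp
    rw [this]; simp

theorem enorm_mul_sqrt_mul_le {γ : ℝ} {b : ℝ → ℝ} (hb : IsCutoff b) {β C : ℝ} (hC : 0 ≤ C)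
    (h : ∀ v : R3, √(maxwellian v) ≤ C * decay β v) (v w : R3) (p : R3 × S2) (a : ℝ) :
    ‖kernelB γ b (v - p.1) p.2 * √(maxwellian p.1 * maxwellian w) * a‖ₑ
      ≤ ENNReal.ofReal C * (scatter γ b v p * ENNReal.ofReal (decay β w) * ‖a‖ₑ) := by
  have hk := kernelB_nonneg (γ := γ) hb (v - p.1) p.2
  rw [Real.sqrt_mul (maxwellian_pos _).le, enorm_mul, enorm_mul, enorm_mul,
    Real.enorm_of_nonneg hk, Real.enorm_of_nonneg (Real.sqrt_nonneg _),
    Real.enorm_of_nonneg (Real.sqrt_nonneg _), scatter]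
  calc _ ≤ ENNReal.ofReal (kernelB γ b (v - p.1) p.2) * (ENNReal.ofReal √(maxwellian p.1)
          * ENNReal.ofReal (C * decay β w)) * ‖a‖ₑ := by
        gcongr
        exact h w
    _ = _ := by rw [ENNReal.ofReal_mul hC]; ring

/-- The linear collision operator is controlled by the collision averages. -/
theorem enorm_K_le {γ : ℝ} {b : ℝ → ℝ} (hb : IsCutoff b) {β C : ℝ} (hC : 0 ≤ C)
    (h : ∀ v : R3, √(maxwellian v) ≤ C * decay β v) (g : R3 → ℝ) (v : R3) :
    ‖K γ b g v‖ₑ ≤ ENNReal.ofReal C * collisionAverage γ b β v g := by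
  have key : ∀ i, ‖∫ p, kernelB γ b (v - p.1) p.2 *
      √(maxwellian p.1 * maxwellian (partner i v p)) * g (target i v p) ∂collisionMeasure‖ₑ
      ≤ ENNReal.ofReal C * partialAverage γ b β i v g := fun i => by
    rw [partialAverage, ← lintegral_const_mul' _ _ ENNReal.ofReal_ne_top]
    exact (enorm_integral_le_lintegral_enorm _).trans
      (lintegral_mono fun p => enorm_mul_sqrt_mul_le hb hC h v _ p _)
  have h1 : K₁ γ b g v = ∫ p, kernelB γ b (v - p.1) p.2 *
      √(maxwellian p.1 * maxwellian (partner 2 v p)) * g (target 2 v p) ∂collisionMeasure := by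
    unfold K₁
    refine integral_congr_ae (Filter.Eventually.of_forall fun p => ?_)
    simp only [partner, target, Matrix.cons_val, mul_comm (maxwellian v)]
  have h2 : K₂ γ b g v = (∫ p, kernelB γ b (v - p.1) p.2 *
      √(maxwellian p.1 * maxwellian (partner 0 v p)) * g (target 0 v p) ∂collisionMeasure)
      + ∫ p, kernelB γ b (v - p.1) p.2 *
      √(maxwellian p.1 * maxwellian (partner 1 v p)) * g (target 1 v p) ∂collisionMeasure := rfl
  rw [K, h1, h2, collisionAverage, Fin.sum_univ_three, mul_add, mul_add]
  exact (enorm_sub_le).trans (add_le_add ((enorm_add_le _ _).trans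
    (add_le_add (key 0) (key 1))) (key 2))

theorem enorm_le_of_weight_mul_le {β : ℝ} {H : ℝ≥0∞} {w : R3} {a : ℝ}
    (h : ENNReal.ofReal (weight β w) * ‖a‖ₑ ≤ H) : ‖a‖ₑ ≤ H * ENNReal.ofReal (decay β w) := by
  have h1 : ENNReal.ofReal (decay β w) * ENNReal.ofReal (weight β w) = 1 := by
    rw [← ENNReal.ofReal_mul (decay_pos β w).le, decay, inv_mul_cancel₀ (weight_pos β w).ne',
      ENNReal.ofReal_one]
  calc ‖a‖ₑ = ENNReal.ofReal (decay β w) * (ENNReal.ofReal (weight β w) * ‖a‖ₑ) := by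
        rw [← mul_assoc, h1, one_mul]
    _ ≤ ENNReal.ofReal (decay β w) * H := by gcongr
    _ = _ := mul_comm _ _

theorem maxwellian_mul_collision (v u : R3) (ω : S2) :
    maxwellian (uPrime v u ω) * maxwellian (vPrime v u ω) = maxwellian u * maxwellian v := by
  have h := norm_sq_uPrime_add_vPrime v u ω
  simp only [maxwellian]
  have e : ∀ x y : R3, 1 / (2 * Real.pi) ^ (3 / 2 : ℝ) * Real.exp (-‖x‖ ^ 2 / 2)
      * (1 / (2 * Real.pi) ^ (3 / 2 : ℝ) * Real.exp (-‖y‖ ^ 2 / 2))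
      = (1 / (2 * Real.pi) ^ (3 / 2 : ℝ)) ^ 2 * Real.exp (-(‖x‖ ^ 2 + ‖y‖ ^ 2) / 2) := by
    intro x y
    rw [show -(‖x‖ ^ 2 + ‖y‖ ^ 2) / 2 = -‖x‖ ^ 2 / 2 + -‖y‖ ^ 2 / 2 by ring, Real.exp_add]
    ring
  rw [e, e, h]

/-- The nonlinear collision operator is controlled by the collision averages, at the price of the
weighted supremum. -/
theorem enorm_Gam_le {γ : ℝ} {b : ℝ → ℝ} (hb : IsCutoff b) {β : ℝ} {H : ℝ≥0∞} (hH : H ≠ ∞)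
    {g : R3 → ℝ} {v : R3} (hv : ENNReal.ofReal (weight β v) * ‖g v‖ₑ ≤ H)
    (hg : ∀ᵐ w : R3, ENNReal.ofReal (weight β w) * ‖g w‖ₑ ≤ H) :
    ‖Gam γ b g v‖ₑ ≤ H * collisionAverage γ b β v g := by
  set m := 1 / √(maxwellian v) with hm
  have hs : 0 < √(maxwellian v) := Real.sqrt_pos.2 (maxwellian_pos v)
  have hm0 : 0 ≤ m := by positivity
  have hplus : ‖m * Qplus γ b (fun u => √(maxwellian u) * g u)
      (fun u => √(maxwellian u) * g u) v‖ₑ ≤ H * partialAverage γ b β 0 v g := by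
    rw [enorm_mul, Qplus, partialAverage, ← lintegral_const_mul' _ _ hH]
    refine (mul_le_mul' le_rfl (enorm_integral_le_lintegral_enorm _)).trans ?_
    rw [← lintegral_const_mul' _ _ enorm_ne_top]
    refine lintegral_mono_ae ?_
    -- The factor at `u'` is spent on the weighted bound and the factor at `v'` is kept for the
    -- average. The a.e. bound reaches `u'` because null sets pull back to null sets.
    filter_upwards [(quasiMeasurePreserving_uPrime v).ae hg] with p hp
    have hk := kernelB_nonneg (γ := γ) hb (v - p.1) p.2
    -- Conservation of energy cancels the prefactor `1/√μ(v)` and leaves `√μ(u)`.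
    have hsq : √(maxwellian (uPrime v p.1 p.2)) * √(maxwellian (vPrime v p.1 p.2))
        = √(maxwellian p.1) * √(maxwellian v) := by
      rw [← Real.sqrt_mul (maxwellian_pos _).le, maxwellian_mul_collision,
        Real.sqrt_mul (maxwellian_pos _).le]
    have he : m * (kernelB γ b (v - p.1) p.2 * (√(maxwellian (uPrime v p.1 p.2)) *
        g (uPrime v p.1 p.2)) * (√(maxwellian (vPrime v p.1 p.2)) * g (vPrime v p.1 p.2)))
        = kernelB γ b (v - p.1) p.2 * √(maxwellian p.1) * (g (uPrime v p.1 p.2) *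
          g (vPrime v p.1 p.2)) := by
      calc _ = m * (√(maxwellian (uPrime v p.1 p.2)) * √(maxwellian (vPrime v p.1 p.2))) *
            (kernelB γ b (v - p.1) p.2 * (g (uPrime v p.1 p.2) * g (vPrime v p.1 p.2))) := by ring
        _ = _ := by rw [hsq, hm]; field_simp
    rw [← enorm_mul, he, enorm_mul, enorm_mul, enorm_mul, Real.enorm_of_nonneg hk,
      Real.enorm_of_nonneg (Real.sqrt_nonneg _)]
    change scatter γ b v p * _ ≤ H * (scatter γ b v p * ENNReal.ofReal (decay β
      (uPrime v p.1 p.2)) * ‖g (vPrime v p.1 p.2)‖ₑ)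
    calc _ ≤ scatter γ b v p * ((H * ENNReal.ofReal (decay β (uPrime v p.1 p.2)))
          * ‖g (vPrime v p.1 p.2)‖ₑ) := by
          gcongr
          exact enorm_le_of_weight_mul_le hp
      _ = _ := by ring
  have hminus : ‖m * Qminus γ b (fun u => √(maxwellian u) * g u)
      (fun u => √(maxwellian u) * g u) v‖ₑ ≤ H * partialAverage γ b β 2 v g := by
    rw [enorm_mul, Qminus, partialAverage, ← lintegral_const_mul' _ _ hH]
    refine (mul_le_mul' le_rfl (enorm_integral_le_lintegral_enorm _)).trans ?_
    rw [← lintegral_const_mul' _ _ enorm_ne_top]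
    refine lintegral_mono fun p => ?_
    have hk := kernelB_nonneg (γ := γ) hb (v - p.1) p.2
    have he : m * (kernelB γ b (v - p.1) p.2 * (√(maxwellian p.1) * g p.1)
        * (√(maxwellian v) * g v))
        = kernelB γ b (v - p.1) p.2 * √(maxwellian p.1) * (g v * g p.1) := by
      rw [hm]; field_simp
    rw [← enorm_mul, he, enorm_mul, enorm_mul, enorm_mul, Real.enorm_of_nonneg hk,
      Real.enorm_of_nonneg (Real.sqrt_nonneg _)]
    change scatter γ b v p * _ ≤ H * (scatter γ b v p * ENNReal.ofReal (decay β v) * ‖g p.1‖ₑ)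
    calc _ ≤ scatter γ b v p * ((H * ENNReal.ofReal (decay β v)) * ‖g p.1‖ₑ) := by
          gcongr
          exact enorm_le_of_weight_mul_le hv
      _ = _ := by ring
  rw [Gam, Q, mul_sub]
  refine enorm_sub_le.trans ((add_le_add hplus hminus).trans ?_)
  rw [← mul_add, collisionAverage, Fin.sum_univ_three]
  gcongr
  -- The average through `u'` does not occur in this bound for `Γ`; it is added for free.
  exact le_self_add

/-! ### The measure induced by collisions on pairs of velocities -/

/-- The density of `collisionPairs` before pushing it forward. -/
noncomputable def pairDensity (γ : ℝ) (b : ℝ → ℝ) (β : ℝ) (q : R3 → ℝ) (i : Fin 3)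
    (a : R3 × (R3 × S2)) : ℝ≥0∞ :=
  scatter γ b a.1 a.2 * ENNReal.ofReal (decay β (partner i a.1 a.2))
    * ENNReal.ofReal (decay β (target i a.1 a.2)) * ENNReal.ofReal (q a.1)⁻¹

/-- The measure induced by collisions on the pairs of a velocity and a velocity which it samples. -/
noncomputable def collisionPairs (γ : ℝ) (b : ℝ → ℝ) (β : ℝ) (q : R3 → ℝ) : Measure (R3 × R3) :=
  ∑ i, Measure.map (fun a : R3 × (R3 × S2) => (a.1, target i a.1 a.2))
    (((volume : Measure R3).prod collisionMeasure).withDensity (pairDensity γ b β q i))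

theorem measurable_pairDensity (γ : ℝ) {b : ℝ → ℝ} (hb : Measurable b) (β : ℝ) {q : R3 → ℝ}
    (hq : Measurable q) (i : Fin 3) : Measurable (pairDensity γ b β q i) :=
  (((measurable_scatter γ hb measurable_fst measurable_snd).mul
    ((measurable_decay β).comp (measurable_partner i)).ennreal_ofReal).mul
    ((measurable_decay β).comp (measurable_target i)).ennreal_ofReal).mul
    (hq.comp measurable_fst).inv.ennreal_ofReal

theorem measurable_pair_target (i : Fin 3) :
    Measurable fun a : R3 × (R3 × S2) => (a.1, target i a.1 a.2) :=
  measurable_fst.prodMk (measurable_target i)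

theorem lintegral_collisionPairs (γ : ℝ) {b : ℝ → ℝ} (hb : Measurable b) (β : ℝ) {q : R3 → ℝ}
    (hq : Measurable q) {g : R3 × R3 → ℝ≥0∞} (hg : Measurable g) :
    ∫⁻ z, g z ∂collisionPairs γ b β q = ∑ i, ∫⁻ v, ∫⁻ p, pairDensity γ b β q i (v, p)
      * g (v, target i v p) ∂collisionMeasure := by
  rw [collisionPairs, lintegral_finsetSum_measure]
  refine Finset.sum_congr rfl fun i _ => ?_
  have hgt : Measurable fun a : R3 × (R3 × S2) => g (a.1, target i a.1 a.2) :=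
    hg.comp (measurable_pair_target i)
  have hd := measurable_pairDensity γ hb β hq i
  rw [lintegral_map hg (measurable_pair_target i), lintegral_withDensity_eq_lintegral_mul _ hd hgt,
    lintegral_prod _ (hd.mul hgt).aemeasurable]
  rfl

/-- Almost every `v`-section of a null set is null, and the sampling map for fixed `v` pulls it back
to a null set. No formula for the density of this measure is needed. -/
theorem collisionPairs_absolutelyContinuous (γ : ℝ) (b : ℝ → ℝ) (β : ℝ) (q : R3 → ℝ) :
    collisionPairs γ b β q ≪ volume := by
  refine AbsolutelyContinuous.mk fun E hE h0 => ?_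
  rw [collisionPairs, Measure.finsetSum_apply]
  refine Finset.sum_eq_zero fun i _ => ?_
  rw [map_apply (measurable_pair_target i) hE]
  refine withDensity_absolutelyContinuous _ _ ?_
  have hE' := measurable_pair_target i hE
  rw [measure_prod_null hE']
  rw [volume_eq_prod, measure_prod_null hE] at h0
  filter_upwards [h0] with v hv
  exact (quasiMeasurePreserving_target i v).preimage_null hv

/-- Insert `1 = w_β^{-1} w_β` at the sampled velocity and `1 = q^{-1} q` at `v`: the inverses belong
to the measure, the other factors to the integrand. -/
theorem lintegral_mul_collisionAverage {γ : ℝ} {b : ℝ → ℝ} (hb : Measurable b) (β : ℝ) {q : R3 → ℝ}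
    (hq : Measurable q) (hq0 : ∀ v, 0 < q v) {e : R3 → ℝ} (he : Measurable e)
    {G : R3 → R3 → ℝ} (hG : Measurable fun z : R3 × R3 => G z.1 z.2) :
    ∫⁻ v, ENNReal.ofReal (e v) * collisionAverage γ b β v (G v)
      = ∫⁻ z, ENNReal.ofReal (q z.1 * e z.1) * (ENNReal.ofReal (weight β z.2) * ‖G z.1 z.2‖ₑ)
        ∂collisionPairs γ b β q := by
  have hw := (continuous_weight β).measurable
  have hm : Measurable fun z : R3 × R3 => ENNReal.ofReal (q z.1 * e z.1)
      * (ENNReal.ofReal (weight β z.2) * ‖G z.1 z.2‖ₑ) :=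
    ((hq.comp measurable_fst).mul (he.comp measurable_fst)).ennreal_ofReal.mul
      ((hw.comp measurable_snd).ennreal_ofReal.mul hG.enorm)
  have hterm : ∀ i, Measurable fun a : R3 × (R3 × S2) => scatter γ b a.1 a.2
      * ENNReal.ofReal (decay β (partner i a.1 a.2)) * ‖G a.1 (target i a.1 a.2)‖ₑ := fun i =>
    ((measurable_scatter γ hb measurable_fst measurable_snd).mul
      ((measurable_decay β).comp (measurable_partner i)).ennreal_ofReal).mul
      (hG.comp (measurable_pair_target i)).enorm
  have hpm : ∀ i, Measurable fun v => partialAverage γ b β i v (G v) := fun i =>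
    (hterm i).lintegral_prod_right'
  rw [lintegral_collisionPairs γ hb β hq hm]
  simp only [collisionAverage, Finset.mul_sum]
  have hpe : ∀ i ∈ (Finset.univ : Finset (Fin 3)), Measurable fun v =>
      ENNReal.ofReal (e v) * partialAverage γ b β i v (G v) := fun i _ =>
    he.ennreal_ofReal.mul (hpm i)
  rw [lintegral_finsetSum _ hpe]
  refine Finset.sum_congr rfl fun i _ => lintegral_congr fun v => ?_
  rw [partialAverage, ← lintegral_const_mul' _ _ ENNReal.ofReal_ne_top]
  refine lintegral_congr fun p => ?_
  have h1 : ENNReal.ofReal (decay β (target i v p)) * ENNReal.ofReal (weight β (target i v p))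
      = 1 := by
    rw [← ENNReal.ofReal_mul (decay_pos β _).le, decay, inv_mul_cancel₀ (weight_pos β _).ne',
      ENNReal.ofReal_one]
  have h2 : ENNReal.ofReal (q v)⁻¹ * ENNReal.ofReal (q v) = 1 := by
    rw [← ENNReal.ofReal_mul (inv_pos.2 (hq0 v)).le, inv_mul_cancel₀ (hq0 v).ne',
      ENNReal.ofReal_one]
  simp only [pairDensity]
  rw [ENNReal.ofReal_mul (hq0 v).le]
  calc ENNReal.ofReal (e v) * (scatter γ b v p * ENNReal.ofReal (decay β (partner i v p))
        * ‖G v (target i v p)‖ₑ)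
      = (ENNReal.ofReal (decay β (target i v p)) * ENNReal.ofReal (weight β (target i v p)))
        * (ENNReal.ofReal (q v)⁻¹ * ENNReal.ofReal (q v)) * (ENNReal.ofReal (e v)
        * (scatter γ b v p * ENNReal.ofReal (decay β (partner i v p))
        * ‖G v (target i v p)‖ₑ)) := by rw [h1, h2, one_mul, one_mul]
    _ = _ := by ring

/-- The decays of target and partner combine into the decay at `v`, after which the scattering
kernel integrates to order `(1+|v|)^γ`. The factor `3` counts the three sampled velocities. -/
theorem lintegral_fst_collisionPairs_le {γ : ℝ} (hγ : -3 < γ) {b : ℝ → ℝ} (hb : IsCutoff b)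
    {β : ℝ} (hβ : 0 ≤ β) :
    ∃ C : ℝ, 0 < C ∧ ∀ q φ : R3 → ℝ, Measurable q → Measurable φ → (∀ v, 0 < q v) →
      (∀ v, 0 ≤ φ v) → ∫⁻ z, ENNReal.ofReal (φ z.1) ∂collisionPairs γ b β q
        ≤ 3 * ∫⁻ v, ENNReal.ofReal
          (φ v * (q v)⁻¹ * (decay β v * ((angularMass b).toReal * (C * (1 + ‖v‖) ^ γ)))) := by
  obtain ⟨C, hC, h⟩ := lintegral_scatter_le hγ hb
  refine ⟨C, hC, fun q φ hq hφ hq0 hφ0 => ?_⟩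
  have hφ1 : Measurable fun z : R3 × R3 => ENNReal.ofReal (φ z.1) :=
    (hφ.comp measurable_fst).ennreal_ofReal
  rw [lintegral_collisionPairs γ hb.1 β hq hφ1]
  have hi : ∀ i : Fin 3, ∫⁻ v, ∫⁻ p, pairDensity γ b β q i (v, p) * ENNReal.ofReal (φ v)
      ∂collisionMeasure ≤ ∫⁻ v, ENNReal.ofReal
          (φ v * (q v)⁻¹ * (decay β v * ((angularMass b).toReal * (C * (1 + ‖v‖) ^ γ)))) := by
    intro i
    refine lintegral_mono fun v => ?_
    have hκ : angularMass b ≠ ∞ := (angularMass_lt_top hb).ne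
    have hqi : 0 ≤ (q v)⁻¹ := (inv_pos.2 (hq0 v)).le
    calc ∫⁻ p, pairDensity γ b β q i (v, p) * ENNReal.ofReal (φ v) ∂collisionMeasure
        ≤ ∫⁻ p, ENNReal.ofReal (φ v * (q v)⁻¹ * decay β v) * scatter γ b v p
          ∂collisionMeasure := by
          refine lintegral_mono fun p => ?_
          have h1 : ENNReal.ofReal (decay β (partner i v p)) * ENNReal.ofReal
              (decay β (target i v p)) ≤ ENNReal.ofReal (decay β v) := by
            rw [← ENNReal.ofReal_mul (decay_pos β _).le]
            exact ENNReal.ofReal_le_ofReal (decay_partner_mul_target hβ i v p)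
          simp only [pairDensity]
          rw [ENNReal.ofReal_mul (mul_nonneg (hφ0 v) hqi), ENNReal.ofReal_mul (hφ0 v)]
          calc _ = ENNReal.ofReal (φ v) * ENNReal.ofReal (q v)⁻¹ * (ENNReal.ofReal
                (decay β (partner i v p)) * ENNReal.ofReal (decay β (target i v p)))
                * scatter γ b v p := by ring
            _ ≤ _ := by gcongr
      _ = ENNReal.ofReal (φ v * (q v)⁻¹ * decay β v)
          * ∫⁻ p, scatter γ b v p ∂collisionMeasure := by
          rw [lintegral_const_mul' _ _ ENNReal.ofReal_ne_top]
      _ ≤ ENNReal.ofReal (φ v * (q v)⁻¹ * decay β v)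
          * (angularMass b * ENNReal.ofReal (C * (1 + ‖v‖) ^ γ)) := mul_le_mul' le_rfl (h v)
      _ = _ := by
          have h0 : 0 ≤ φ v * (q v)⁻¹ * decay β v :=
            mul_nonneg (mul_nonneg (hφ0 v) hqi) (decay_pos β v).le
          conv_lhs => rw [← ENNReal.ofReal_toReal hκ]
          rw [← ENNReal.ofReal_mul ENNReal.toReal_nonneg, ← ENNReal.ofReal_mul h0, mul_assoc]
  calc _ ≤ ∑ _i : Fin 3, ∫⁻ v, ENNReal.ofReal
          (φ v * (q v)⁻¹ * (decay β v * ((angularMass b).toReal * (C * (1 + ‖v‖) ^ γ)))) :=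
        Finset.sum_le_sum fun i _ => hi i
    _ = _ := by simp

theorem measurable_nu (γ : ℝ) {b : ℝ → ℝ} (hb : Measurable b) : Measurable (nu γ b) := by
  have h : Measurable fun q : R3 × (R3 × S2) =>
      kernelB γ b (q.1 - q.2.1) q.2.2 * maxwellian q.2.1 :=
    (measurable_kernelB γ hb (measurable_fst.sub (measurable_fst.comp measurable_snd))
      (measurable_snd.comp measurable_snd)).mul
      (measurable_maxwellian.comp (measurable_fst.comp measurable_snd))
  exact (h.stronglyMeasurable.integral_prod_right' (ν := collisionMeasure)).measurable

/-! ### The transport estimate for collision averages -/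

theorem measurable_collisionAverage (γ : ℝ) {b : ℝ → ℝ} (hb : Measurable b) (β : ℝ) {α : Type*}
    [MeasurableSpace α] {v : α → R3} (hv : Measurable v) {G : α → R3 → ℝ}
    (hG : Measurable fun z : α × R3 => G z.1 z.2) :
    Measurable fun a => collisionAverage γ b β (v a) (G a) := by
  have hva : Measurable fun a : α × (R3 × S2) => (v a.1, a.2) :=
    (hv.comp measurable_fst).prodMk measurable_snd
  have h1 : ∀ i, Measurable fun a : α × (R3 × S2) => scatter γ b (v a.1) a.2
      * ENNReal.ofReal (decay β (partner i (v a.1) a.2)) * ‖G a.1 (target i (v a.1) a.2)‖ₑ := by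
    intro i
    have e1 : Measurable fun a : α × (R3 × S2) => scatter γ b (v a.1) a.2 :=
      measurable_scatter γ hb (hv.comp measurable_fst) measurable_snd
    have e2 : Measurable fun a : α × (R3 × S2) => partner i (v a.1) a.2 :=
      (measurable_partner i).comp hva
    have e3 : Measurable fun a : α × (R3 × S2) => target i (v a.1) a.2 :=
      (measurable_target i).comp hva
    have e4 : Measurable fun a : α × (R3 × S2) => G a.1 (target i (v a.1) a.2) :=
      hG.comp (measurable_fst.prodMk e3)
    exact (e1.mul ((measurable_decay β).comp e2).ennreal_ofReal).mul e4.enorm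
  have h2 : ∀ i, Measurable fun a => partialAverage γ b β i (v a) (G a) := fun i =>
    (h1 i).lintegral_prod_right'
  unfold collisionAverage
  exact Finset.measurable_fun_sum _ fun i _ => h2 i

/-- The integral along characteristics of the collision averages of `f`. -/
noncomputable def collisionIntegral (γ : ℝ) (b : ℝ → ℝ) (β : ℝ) (f : ℝ → R3 → R3 → ℝ) (t : ℝ)
    (x : R3) : ℝ≥0∞ :=
  ∫⁻ v, ∫⁻ s in Ioc 0 t, ENNReal.ofReal (Real.exp (-nu γ b v * (t - s)))
    * collisionAverage γ b β v (f s (x - (t - s) • v))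

theorem measurable_transport {f : ℝ → R3 → R3 → ℝ}
    (hf : Measurable fun z : ℝ × R3 × R3 => f z.1 z.2.1 z.2.2) (t : ℝ) (x : R3) :
    Measurable fun z : (R3 × ℝ) × R3 => f z.1.2 (x - (t - z.1.2) • z.1.1) z.2 := by
  have h : Measurable fun z : (R3 × ℝ) × R3 => (z.1.2, x - (t - z.1.2) • z.1.1, z.2) := by fun_prop
  exact hf.comp h

theorem collisionIntegral_le_transportAverage {γ : ℝ} {b : ℝ → ℝ} (hb : Measurable b) (β : ℝ)
    {q : R3 → ℝ} (hq : Measurable q) (hq0 : ∀ v, 0 < q v) (hnu : ∀ v, q v ≤ nu γ b v)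
    {f : ℝ → R3 → R3 → ℝ} (hf : Measurable fun z : ℝ × R3 × R3 => f z.1 z.2.1 z.2.2) (t : ℝ)
    (x : R3) :
    collisionIntegral γ b β f t x ≤ transportAverage β q (collisionPairs γ b β q) f t x := by
  have hJ : Measurable fun a : R3 × ℝ =>
      collisionAverage γ b β a.1 (f a.2 (x - (t - a.2) • a.1)) :=
    measurable_collisionAverage γ hb β measurable_fst (measurable_transport hf t x)
  have he : Measurable fun a : R3 × ℝ => ENNReal.ofReal (Real.exp (-q a.1 * (t - a.2))) := by
    fun_prop
  have hm : AEMeasurable (Function.uncurry fun (v : R3) (s : ℝ) =>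
      ENNReal.ofReal (Real.exp (-q v * (t - s)))
        * collisionAverage γ b β v (f s (x - (t - s) • v)))
      ((volume : Measure R3).prod (volume.restrict (Ioc 0 t))) := (he.mul hJ).aemeasurable
  calc collisionIntegral γ b β f t x
      ≤ ∫⁻ v, ∫⁻ s in Ioc 0 t, ENNReal.ofReal (Real.exp (-q v * (t - s)))
        * collisionAverage γ b β v (f s (x - (t - s) • v)) := by
        refine lintegral_mono fun v => setLIntegral_mono' measurableSet_Ioc fun s hs => ?_
        gcongr
        · linarith [hs.2]
        · exact hnu v
    _ = ∫⁻ s in Ioc 0 t, ∫⁻ v, ENNReal.ofReal (Real.exp (-q v * (t - s)))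
        * collisionAverage γ b β v (f s (x - (t - s) • v)) := lintegral_lintegral_swap hm
    _ = transportAverage β q (collisionPairs γ b β q) f t x := by
        refine lintegral_congr fun s => ?_
        have hG : Measurable fun z : R3 × R3 => f s (x - (t - s) • z.1) z.2 := by
          have h : Measurable fun z : R3 × R3 => (s, x - (t - s) • z.1, z.2) := by fun_prop
          exact hf.comp h
        exact lintegral_mul_collisionAverage hb β hq hq0 (e := fun v => Real.exp (-q v * (t - s)))
          (by fun_prop) hG

/-- With `q` proportional to `(1+|v|)^γ`, the mass of the pair measure is at most a multiple of `∫
w_β^{-1}`, finite since `β > 3`, and the integral of `q` at most a multiple of `∫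
w_β^{-1}(1+|v|)^γ`, finite since `β > 3 + γ`. The constant `C` does not depend on `ε`; only `A`
does. -/
theorem collisionIntegral_le {Ω : SpatialDomain} {γ β : ℝ} (hγ : -3 < γ) (hβ3 : 3 < β)
    (hβγ : 3 < β - γ) {b : ℝ → ℝ} (hb : IsCutoff b) :
    ∃ C : ℝ, 0 < C ∧ ∀ ε : ℝ, 0 < ε → ∃ A : ℝ, 0 < A ∧
      ∀ (t E : ℝ) (H : ℝ≥0∞) (f : ℝ → R3 → R3 → ℝ), IsControlled Ω β t E H f →
      0 ≤ t → 0 ≤ E → ∀ x : R3,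
      collisionIntegral γ b β f t x ≤ ENNReal.ofReal C * H ∧
      ∀ lam : ℝ, 0 < lam → lam ≤ 1 →
      collisionIntegral γ b β f t x ≤ ENNReal.ofReal (ε + C * lam) * H
        + ENNReal.ofReal (A * (lam ^ (-(3 / 2) : ℝ) * √E + lam ^ (-3 : ℝ) * E)) := by
  have hβ0 : 0 ≤ β := by linarith
  -- If the angular mass vanishes there is no positive lower bound for `ν`, but there are no
  -- collisions either.
  rcases eq_or_ne (angularMass b) 0 with h0 | h0
  · have hzero : ∀ f t x, collisionIntegral γ b β f t x = 0 := fun f t x => by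
      simp [collisionIntegral, collisionAverage_eq_zero hb h0]
    exact ⟨1, one_pos, fun ε _ => ⟨1, one_pos, fun t E H f _ _ _ x => by simp [hzero]⟩⟩
  set κ : ℝ := (angularMass b).toReal with hκ
  have hκ0 : 0 < κ := ENNReal.toReal_pos h0 (angularMass_lt_top hb).ne
  obtain ⟨c, hc, hnu⟩ := le_nu hγ hb
  obtain ⟨C, hC, hM⟩ := lintegral_fst_collisionPairs_le hγ hb hβ0
  set q : R3 → ℝ := fun v => c * κ * (1 + ‖v‖) ^ γ with hq
  have hq0 : ∀ v, 0 < q v := fun v => by positivity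
  have hqm : Measurable q := by fun_prop
  set M := collisionPairs γ b β q with hMdef
  have hM1 : M univ < ∞ := by
    have h1 := hM q (fun _ => 1) hqm measurable_const hq0 (fun _ => zero_le_one)
    have h2 : ∀ v : R3, 1 * (q v)⁻¹ * (decay β v * (κ * (C * (1 + ‖v‖) ^ γ)))
        = C / c * (decay β v * (1 + ‖v‖) ^ (0 : ℝ)) := fun v => by
      have : 0 < (1 + ‖v‖) ^ γ := by positivity
      simp only [hq, Real.rpow_zero]
      field_simp
    simp only [ENNReal.ofReal_one, lintegral_one] at h1
    refine h1.trans_lt (ENNReal.mul_lt_top (by norm_num) ?_)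
    refine lt_of_eq_of_lt (lintegral_congr fun v => (congrArg ENNReal.ofReal (h2 v)).trans
      (ENNReal.ofReal_mul (div_pos hC hc).le)) ?_
    rw [lintegral_const_mul' _ _ ENNReal.ofReal_ne_top]
    exact ENNReal.mul_lt_top ENNReal.ofReal_lt_top
      (lintegral_decay_mul_lt_top hβ0 (by linarith))
  have hMq : ∫⁻ z, ENNReal.ofReal (q z.1) ∂M < ∞ := by
    refine (hM q q hqm hqm hq0 fun v => (hq0 v).le).trans_lt (ENNReal.mul_lt_top (by norm_num) ?_)
    have h2 : ∀ v : R3, q v * (q v)⁻¹ * (decay β v * (κ * (C * (1 + ‖v‖) ^ γ)))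
        = κ * C * (decay β v * (1 + ‖v‖) ^ γ) := fun v => by
      rw [mul_inv_cancel₀ (hq0 v).ne']; ring
    refine lt_of_eq_of_lt (lintegral_congr fun v => (congrArg ENNReal.ofReal (h2 v)).trans
      (ENNReal.ofReal_mul (mul_pos hκ0 hC).le)) ?_
    rw [lintegral_const_mul' _ _ ENNReal.ofReal_ne_top]
    exact ENNReal.mul_lt_top ENNReal.ofReal_lt_top (lintegral_decay_mul_lt_top hβ0 hβγ)
  have : IsFiniteMeasure M := ⟨hM1⟩
  have hMac : M ≪ volume := collisionPairs_absolutelyContinuous γ b β q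
  have hqloc : ∀ A : ℝ, ∃ a B : ℝ, 0 < a ∧ 0 < B ∧ ∀ v ∈ Metric.ball (0 : R3) A,
      a ≤ q v ∧ q v ≤ B := fun A => by
    refine ⟨c * κ * (1 + |A|) ^ (-|γ|), c * κ * (1 + |A|) ^ |γ|, by positivity, by positivity,
      fun v hv => ?_⟩
    have hvA : ‖v‖ ≤ |A| := (mem_ball_zero_iff.1 hv).le.trans (le_abs_self A)
    have h1 : 1 ≤ 1 + ‖v‖ := by linarith [norm_nonneg v]
    constructor
    · refine mul_le_mul_of_nonneg_left ?_ (by positivity)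
      calc (1 + |A|) ^ (-|γ|) ≤ (1 + ‖v‖) ^ (-|γ|) :=
            Real.rpow_le_rpow_of_nonpos (by positivity) (by linarith) (by simp)
        _ ≤ (1 + ‖v‖) ^ γ := Real.rpow_le_rpow_of_exponent_le h1 (neg_abs_le γ)
    · refine mul_le_mul_of_nonneg_left ?_ (by positivity)
      calc (1 + ‖v‖) ^ γ ≤ (1 + ‖v‖) ^ |γ| := Real.rpow_le_rpow_of_exponent_le h1 (le_abs_self γ)
        _ ≤ (1 + |A|) ^ |γ| := by gcongr
  refine ⟨(M univ).toReal + (∫⁻ z, ENNReal.ofReal (q z.1) ∂M).toReal + 1, by positivity,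
    fun ε hε => ?_⟩
  obtain ⟨A, hA, hmain⟩ := transportAverage_le_relEntropy Ω hβ0 hqm (fun v => (hq0 v).le) hqloc
    hMac hε
  refine ⟨A, hA, fun t E H f hf ht hE x => ?_⟩
  have hle := collisionIntegral_le_transportAverage hb.1 β hqm hq0 hnu hf.measurable t x
  constructor
  · refine hle.trans ((transportAverage_le hf hqm (fun v => (hq0 v).le) hMac ht x).trans ?_)
    gcongr
    rw [← ENNReal.ofReal_toReal hM1.ne]
    refine ENNReal.ofReal_le_ofReal ?_
    rw [ENNReal.toReal_ofReal ENNReal.toReal_nonneg]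
    linarith [ENNReal.toReal_nonneg (a := ∫⁻ z, ENNReal.ofReal (q z.1) ∂M)]
  · intro lam h1 h2
    refine hle.trans ((hmain t E H f hf ht hE x lam h1 h2).trans ?_)
    refine add_le_add (mul_le_mul' ?_ le_rfl) le_rfl
    rw [ENNReal.ofReal_add hε.le (by positivity), mul_comm _ lam, ENNReal.ofReal_mul h1.le]
    gcongr
    rw [← ENNReal.ofReal_toReal hMq.ne]
    refine ENNReal.ofReal_le_ofReal ?_
    rw [ENNReal.toReal_ofReal ENNReal.toReal_nonneg]
    linarith [ENNReal.toReal_nonneg (a := M univ)]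

/-! ### From the mild formulation to collision averages -/

theorem ae_transport_of_ae {P : R3 → R3 → Prop} (hP : MeasurableSet {z : R3 × R3 | P z.1 z.2})
    (h : ∀ᵐ z : R3 × R3, P z.1 z.2) (τ : ℝ) : ∀ᵐ x : R3, ∀ᵐ v : R3, P (x - τ • v) v := by
  rw [volume_eq_prod, ae_prod_iff_ae_ae hP] at h
  have hm : Measurable fun z : R3 × R3 => (z.1 - τ • z.2, z.2) := by fun_prop
  rw [ae_ae_comm (p := fun (x v : R3) => P (x - τ • v) v) (hm hP)]
  filter_upwards [(ae_ae_comm (p := P) hP).1 h] with v hv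
  exact (measurePreserving_sub_right volume (τ • v)).quasiMeasurePreserving.ae hv

/-- Here the position and the evaluated velocity are tied by the same `v`, so for fixed `x` and `s`
only a three-dimensional slice of phase space is seen. A null set can contain such a slice; hence
the restriction to almost every `x`, obtained by translating in `x` for fixed `v`. -/
theorem IsControlled.ae_bounded_characteristic {Ω : SpatialDomain} {β t E : ℝ} {H : ℝ≥0∞}
    {f : ℝ → R3 → R3 → ℝ} (hf : IsControlled Ω β t E H f) :
    ∀ᵐ x : R3, ∀ᵐ v : R3, ∀ᵐ s ∂(volume.restrict (Ioc 0 t) : Measure ℝ),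
      ENNReal.ofReal (weight β v) * ‖f s (x - (t - s) • v) v‖ₑ ≤ H := by
  have hw := (continuous_weight β).measurable
  have hbase : Measurable fun z : ℝ × R3 × R3 =>
      ENNReal.ofReal (weight β z.2.2) * ‖f z.1 z.2.1 z.2.2‖ₑ :=
    (hw.comp (measurable_snd.comp measurable_snd)).ennreal_ofReal.mul hf.measurable.enorm
  have hP : MeasurableSet {z : (ℝ × R3) × R3 |
      ENNReal.ofReal (weight β z.2) * ‖f z.1.1 (z.1.2 - (t - z.1.1) • z.2) z.2‖ₑ ≤ H} := by
    have h : Measurable fun z : (ℝ × R3) × R3 => (z.1.1, z.1.2 - (t - z.1.1) • z.2, z.2) := by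
      fun_prop
    exact (hbase.comp h) measurableSet_Iic
  have h1 : ∀ᵐ s ∂(volume.restrict (Ioc 0 t) : Measure ℝ), ∀ᵐ x : R3, ∀ᵐ v : R3,
      ENNReal.ofReal (weight β v) * ‖f s (x - (t - s) • v) v‖ₑ ≤ H := by
    filter_upwards [ae_Ioc_mem_Ico t] with s hs
    refine ae_transport_of_ae (P := fun y v => ENNReal.ofReal (weight β v) * ‖f s y v‖ₑ ≤ H) ?_
      (hf.bounded s hs) (t - s)
    exact (hbase.comp (measurable_prodMk_left (x := s))) measurableSet_Iic
  have hS : MeasurableSet {z : ℝ × R3 | ∀ᵐ v : R3,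
      ENNReal.ofReal (weight β v) * ‖f z.1 (z.2 - (t - z.1) • v) v‖ₑ ≤ H} :=
    measurableSet_eq_fun (measurable_measure_prodMk_left hP.compl) measurable_const
  have h2 := (ae_ae_comm (p := fun (s : ℝ) (x : R3) => ∀ᵐ v : R3,
      ENNReal.ofReal (weight β v) * ‖f s (x - (t - s) • v) v‖ₑ ≤ H) hS).1 h1
  filter_upwards [h2] with x hx
  have hT : MeasurableSet {z : ℝ × R3 |
      ENNReal.ofReal (weight β z.2) * ‖f z.1 (x - (t - z.1) • z.2) z.2‖ₑ ≤ H} := by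
    have h : Measurable fun z : ℝ × R3 => (z.1, x - (t - z.1) • z.2, z.2) := by fun_prop
    exact (hbase.comp h) measurableSet_Iic
  exact (ae_ae_comm (p := fun (s : ℝ) (v : R3) =>
      ENNReal.ofReal (weight β v) * ‖f s (x - (t - s) • v) v‖ₑ ≤ H) hT).1 hx

/-- The sampled velocity `w` is independent of `v`, so for `s < t` the point `(x - (t-s)v, w)`
ranges over full phase space and every `x` is allowed. -/
theorem IsControlled.ae_bounded_section {Ω : SpatialDomain} {β t E : ℝ} {H : ℝ≥0∞}
    {f : ℝ → R3 → R3 → ℝ} (hf : IsControlled Ω β t E H f) (x : R3) :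
    ∀ᵐ v : R3, ∀ᵐ s ∂(volume.restrict (Ioc 0 t) : Measure ℝ), ∀ᵐ w : R3,
      ENNReal.ofReal (weight β w) * ‖f s (x - (t - s) • v) w‖ₑ ≤ H := by
  have hw := (continuous_weight β).measurable
  have hbase : Measurable fun z : ℝ × R3 × R3 =>
      ENNReal.ofReal (weight β z.2.2) * ‖f z.1 z.2.1 z.2.2‖ₑ :=
    (hw.comp (measurable_snd.comp measurable_snd)).ennreal_ofReal.mul hf.measurable.enorm
  have h1 : ∀ᵐ s ∂(volume.restrict (Ioc 0 t) : Measure ℝ), ∀ᵐ v : R3, ∀ᵐ w : R3,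
      ENNReal.ofReal (weight β w) * ‖f s (x - (t - s) • v) w‖ₑ ≤ H := by
    filter_upwards [ae_Ioc_mem_Ico t] with s hs
    have := hf.ae_bounded AbsolutelyContinuous.rfl x hs
    rw [volume_eq_prod] at this
    exact ae_ae_of_ae_prod this
  have hP : MeasurableSet {z : (ℝ × R3) × R3 |
      ENNReal.ofReal (weight β z.2) * ‖f z.1.1 (x - (t - z.1.1) • z.1.2) z.2‖ₑ ≤ H} := by
    have h : Measurable fun z : (ℝ × R3) × R3 => (z.1.1, x - (t - z.1.1) • z.1.2, z.2) := by
      fun_prop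
    exact (hbase.comp h) measurableSet_Iic
  have hS : MeasurableSet {z : ℝ × R3 | ∀ᵐ w : R3,
      ENNReal.ofReal (weight β w) * ‖f z.1 (x - (t - z.1) • z.2) w‖ₑ ≤ H} :=
    measurableSet_eq_fun (measurable_measure_prodMk_left hP.compl) measurable_const
  exact (ae_ae_comm (p := fun (s : ℝ) (v : R3) => ∀ᵐ w : R3,
      ENNReal.ofReal (weight β w) * ‖f s (x - (t - s) • v) w‖ₑ ≤ H) hS).1 h1

theorem lintegral_enorm_le_of_mild {Ω : SpatialDomain} {γ : ℝ} {b : ℝ → ℝ} (hb : IsCutoff b)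
    {β C : ℝ} (hC : 0 ≤ C) (hμ : ∀ v : R3, √(maxwellian v) ≤ C * decay β v) {T : ℝ}
    {f : ℝ → R3 → R3 → ℝ} (hsol : IsMildSolution Ω γ b β T f) {t : ℝ} (ht : t ∈ Icc 0 T)
    {E : ℝ} {H : ℝ≥0∞} (hH : H ≠ ∞) (hf : IsControlled Ω β t E H f) :
    ∀ᵐ x : R3, ∫⁻ v, ‖f t x v‖ₑ
      ≤ (∫⁻ v, ENNReal.ofReal (Real.exp (-nu γ b v * t)) * ‖f 0 (x - t • v) v‖ₑ)
        + (ENNReal.ofReal C + H) * collisionIntegral γ b β f t x := by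
  have hmild := hsol.mild t ht
  rw [volume_eq_prod] at hmild
  filter_upwards [ae_ae_of_ae_prod hmild, hf.ae_bounded_characteristic] with x hx hchar
  let I : R3 → ℝ≥0∞ := fun v => ∫⁻ s in Ioc 0 t, ENNReal.ofReal (Real.exp (-nu γ b v * (t - s)))
    * collisionAverage γ b β v (f s (x - (t - s) • v))
  have hc : ENNReal.ofReal C + H ≠ ∞ := ENNReal.add_ne_top.2 ⟨ENNReal.ofReal_ne_top, hH⟩
  have hpt : ∀ᵐ v : R3, ‖f t x v‖ₑ
      ≤ ENNReal.ofReal (Real.exp (-nu γ b v * t)) * ‖f 0 (x - t • v) v‖ₑ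
        + (ENNReal.ofReal C + H) * I v := by
    filter_upwards [hx, hchar, hf.ae_bounded_section x] with v hv h1 h2
    have hv' : f t x v = Real.exp (-nu γ b v * t) * f 0 (x - t • v) v
      + (∫ s in (0 : ℝ)..t,
          Real.exp (-nu γ b v * (t - s)) * K γ b (f s (x - (t - s) • v)) v)
      + ∫ s in (0 : ℝ)..t,
          Real.exp (-nu γ b v * (t - s)) * Gam γ b (f s (x - (t - s) • v)) v := hv
    have hK : ‖∫ s in (0 : ℝ)..t, Real.exp (-nu γ b v * (t - s))
        * K γ b (f s (x - (t - s) • v)) v‖ₑ ≤ ENNReal.ofReal C * I v := by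
      rw [intervalIntegral.integral_of_le ht.1, ← lintegral_const_mul' _ _ ENNReal.ofReal_ne_top]
      refine (enorm_integral_le_lintegral_enorm _).trans (lintegral_mono fun s => ?_)
      rw [enorm_mul, Real.enorm_of_nonneg (Real.exp_pos _).le, mul_left_comm]
      exact mul_le_mul' le_rfl (enorm_K_le hb hC hμ _ _)
    have hG : ‖∫ s in (0 : ℝ)..t, Real.exp (-nu γ b v * (t - s))
        * Gam γ b (f s (x - (t - s) • v)) v‖ₑ ≤ H * I v := by
      rw [intervalIntegral.integral_of_le ht.1, ← lintegral_const_mul' _ _ hH]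
      refine (enorm_integral_le_lintegral_enorm _).trans (lintegral_mono_ae ?_)
      filter_upwards [h1, h2] with s hs1 hs2
      rw [enorm_mul, Real.enorm_of_nonneg (Real.exp_pos _).le, mul_left_comm]
      exact mul_le_mul' le_rfl (enorm_Gam_le hb hH hs1 hs2)
    rw [hv', add_mul, ← add_assoc]
    refine (enorm_add_le _ _).trans (add_le_add ((enorm_add_le _ _).trans (add_le_add ?_ hK)) hG)
    rw [enorm_mul, Real.enorm_of_nonneg (Real.exp_pos _).le]
  have hm : Measurable fun v : R3 =>
      ENNReal.ofReal (Real.exp (-nu γ b v * t)) * ‖f 0 (x - t • v) v‖ₑ := by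
    have h : Measurable fun v : R3 => ((0 : ℝ), x - t • v, v) := by fun_prop
    have h' : Measurable fun v : R3 => f 0 (x - t • v) v := hsol.measurable.comp h
    have hn := measurable_nu γ hb.1
    exact (hn.neg.mul_const t).exp.ennreal_ofReal.mul h'.enorm
  calc ∫⁻ v, ‖f t x v‖ₑ ≤ ∫⁻ v, (ENNReal.ofReal (Real.exp (-nu γ b v * t)) * ‖f 0 (x - t • v) v‖ₑ
        + (ENNReal.ofReal C + H) * I v) := lintegral_mono_ae hpt
    _ = _ := by rw [lintegral_add_left hm, lintegral_const_mul' _ _ hc]; rfl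

/-- Since mass and energy are conserved and the entropy does not exceed its initial value, the
relative entropy stays below its initial value. -/
theorem isControlled_of_isMildSolution {Ω : SpatialDomain} {γ : ℝ} {b : ℝ → ℝ} {β T : ℝ}
    {f : ℝ → R3 → R3 → ℝ} (hsol : IsMildSolution Ω γ b β T f)
    (hcons : ConservesDefects Ω T fun t => density (f t)) {t : ℝ} (ht : t ∈ Icc 0 T) :
    IsControlled Ω β t (relEntropy Ω (density (f 0))) (⨆ s ∈ Icc 0 t, weightedNorm β (f s)) f := by
  have hsub : ∀ s ∈ Ico 0 t, s ∈ Icc 0 T := fun s hs => ⟨hs.1, hs.2.le.trans ht.2⟩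
  refine ⟨hsol.measurable, fun s hs => hsol.isFunctionOn s (hsub s hs),
    fun s hs => hsol.nonneg s (hsub s hs), fun s hs => hcons.finite s (hsub s hs),
    fun s hs => ?_, fun s hs => ?_⟩
  · have h1 := hcons.mass s (hsub s hs)
    have h2 := hcons.energy s (hsub s hs)
    have h3 := hcons.entropy s (hsub s hs)
    rw [relEntropy, relEntropy, h1, h2]
    linarith
  · have h1 : weightedNorm β (f s) ≤ ⨆ s ∈ Icc 0 t, weightedNorm β (f s) :=
      le_iSup₂ (f := fun s (_ : s ∈ Icc 0 t) => weightedNorm β (f s)) s ⟨hs.1, hs.2.le⟩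
    have h2 := ae_le_eLpNormEssSup (f := fun z : R3 × R3 => weight β z.2 * f s z.1 z.2)
      (μ := volume)
    filter_upwards [h2] with z hz
    rw [enorm_mul, Real.enorm_of_nonneg (weight_pos β _).le] at hz
    refine hz.trans (le_trans (le_of_eq ?_) h1)
    rw [weightedNorm, eLpNorm_exponent_top]

/-! ### Combination of the estimates -/

theorem one_lt_pExp {γ : ℝ} (hγ : -3 < γ) (hγ' : γ ≤ 1) : 1 < pExp γ := by
  have : 0 < (3 + γ) / (4 * (9 - γ)) := div_pos (by linarith) (by linarith)
  unfold pExp; linarith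

theorem min_le_rpow_mul_rpow (a b : ℝ≥0∞) {θ : ℝ} (h0 : 0 ≤ θ) (h1 : θ ≤ 1) :
    min a b ≤ a ^ θ * b ^ (1 - θ) := by
  calc min a b = min a b ^ (θ + (1 - θ)) := by simp
    _ = min a b ^ θ * min a b ^ (1 - θ) :=
        ENNReal.rpow_add_of_nonneg _ _ h0 (by linarith)
    _ ≤ a ^ θ * b ^ (1 - θ) := by
        gcongr
        · exact min_le_left _ _
        · exact min_le_right _ _

theorem rpow_le_add_one {a θ : ℝ} (ha : 0 ≤ a) (h0 : 0 ≤ θ) (h1 : θ ≤ 1) : a ^ θ ≤ a + 1 := by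
  calc a ^ θ ≤ (a + 1) ^ θ := by gcongr; linarith
    _ ≤ (a + 1) ^ (1 : ℝ) := Real.rpow_le_rpow_of_exponent_le (by linarith) h1
    _ = a + 1 := Real.rpow_one _

/-- Interpolation between the trivial bound and the entropy bound for a quadratic term. -/
theorem mul_min_le_interpolation {C A lam E θ : ℝ} (hC : 0 < C) (hA : 0 < A) (hl : 0 < lam)
    (hl1 : lam ≤ 1) (hE : 0 ≤ E) (h0 : 0 ≤ θ) (h1 : θ ≤ 1) (H : ℝ≥0∞) :
    H * min (ENNReal.ofReal C * H)
        (ENNReal.ofReal (A * (lam ^ (-(3 / 2) : ℝ) * √E + lam ^ (-3 : ℝ) * E)))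
      ≤ ENNReal.ofReal ((C + 1) * (A + 1) * lam ^ (-3 : ℝ) * (√E + E) ^ (1 - θ))
        * H ^ (1 + θ) := by
  have hθ : 0 ≤ 1 - θ := by linarith
  have hθ1 : 1 - θ ≤ 1 := by linarith
  set X := √E + E with hX
  have hX0 : 0 ≤ X := by positivity
  have hlam : 1 ≤ lam ^ (-3 : ℝ) :=
    Real.one_le_rpow_of_pos_of_le_one_of_nonpos hl hl1 (by norm_num)
  have hR : A * (lam ^ (-(3 / 2) : ℝ) * √E + lam ^ (-3 : ℝ) * E) ≤ A * (lam ^ (-3 : ℝ) * X) := by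
    rw [hX, mul_add (lam ^ (-3 : ℝ))]
    have : lam ^ (-(3 / 2) : ℝ) ≤ lam ^ (-3 : ℝ) :=
      Real.rpow_le_rpow_of_exponent_ge hl hl1 (by norm_num)
    gcongr
  have hpow : (A * (lam ^ (-3 : ℝ) * X)) ^ (1 - θ)
      ≤ (A + 1) * (lam ^ (-3 : ℝ) * X ^ (1 - θ)) := by
    rw [Real.mul_rpow hA.le (by positivity), Real.mul_rpow (by positivity) hX0]
    gcongr
    · exact rpow_le_add_one hA.le hθ hθ1
    · calc (lam ^ (-3 : ℝ)) ^ (1 - θ) ≤ (lam ^ (-3 : ℝ)) ^ (1 : ℝ) :=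
            Real.rpow_le_rpow_of_exponent_le hlam hθ1
        _ = _ := Real.rpow_one _
  calc _ ≤ H * ((ENNReal.ofReal C * H) ^ θ
        * (ENNReal.ofReal (A * (lam ^ (-3 : ℝ) * X))) ^ (1 - θ)) := by
        gcongr
        refine (min_le_rpow_mul_rpow _ _ h0 h1).trans ?_
        gcongr
    _ = H * (ENNReal.ofReal (C ^ θ) * H ^ θ
        * ENNReal.ofReal ((A * (lam ^ (-3 : ℝ) * X)) ^ (1 - θ))) := by
        rw [ENNReal.mul_rpow_of_nonneg _ _ h0, ENNReal.ofReal_rpow_of_nonneg hC.le h0,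
          ENNReal.ofReal_rpow_of_nonneg (by positivity) hθ]
    _ ≤ H * (ENNReal.ofReal (C + 1) * H ^ θ
        * ENNReal.ofReal ((A + 1) * (lam ^ (-3 : ℝ) * X ^ (1 - θ)))) := by
        gcongr
        exact rpow_le_add_one hC.le h0 h1
    _ = ENNReal.ofReal ((C + 1) * (A + 1) * lam ^ (-3 : ℝ) * X ^ (1 - θ))
        * (H ^ (1 : ℝ) * H ^ θ) := by
        rw [show (C + 1) * (A + 1) * lam ^ (-3 : ℝ) * X ^ (1 - θ)
          = (C + 1) * ((A + 1) * (lam ^ (-3 : ℝ) * X ^ (1 - θ))) by ring,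
          ENNReal.ofReal_mul (p := C + 1) (by positivity), ENNReal.rpow_one]
        ring
    _ = _ := by rw [← ENNReal.rpow_add_of_nonneg _ _ zero_le_one h0]

/-- A monotone continuous function vanishing at `0` commutes with suprema, including empty ones. -/
theorem iSup_add_sq_le {ι : Type*} (p : ι → Prop) (a : ι → ℝ≥0∞) :
    (⨆ s, ⨆ _ : p s, a s) + (⨆ s, ⨆ _ : p s, a s) ^ 2 ≤ ⨆ s, ⨆ _ : p s, (a s + a s ^ 2) := by
  have hmono : Monotone fun x : ℝ≥0∞ => x + x ^ 2 := fun x y h => by dsimp only; gcongr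
  have hcont : Continuous fun x : ℝ≥0∞ => x + x ^ 2 :=
    continuous_id.add (ENNReal.continuous_pow 2)
  have h1 := hmono.map_iSup_of_continuousAt (g := fun s => ⨆ _ : p s, a s)
    hcont.continuousAt (by simp)
  refine h1.le.trans (iSup_mono fun s => ?_)
  exact (hmono.map_iSup_of_continuousAt (g := fun _ : p s => a s) hcont.continuousAt (by simp)).le

theorem iSup_rpow_le {ι : Type*} (p : ι → Prop) (a : ι → ℝ≥0∞) {r : ℝ} (hr : 0 < r) :
    (⨆ s, ⨆ _ : p s, a s) ^ r ≤ ⨆ s, ⨆ _ : p s, a s ^ r := by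
  have hmono : Monotone fun x : ℝ≥0∞ => x ^ r := fun x y h => by dsimp only; gcongr
  have hcont : Continuous fun x : ℝ≥0∞ => x ^ r := ENNReal.continuous_rpow_const
  have h1 := hmono.map_iSup_of_continuousAt (g := fun s => ⨆ _ : p s, a s)
    hcont.continuousAt (by simp [hr])
  refine h1.le.trans (iSup_mono fun s => ?_)
  exact (hmono.map_iSup_of_continuousAt (g := fun _ : p s => a s) hcont.continuousAt
    (by simp [hr])).le

/-- Combination of the trivial bound and the entropy bound for a sum of a linear and a quadratic
term. -/
theorem add_mul_le_of_bounds {C C₁ A lam N E θ : ℝ} (hC : 0 < C) (hC₁ : 0 < C₁) (hA : 0 < A)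
    (hl : 0 < lam) (hN : 1 ≤ N) (hE : 0 ≤ E) (h0 : 0 ≤ θ) (h1 : θ ≤ 1) {S H : ℝ≥0∞}
    (hS : S ≤ ENNReal.ofReal C * H)
    (hS' : lam ≤ 1 → S ≤ ENNReal.ofReal (1 / N + C * lam) * H
        + ENNReal.ofReal (A * (lam ^ (-(3 / 2) : ℝ) * √E + lam ^ (-3 : ℝ) * E)))
    {r : ℝ} (hr : lam + 1 / N ≤ r) :
    (ENNReal.ofReal C₁ + H) * S
      ≤ ENNReal.ofReal ((C₁ * A + (C + 1) * (A + 1)) * lam ^ (-(3 / 2) : ℝ) * √E)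
        + ENNReal.ofReal ((C₁ * A + (C + 1) * (A + 1)) * lam ^ (-3 : ℝ) * E)
        + ENNReal.ofReal ((C₁ + 1) * (C + 1) * r) * (H + H ^ 2)
        + ENNReal.ofReal ((C₁ * A + (C + 1) * (A + 1)) * lam ^ (-3 : ℝ)
          * (√E + E) ^ (1 - θ)) * H ^ (1 + θ) := by
  have hN0 : 0 ≤ 1 / N := by positivity
  have hHH : (ENNReal.ofReal C₁ + H) * H ≤ ENNReal.ofReal (C₁ + 1) * (H + H ^ 2) := by
    rw [ENNReal.ofReal_add hC₁.le zero_le_one, ENNReal.ofReal_one]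
    calc (ENNReal.ofReal C₁ + H) * H = ENNReal.ofReal C₁ * H + 1 * H ^ 2 := by ring
      _ ≤ ENNReal.ofReal C₁ * (H + H ^ 2) + 1 * (H + H ^ 2) := by
          gcongr
          · exact le_self_add
          · exact le_add_self
      _ = _ := by ring
  have hquad : ∀ a : ℝ, 0 ≤ a → a ≤ (C + 1) * r → (ENNReal.ofReal C₁ + H) * (ENNReal.ofReal a * H)
      ≤ ENNReal.ofReal ((C₁ + 1) * (C + 1) * r) * (H + H ^ 2) := fun a ha har => by
    calc _ = ENNReal.ofReal a * ((ENNReal.ofReal C₁ + H) * H) := by ring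
      _ ≤ ENNReal.ofReal ((C + 1) * r) * (ENNReal.ofReal (C₁ + 1) * (H + H ^ 2)) := by gcongr
      _ = _ := by
          rw [← mul_assoc, ← ENNReal.ofReal_mul (ha.trans har)]
          congr 2; ring
  -- For `λ > 1` the coefficient `r ≥ λ` exceeds `1`, and the trivial bound for `S` already
  -- suffices.
  rcases le_or_gt lam 1 with hl1 | hl1
  · set R := lam ^ (-(3 / 2) : ℝ) * √E + lam ^ (-3 : ℝ) * E with hR
    set X := ENNReal.ofReal C * H
    -- Keeping the minimum serves both parts: the constant factor `C₁` uses the entropy bound, while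
    -- the factor `H` uses the interpolation.
    have hmin : S ≤ ENNReal.ofReal (1 / N + C * lam) * H + min X (ENNReal.ofReal (A * R)) := by
      rcases le_total X (ENNReal.ofReal (A * R)) with h | h
      · rw [min_eq_left h]; exact hS.trans le_add_self
      · rw [min_eq_right h]; exact hS' hl1
    have hlin : ENNReal.ofReal C₁ * min X (ENNReal.ofReal (A * R))
        ≤ ENNReal.ofReal ((C₁ * A + (C + 1) * (A + 1)) * lam ^ (-(3 / 2) : ℝ) * √E)
          + ENNReal.ofReal ((C₁ * A + (C + 1) * (A + 1)) * lam ^ (-3 : ℝ) * E) := by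
      refine (mul_le_mul' le_rfl (min_le_right _ _)).trans ?_
      rw [← ENNReal.ofReal_mul hC₁.le, ← ENNReal.ofReal_add (by positivity) (by positivity)]
      refine ENNReal.ofReal_le_ofReal ?_
      have hR0 : 0 ≤ R := by positivity
      have : 0 ≤ (C + 1) * (A + 1) * R := by positivity
      calc C₁ * (A * R) ≤ C₁ * (A * R) + (C + 1) * (A + 1) * R := by linarith
        _ = _ := by rw [hR]; ring
    have hint : H * min X (ENNReal.ofReal (A * R))
        ≤ ENNReal.ofReal ((C₁ * A + (C + 1) * (A + 1)) * lam ^ (-3 : ℝ)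
          * (√E + E) ^ (1 - θ)) * H ^ (1 + θ) := by
      refine (mul_min_le_interpolation hC hA hl hl1 hE h0 h1 H).trans ?_
      gcongr
      have := mul_pos hC₁ hA
      linarith
    calc (ENNReal.ofReal C₁ + H) * S
        ≤ (ENNReal.ofReal C₁ + H) * (ENNReal.ofReal (1 / N + C * lam) * H
          + min X (ENNReal.ofReal (A * R))) := by gcongr
      _ = ENNReal.ofReal C₁ * min X (ENNReal.ofReal (A * R))
          + (ENNReal.ofReal C₁ + H) * (ENNReal.ofReal (1 / N + C * lam) * H)
          + H * min X (ENNReal.ofReal (A * R)) := by ring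
      _ ≤ _ := by
          refine add_le_add (add_le_add hlin (hquad _ (by positivity) ?_)) hint
          nlinarith
  · calc (ENNReal.ofReal C₁ + H) * S ≤ (ENNReal.ofReal C₁ + H) * (ENNReal.ofReal C * H) := by gcongr
      _ ≤ ENNReal.ofReal ((C₁ + 1) * (C + 1) * r) * (H + H ^ 2) := hquad C hC.le (by nlinarith)
      _ ≤ _ := le_add_right le_add_self

end Boltzmann

/-! ### The final estimate -/

theorem lemma3p3 (Ω : Boltzmann.SpatialDomain) (γ β : ℝ) (hγ : -3 < γ) (hγ' : γ ≤ 1)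
    (hβ : max 3 (3 + γ) < β) (b : ℝ → ℝ) (hb : Boltzmann.IsCutoff b) :
    ∃ (C : ℝ) (Cm CN : ℝ → ℝ), 0 < C ∧ (∀ m, 0 < m → 0 < Cm m) ∧ (∀ N, 1 ≤ N → 0 < CN N) ∧
      ∀ (T : ℝ) (f : ℝ → Boltzmann.R3 → Boltzmann.R3 → ℝ),
        Boltzmann.IsMildSolution Ω γ b β T f →
        Boltzmann.ConservesDefects Ω T (fun t => Boltzmann.density (f t)) →
        ∀ t ∈ Set.Icc 0 T, ∀ᵐ x : Boltzmann.R3, ∀ lam m N : ℝ, 0 < lam → 0 < m → 1 ≤ N →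
          ∫⁻ v, ‖f t x v‖ₑ ≤
            (∫⁻ v, ENNReal.ofReal (Real.exp (-Boltzmann.nu γ b v * t)) * ‖f 0 (x - t • v) v‖ₑ)
            + ENNReal.ofReal (CN N * lam ^ (-(3 / 2) : ℝ)
                * √(Boltzmann.relEntropy Ω (Boltzmann.density (f 0))))
            + ENNReal.ofReal (CN N * lam ^ (-3 : ℝ)
                * Boltzmann.relEntropy Ω (Boltzmann.density (f 0)))
            + ENNReal.ofReal (C * (m ^ (3 + γ) + Cm m * (lam + 1 / N + 1 / N ^ (β - 3))))
                * (⨆ s ∈ Set.Icc 0 t,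
                    (Boltzmann.weightedNorm β (f s) + Boltzmann.weightedNorm β (f s) ^ 2))
            + ENNReal.ofReal (CN N * lam ^ (-3 : ℝ)
                * (√(Boltzmann.relEntropy Ω (Boltzmann.density (f 0)))
                    + Boltzmann.relEntropy Ω (Boltzmann.density (f 0)))
                  ^ (1 - 1 / Boltzmann.pExp γ))
                * (⨆ s ∈ Set.Icc 0 t,
                    Boltzmann.weightedNorm β (f s) ^ (1 + 1 / Boltzmann.pExp γ)) := by
  have hβ3 : 3 < β := (le_max_left _ _).trans_lt hβ
  have hβγ : 3 < β - γ := by have := (le_max_right 3 (3 + γ)).trans_lt hβ; linarith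
  obtain ⟨C₁, hC₁, hμ⟩ := Boltzmann.sqrt_maxwellian_le_decay (by linarith : 0 ≤ β)
  obtain ⟨C, hC, hA⟩ := Boltzmann.collisionIntegral_le (Ω := Ω) hγ hβ3 hβγ hb
  -- The small parameter is `ε = 1/N`. Stating this for all real `N`, with value `0` below `1`,
  -- allows a choice of the constant as a function of `N` alone.
  have hA' : ∀ N : ℝ, ∃ A : ℝ, 1 ≤ N → 0 < A ∧
      ∀ (t E : ℝ) (H : ℝ≥0∞) (f : ℝ → Boltzmann.R3 → Boltzmann.R3 → ℝ),
      Boltzmann.IsControlled Ω β t E H f → 0 ≤ t → 0 ≤ E → ∀ x : Boltzmann.R3,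
      Boltzmann.collisionIntegral γ b β f t x ≤ ENNReal.ofReal C * H ∧
      ∀ lam : ℝ, 0 < lam → lam ≤ 1 →
      Boltzmann.collisionIntegral γ b β f t x ≤ ENNReal.ofReal (1 / N + C * lam) * H
        + ENNReal.ofReal (A * (lam ^ (-(3 / 2) : ℝ) * √E + lam ^ (-3 : ℝ) * E)) := fun N => by
    by_cases hN : 1 ≤ N
    · obtain ⟨A, hA0, hA1⟩ := hA (1 / N) (by positivity)
      exact ⟨A, fun _ => ⟨hA0, hA1⟩⟩
    · exact ⟨0, fun h => absurd h hN⟩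
  choose A hA using hA'
  refine ⟨(C₁ + 1) * (C + 1), fun _ => 1, fun N => C₁ * A N + (C + 1) * (A N + 1), by positivity,
    fun _ _ => one_pos, fun N hN => ?_, ?_⟩
  · have := (hA N hN).1
    positivity
  intro T f hsol hcons t ht
  have hf := Boltzmann.isControlled_of_isMildSolution hsol hcons ht
  have h0T : (0 : ℝ) ∈ Set.Icc 0 T := ⟨le_rfl, ht.1.trans ht.2⟩
  have hE : 0 ≤ Boltzmann.relEntropy Ω (Boltzmann.density (f 0)) :=
    Boltzmann.relEntropy_nonneg (hcons.finite 0 h0T) (hsol.nonneg 0 h0T)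
  have hH : (⨆ s ∈ Set.Icc 0 t, Boltzmann.weightedNorm β (f s)) ≠ ∞ :=
    ne_top_of_le_ne_top hsol.bounded.ne
      (biSup_mono fun s hs => ⟨hs.1, hs.2.trans ht.2⟩)
  have hp := Boltzmann.one_lt_pExp hγ hγ'
  have hp0 : 0 < Boltzmann.pExp γ := by linarith
  have hθ0 : 0 ≤ 1 / Boltzmann.pExp γ := by positivity
  have hθ1 : 1 / Boltzmann.pExp γ ≤ 1 := by rw [div_le_one hp0]; exact hp.le
  filter_upwards [Boltzmann.lintegral_enorm_le_of_mild hb hC₁.le hμ hsol ht hH hf]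
    with x hx lam m N hlam hm hN
  obtain ⟨hA0, hA1⟩ := hA N hN
  obtain ⟨hS, hS'⟩ := hA1 t _ _ f hf ht.1 hE x
  -- The terms in `m` and in `N ^ (β - 3)` enter only through their nonnegativity.
  have hr : lam + 1 / N ≤ m ^ (3 + γ) + 1 * (lam + 1 / N + 1 / N ^ (β - 3)) := by
    have h1 : 0 ≤ m ^ (3 + γ) := by positivity
    have h2 : 0 ≤ 1 / N ^ (β - 3) := by positivity
    linarith
  refine hx.trans ?_
  refine (add_le_add le_rfl (Boltzmann.add_mul_le_of_bounds hC hC₁ hA0 hlam hN hE hθ0 hθ1 hS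
    (hS' lam hlam) hr)).trans ?_
  simp only [← add_assoc]
  refine add_le_add (add_le_add le_rfl (mul_le_mul' le_rfl ?_)) (mul_le_mul' le_rfl ?_)
  · exact Boltzmann.iSup_add_sq_le (fun s => s ∈ Set.Icc 0 t)
      fun s => Boltzmann.weightedNorm β (f s)
  · exact Boltzmann.iSup_rpow_le (fun s => s ∈ Set.Icc 0 t)
      (fun s => Boltzmann.weightedNorm β (f s)) (by positivity)
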